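/- Homology is simplicial homology with coefficients in $\mathbb{Z}/2$. For a finite simplicial complex $M\subset\mathbb{R}^d$, a unit vector $v\in S^{d-1}$ and $r\in\mathbb{R}$, let $M(v)_r$ be the subcomplex of all simplices $\Delta$ of $M$ with $x\cdot v\le r$ for all $x\in\Delta$. Let $X_k(M,v)$ be the $k$-th persistence diagram of the filtration $(M(v)_r)_{r\in\mathbb{R}}$: the multiset of points $(a,b)$ with $a\in\{-\infty\}\cup\mathbb{R}$, $b\in\mathbb{R}\cup\{\infty\}$, $a<b$, in which $(a,b)$ has as multiplicity the dimension of the space of $k$-dimensional homology classes that are born at $a$ and die at $b$ ($b=\infty$ for classes that never die); the copies of the diagonal, which all diagrams share, are omitted. Proposition. Let $M$ be a finite simplicial complex in $\mathbb{R}^3$ whose underlying space is homeomorphic to $S^2$ or $S^1$, or one in $\mathbb{R}^2$ whose underlying space is homeomorphic to $S^1$. Then, for every unit vector $v$, the diagrams $X_1(M,v)$ and $X_2(M,v)$ can be constructed from $X_0(M,v)$ and $X_0(M,-v)$ (in fact from the latter alone), by a rule that depends only on whether $M$ is homeomorphic to $S^2$ or to $S^1$. Explicitly, let $\lambda$ be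 the smallest $x$ such that $(x,\infty)\in X_0(M,-v)$. 1. If $M\subset\mathbb{R}^3$ is homeomorphic to $S^2$, then $X_2(M,v)$ consists of the single point $(-\lambda,\infty)$, and $X_1(M,v)$ is obtained from $X_0(M,-v)$ by discarding the essential points $(x,\infty)$ and replacing every other point $(a,b)$ by $(-b,-a)$, with the same multiplicity. 2. If $M\subset\mathbb{R}^3$ or $M\subset\mathbb{R}^2$ is homeomorphic to $S^1$, then $X_1(M,v)$ consists of the single point $(-\lambda,\infty)$, and $X_2(M,v)$ is empty. -/

import Mathlib

namespace PHT

open Geometry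

noncomputable section

/-- The dimension of the quotient space `N / D`, for subspaces `D ≤ N` of a vector space. -/
def quotientDim {F V : Type*} [Field F] [AddCommGroup V] [Module F V] (N D : Submodule F V) : ℕ :=
  Module.finrank F (N ⧸ D.submoduleOf N)

/-! ### Simplicial homology with coefficients in `ℤ/2` -/

section Homology

variable {E : Type*} [NormedAddCommGroup E] [InnerProductSpace ℝ E]

/-- Formal `ℤ/2`-linear combinations of finite point sets; the chains of every simplicial complex
in `E` are among them. -/
abbrev FormalChain (E : Type*) : Type _ := Finset E →₀ ZMod 2

open scoped Classical in
/-- The boundary map: a simplex goes to the sum of its (nonempty) faces of codimension one.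
In particular the boundary of a single vertex is `0`. There are no signs, as `-1 = 1`. -/
def boundaryMap (E : Type*) : FormalChain E →ₗ[ZMod 2] FormalChain E :=
  Finsupp.linearCombination (ZMod 2) fun s : Finset E =>
    ∑ x ∈ s with (s.erase x).Nonempty, Finsupp.single (s.erase x) (1 : ZMod 2)

/-- `C_k(K)`: formal combinations of the `k`-simplices of `K`. -/
def chains (K : SimplicialComplex ℝ E) (k : ℕ) : Submodule (ZMod 2) (FormalChain E) :=
  Finsupp.supported (ZMod 2) (ZMod 2) {s | s ∈ K.faces ∧ s.card = k + 1}

/-- `Z_k(K)`: the `k`-cycles of `K`. -/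
def cycles (K : SimplicialComplex ℝ E) (k : ℕ) : Submodule (ZMod 2) (FormalChain E) :=
  chains K k ⊓ LinearMap.ker (boundaryMap E)

/-- `B_k(K)`: the `k`-boundaries of `K`. -/
def boundaries (K : SimplicialComplex ℝ E) (k : ℕ) : Submodule (ZMod 2) (FormalChain E) :=
  (chains K (k + 1)).map (boundaryMap E)

/-! ### The height filtration -/

/-- The full subcomplex of `K` on the vertices that satisfy `P`. -/
def fullSubcomplex (K : SimplicialComplex ℝ E) (P : E → Prop) : SimplicialComplex ℝ E where
  faces := {s | s ∈ K.faces ∧ ∀ x ∈ s, P x}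
  isRelLowerSet_faces := by
    intro s hs
    exact ⟨K.nonempty_of_mem_faces hs.1, fun t hts ht =>
      ⟨K.down_closed hs.1 hts ht, fun x hx => hs.2 x (hts hx)⟩⟩
  indep hs := K.indep hs.1
  inter_subset_convexHull hs ht := K.inter_subset_convexHull hs.1 ht.1

/-- The height of `x` in direction `v`. -/
def height (v x : E) : EReal := ((inner ℝ x v : ℝ) : EReal)

/-- `M(v)_r`: the subcomplex of all simplices of `M` that lie entirely at height at most `r` in
direction `v` (for a simplex it is enough to test its vertices). At `r = ∞` it is all of `M`. -/
def sublevel (M : SimplicialComplex ℝ E) (v : E) (r : EReal) : SimplicialComplex ℝ E :=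
  fullSubcomplex M fun x => height v x ≤ r

/-- The union of the `M(v)_t` over all `t < r`: the simplices that lie entirely strictly below
height `r`. At `r = ∞` it is all of `M`. -/
def strictSublevel (M : SimplicialComplex ℝ E) (v : E) (r : EReal) : SimplicialComplex ℝ E :=
  fullSubcomplex M fun x => height v x < r

/-- The chains that count as dead at time `b`: the boundaries of `M(v)_b` if `b` is finite. Every
class counts as dead at time `∞`, so that the essential classes are those that die at `∞` but are
not dead at any earlier stage. -/
def deadAt (M : SimplicialComplex ℝ E) (v : E) (k : ℕ) (b : EReal) :
    Submodule (ZMod 2) (FormalChain E) :=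
  if b = ⊤ then ⊤ else boundaries (sublevel M v b) k

/-- The `k`-cycles present at time `a` that are dead at time `b`. -/
def dyingCycles (M : SimplicialComplex ℝ E) (v : E) (k : ℕ) (a b : EReal) :
    Submodule (ZMod 2) (FormalChain E) :=
  cycles (sublevel M v a) k ⊓ deadAt M v k b

/-- Those of `dyingCycles` that come from cycles present already before time `a`, or that are
dead already before time `b`, and their sums. -/
def earlierCycles (M : SimplicialComplex ℝ E) (v : E) (k : ℕ) (a b : EReal) :
    Submodule (ZMod 2) (FormalChain E) :=
  (cycles (strictSublevel M v a) k ⊓ deadAt M v k b) ⊔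
    (cycles (sublevel M v a) k ⊓ boundaries (strictSublevel M v b) k)

end Homology

/-! ### Persistence diagrams -/

/-- The points `(a, b)` with `a ∈ {-∞} ∪ ℝ`, `b ∈ ℝ ∪ {∞}` and `a < b`. -/
abbrev OffDiagonal : Type := {p : EReal × EReal // p.1 < p.2}

/-- A persistence diagram, given by the multiplicities of its off-diagonal points. (The countably
many copies of the diagonal are the same for all diagrams and carry no information.) -/
abbrev PersistenceDiagram : Type := OffDiagonal → ℕ

/-- `X_k(M, v)`: the multiplicity of `(a, b)` is the dimension of the space of `k`-dimensional
homology classes, over `ℤ/2`, that are born at time `a` and die at time `b` in the filtration of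
`M` by height in direction `v`. -/
def persistenceDiagram {E : Type*} [NormedAddCommGroup E] [InnerProductSpace ℝ E]
    (k : ℕ) (M : SimplicialComplex ℝ E) (v : E) : PersistenceDiagram := fun p =>
  quotientDim (dyingCycles M v k p.1.1 p.1.2) (earlierCycles M v k p.1.1 p.1.2)

namespace PersistenceDiagram

/-- The smallest `x` such that `(x, ∞)` is a point of `D`. -/
def essentialBirth (D : PersistenceDiagram) : EReal :=
  sInf {x | ∃ hx : x < ⊤, 0 < D ⟨(x, ⊤), hx⟩}

open scoped Classical in
/-- The diagram whose only point is `(-x, ∞)`, where `(x, ∞)` is the first essential point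
of `D`. -/
def oppositeEssential (D : PersistenceDiagram) : PersistenceDiagram := fun p =>
  if p.1 = (-D.essentialBirth, ⊤) then 1 else 0

open scoped Classical in
/-- Discard the essential points `(x, ∞)` of `D` and replace every other point `(a, b)` by
`(-b, -a)`. The multiplicity of `(s, t)` in the result is thus that of `(-t, -s)` in `D`,
unless `-s = ∞`. -/
def flip (D : PersistenceDiagram) : PersistenceDiagram := fun p =>
  if p.1.1 = ⊥ then 0 else D ⟨(-p.1.2, -p.1.1), EReal.neg_lt_neg_iff.mpr p.2⟩

/-- The diagram without off-diagonal points. -/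
def empty : PersistenceDiagram := fun _ => 0

end PersistenceDiagram

end

end PHT

namespace PHT

open Filter Topology Set

/-! Sublevel complexes for `v` and for `-v` are full subcomplexes on complementary vertex sets, so
the statement about `X_1` of a sphere is an Alexander duality. For vertex conditions `P ⊆ Q`, the
one-cycles in `P` that bound in `Q` are compared with the zero-chains off `Q` that bound off `P`. A
2-chain whose boundary lies in `P` is constant on the triangles around each vertex off `P`. It is
therefore a locally constant function on the vertices off `P`, and it pairs with zero-chains.
Equality of left and right rank gives `IsHomologySphere.subDim_duality`. A multiplicity in a
persistence diagram is a second difference of dimensions of `Z ⊓ B`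
(`quotientDim_second_difference`), and in it the terms that depend on `P` alone or on `Q` alone
cancel.

In the top dimension the only nonzero cycle contains all facets. It appears when the highest vertex
enters and never bounds, while the essential zero-class for `-v` is born at that same vertex
(`HasFundamentalCycle.persistenceDiagram_eq`).

What remains is to extract the combinatorics (`HasFundamentalCycle`, `IsHomologySphere`) from the
homeomorphism type. The only topological input is `IsPuncturedSpace`: removing any point leaves a
copy of `ℂ` or `ℝ`. Vanishing statements come from Alexander–Spanier one-cocycles modulo 2, which
are trivial on star-shaped sets. They pass to simplicial homology through maps sending points to
vertices, and the space without the barycentre of `σ` maps in this way to the complex without the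
open star of `σ`. Nonvanishing statements come from square roots: the sign ambiguity of a root of a
nonvanishing complex function is a local cocycle, so a trivial cocycle yields a continuous root, but
the identity has none on a circle about the origin. This excludes tetrahedra (`card_ne_four`) and
shows that a nonzero 2-cycle contains every triangle (`cycle_apply_ne_zero`). For circles the order
of the real line takes the place of square roots. -/

/-! ### Local one-cocycles with values in `ℤ/2` -/

section LocalCocycles

variable {X : Type*} [TopologicalSpace X]

/-- On a neighbourhood of every point of `S`, the function `g` is the coboundary of some `f`. -/
def LocallyCoboundary (S : Set X) (g : X → X → ZMod 2) : Prop :=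
  ∀ x ∈ S, ∃ U ∈ 𝓝[S] x, ∃ f : X → ZMod 2, ∀ a ∈ U, ∀ b ∈ U, g a b = f a + f b

/-- On a neighbourhood of every point of `S`, the function `g` is the coboundary of `f`. -/
def CoboundaryNear (S : Set X) (g : X → X → ZMod 2) (f : X → ZMod 2) : Prop :=
  ∀ x ∈ S, ∃ U ∈ 𝓝[S] x, ∀ a ∈ U, ∀ b ∈ U, g a b = f a + f b

/-- The first Alexander–Spanier cohomology of `S` with coefficients in `ℤ/2` vanishes. -/
def H1Trivial (S : Set X) : Prop :=
  ∀ g, LocallyCoboundary S g → ∃ f, CoboundaryNear S g f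

theorem LocallyCoboundary.mono {S T : Set X} {g : X → X → ZMod 2} (h : LocallyCoboundary S g)
    (hTS : T ⊆ S) : LocallyCoboundary T g := fun x hx =>
  let ⟨U, hU, f, hf⟩ := h x (hTS hx)
  ⟨U, nhdsWithin_mono x hTS hU, f, hf⟩

theorem CoboundaryNear.mono {S T : Set X} {g : X → X → ZMod 2} {f : X → ZMod 2}
    (h : CoboundaryNear S g f) (hTS : T ⊆ S) : CoboundaryNear T g f := fun x hx =>
  let ⟨U, hU, hf⟩ := h x (hTS hx)
  ⟨U, nhdsWithin_mono x hTS hU, hf⟩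

theorem LocallyCoboundary.comp {Y : Type*} [TopologicalSpace Y] {S : Set X} {T : Set Y}
    {g : X → X → ZMod 2} (h : LocallyCoboundary S g) {φ : Y → X} (hφ : ContinuousOn φ T)
    (hm : MapsTo φ T S) : LocallyCoboundary T fun a b => g (φ a) (φ b) := fun y hy =>
  let ⟨U, hU, f, hf⟩ := h (φ y) (hm hy)
  ⟨φ ⁻¹' U, (hφ y hy).tendsto_nhdsWithin hm hU, f ∘ φ, fun _ ha _ hb => hf _ ha _ hb⟩

theorem CoboundaryNear.comp {Y : Type*} [TopologicalSpace Y] {S : Set X} {T : Set Y}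
    {g : X → X → ZMod 2} {f : X → ZMod 2} (h : CoboundaryNear S g f) {φ : Y → X}
    (hφ : ContinuousOn φ T) (hm : MapsTo φ T S) :
    CoboundaryNear T (fun a b => g (φ a) (φ b)) (f ∘ φ) := fun y hy =>
  let ⟨U, hU, hf⟩ := h (φ y) (hm hy)
  ⟨φ ⁻¹' U, (hφ y hy).tendsto_nhdsWithin hm hU, fun _ ha _ hb => hf _ ha _ hb⟩

theorem CoboundaryNear.congr {S : Set X} {g g' : X → X → ZMod 2} {f : X → ZMod 2}
    (h : CoboundaryNear S g f) (hg : ∀ a ∈ S, ∀ b ∈ S, g a b = g' a b) :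
    CoboundaryNear S g' f := fun x hx =>
  let ⟨U, hU, hf⟩ := h x hx
  ⟨U ∩ S, inter_mem hU self_mem_nhdsWithin, fun a ha b hb => by
    rw [← hg a ha.2 b hb.2, hf a ha.1 b hb.1]⟩

/-- A locally constant function on a preconnected set is constant. -/
theorem eq_of_isPreconnected {S : Set X} (hS : IsPreconnected S) {Y : Type*} {f : X → Y}
    (hf : ∀ x ∈ S, ∃ U ∈ 𝓝[S] x, ∀ a ∈ U, f a = f x) {x y : X} (hx : x ∈ S) (hy : y ∈ S) :
    f x = f y := by
  let : TopologicalSpace Y := ⊥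
  have : DiscreteTopology Y := ⟨rfl⟩
  refine hS.constant (f := f) (fun z hz => ?_) hx hy
  obtain ⟨U, hU, h⟩ := hf z hz
  exact (tendsto_const_nhds (x := f z)).congr' (by filter_upwards [hU] with a ha using (h a ha).symm)

theorem zmod_two_add_cancel (a : ZMod 2) : a + a = 0 := CharTwo.add_self_eq_zero a

/-- Two primitives of the same local cocycle differ by a locally constant function. -/
theorem CoboundaryNear.add_eq {S : Set X} {g : X → X → ZMod 2} {f f' : X → ZMod 2}
    (h : CoboundaryNear S g f) (h' : CoboundaryNear S g f') (hS : IsPreconnected S) {x y : X}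
    (hx : x ∈ S) (hy : y ∈ S) : f x + f' x = f y + f' y := by
  refine eq_of_isPreconnected hS (f := fun z => f z + f' z) (fun z hz => ?_) hx hy
  obtain ⟨U, hU, hf⟩ := h z hz
  obtain ⟨V, hV, hf'⟩ := h' z hz
  refine ⟨U ∩ V, inter_mem hU hV, fun a ha => ?_⟩
  have hzU := mem_of_mem_nhdsWithin hz hU
  have hzV := mem_of_mem_nhdsWithin hz hV
  have h1 := hf a ha.1 z hzU
  have h2 := hf' a ha.2 z hzV
  rw [h1] at h2
  clear h1
  generalize f a = p at *
  generalize f z = q at *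
  generalize f' a = r at *
  generalize f' z = s at *
  revert p q r s; decide

theorem CoboundaryNear.add_const {S : Set X} {g : X → X → ZMod 2} {f : X → ZMod 2}
    (h : CoboundaryNear S g f) (c : ZMod 2) : CoboundaryNear S g fun x => f x + c := fun x hx =>
  let ⟨U, hU, hf⟩ := h x hx
  ⟨U, hU, fun a ha b hb => by rw [hf a ha b hb, add_add_add_comm, zmod_two_add_cancel, add_zero]⟩

/-- A function that is a coboundary on two relatively open sets with connected intersection, is
a coboundary on their union. -/
theorem exists_coboundaryNear_union {S O₁ O₂ : Set X} {g : X → X → ZMod 2} (h₁ : IsOpen O₁)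
    (h₂ : IsOpen O₂) (hS : S ⊆ O₁ ∪ O₂) (hc : IsPreconnected (S ∩ O₁ ∩ O₂))
    {f₁ f₂ : X → ZMod 2} (hf₁ : CoboundaryNear (S ∩ O₁) g f₁)
    (hf₂ : CoboundaryNear (S ∩ O₂) g f₂) : ∃ f, CoboundaryNear S g f := by
  classical
  -- Mayer–Vietoris: on the connected overlap the primitives differ by a single constant, which `f₂`
  -- can absorb.
  obtain ⟨c, hcc⟩ : ∃ c, ∀ x ∈ S ∩ O₁ ∩ O₂, f₁ x = f₂ x + c := by
    rcases (S ∩ O₁ ∩ O₂).eq_empty_or_nonempty with he | ⟨y, hy⟩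
    · exact ⟨0, by simp [he]⟩
    · refine ⟨f₁ y + f₂ y, fun x hx => ?_⟩
      have := (hf₁.mono inter_subset_left).add_eq (hf₂.mono (T := S ∩ O₁ ∩ O₂)
        fun z hz => ⟨hz.1.1, hz.2⟩) hc hx hy
      rw [← this, add_comm (f₁ x), ← add_assoc, zmod_two_add_cancel, zero_add]
  refine ⟨fun x => if x ∈ O₁ then f₁ x else f₂ x + c, fun x hx => ?_⟩
  have key : ∀ O f, IsOpen O → x ∈ O → CoboundaryNear (S ∩ O) g f →
      (∀ y ∈ S ∩ O, f y = if y ∈ O₁ then f₁ y else f₂ y + c) → ∃ U ∈ 𝓝[S] x, ∀ a ∈ U, ∀ b ∈ U,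
        g a b = (if a ∈ O₁ then f₁ a else f₂ a + c) + (if b ∈ O₁ then f₁ b else f₂ b + c) := by
    intro O f hO hxO hf he
    obtain ⟨U, hU, h⟩ := hf x ⟨hx, hxO⟩
    rw [nhdsWithin_inter_of_mem' (mem_nhdsWithin_of_mem_nhds (hO.mem_nhds hxO))] at hU
    refine ⟨U ∩ (S ∩ O), inter_mem hU (inter_mem self_mem_nhdsWithin
      (mem_nhdsWithin_of_mem_nhds (hO.mem_nhds hxO))), fun a ha b hb => ?_⟩
    rw [← he a ha.2, ← he b hb.2, h a ha.1 b hb.1]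
  rcases hS hx with h | h
  · exact key O₁ f₁ h₁ h hf₁ fun y hy => by simp [hy.2]
  · refine key O₂ _ h₂ h (hf₂.add_const c) fun y hy => ?_
    split_ifs with hy1
    · exact (hcc y ⟨⟨hy.1, hy1⟩, hy.2⟩).symm
    · rfl

/-- Only `ψ ∘ φ = id` on `S` is needed: a primitive of the pullback along `ψ` is pulled back along
`φ`. -/
theorem H1Trivial.of_homeo {Y : Type*} [TopologicalSpace Y] {S : Set X} {T : Set Y}
    (hT : H1Trivial T) {φ : X → Y} {ψ : Y → X} (hφ : ContinuousOn φ S) (hψ : ContinuousOn ψ T)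
    (hφm : MapsTo φ S T) (hψm : MapsTo ψ T S) (h : ∀ x ∈ S, ψ (φ x) = x) : H1Trivial S := by
  intro g hg
  obtain ⟨f, hf⟩ := hT _ (hg.comp hψ hψm)
  exact ⟨f ∘ φ, (hf.comp hφ hφm).congr fun a ha b hb => by rw [h a ha, h b hb]⟩

end LocalCocycles

theorem sum_range_add_succ_zmod_two (k : ℕ → ZMod 2) (n : ℕ) :
    ∑ i ∈ Finset.range n, (k i + k (i + 1)) = k 0 + k n := by
  induction n with
  | zero => simp [zmod_two_add_cancel]
  | succ n ih =>
    rw [Finset.sum_range_succ, ih, add_assoc, ← add_assoc (k n), zmod_two_add_cancel, zero_add]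

/-- Star-shaped sets have trivial first cohomology. -/
theorem StarConvex.h1Trivial {E : Type*} [NormedAddCommGroup E] [NormedSpace ℝ E] {S : Set E}
    {p : E} (hS : StarConvex ℝ p S) : H1Trivial S := by
  intro g hg
  -- The primitive at `a` is the integral of `g` along the segment from `p` to `a`, approximated by
  -- the sum `s n a` over `n` equal steps.
  set H : ℝ → E → E := fun t a => AffineMap.lineMap p a t with hH
  have hHS : ∀ t ∈ Icc (0 : ℝ) 1, ∀ a ∈ S, H t a ∈ S := fun t ht a ha =>
    hS.segment_subset ha (by rw [segment_eq_image_lineMap]; exact ⟨t, ht, rfl⟩)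
  let s : ℕ → E → ZMod 2 := fun n a =>
    ∑ i ∈ Finset.range n, g (H (i / n) a) (H ((i + 1 : ℕ) / n) a)
  -- the sums vary correctly near every point, for all large `n`
  have main : ∀ x ∈ S, ∃ V ∈ 𝓝[S] x, ∃ N : ℕ, ∀ n ≥ N, ∀ a ∈ V, ∀ b ∈ V,
      s n a + s n b = g a b := by
    intro x hx
    have hx' : ∀ t : Icc (0 : ℝ) 1, ∃ O : Set E, IsOpen O ∧ H t x ∈ O ∧
        ∃ f : E → ZMod 2, ∀ a ∈ O ∩ S, ∀ b ∈ O ∩ S, g a b = f a + f b := by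
      intro t
      obtain ⟨U, hU, f, hf⟩ := hg (H t x) (hHS t t.2 x hx)
      obtain ⟨O, hO, hxO, hOU⟩ := mem_nhdsWithin.1 hU
      exact ⟨O, hO, hxO, f, fun a ha b hb => hf a (hOU ha) b (hOU hb)⟩
    choose O hO hxO F hF using hx'
    have hcomp : IsCompact ((fun t => H t x) '' Icc (0 : ℝ) 1) :=
      isCompact_Icc.image (by simp only [hH]; exact AffineMap.lineMap_continuous)
    -- For large `n`, the four ends of two corresponding steps on the segments to `a` and `b` near
    -- `x` lie in a common `O t`. There `g` is a coboundary, so opposite sides of the quadrilateral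
    -- have equal sums and the total telescopes.
    obtain ⟨δ, hδ, hleb⟩ := lebesgue_number_lemma_of_metric hcomp hO (by
      rintro _ ⟨t, ht, rfl⟩
      exact mem_iUnion.2 ⟨⟨t, ht⟩, hxO ⟨t, ht⟩⟩)
    obtain ⟨N, hN⟩ := exists_nat_gt (‖x - p‖ / (δ / 2))
    refine ⟨Metric.ball x (δ / 2) ∩ S, inter_mem (mem_nhdsWithin_of_mem_nhds
      (Metric.ball_mem_nhds x (by positivity))) self_mem_nhdsWithin, N + 1, fun n hn a ha b hb => ?_⟩
    have hn0 : (0 : ℝ) < n := by exact_mod_cast (show 0 < n by omega)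
    have hnN : ‖x - p‖ / n < δ / 2 := by
      rw [div_lt_iff₀ hn0]
      rw [div_lt_iff₀ (by positivity)] at hN
      have : (N : ℝ) < n := by exact_mod_cast hn
      nlinarith
    have hdist : ∀ (t t' : ℝ) (c : E), t ∈ Icc (0 : ℝ) 1 → |t - t'| ≤ 1 / n →
        c ∈ Metric.ball x (δ / 2) → H t c ∈ Metric.ball (H t' x) δ := by
      intro t t' c ht htt hc
      rw [mem_ball_iff_norm] at hc ⊢
      have e : H t c - H t' x = t • (c - x) + (t - t') • (x - p) := by
        simp only [hH, AffineMap.lineMap_apply, vsub_eq_sub, vadd_eq_add]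
        module
      rw [e]
      calc _ ≤ ‖t • (c - x)‖ + ‖(t - t') • (x - p)‖ := norm_add_le _ _
        _ = |t| * ‖c - x‖ + |t - t'| * ‖x - p‖ := by simp [norm_smul]
        _ ≤ 1 * ‖c - x‖ + 1 / n * ‖x - p‖ := by
          gcongr
          rw [abs_of_nonneg ht.1]; exact ht.2
        _ < δ := by rw [one_mul, one_div_mul_eq_div]; linarith
    have hI : ∀ i ≤ n, ((i : ℝ) / n) ∈ Icc (0 : ℝ) 1 := fun i hi =>
      ⟨by positivity, by rw [div_le_one hn0]; exact_mod_cast hi⟩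
    have hstep : ∀ i ∈ Finset.range n, g (H (i / n) a) (H ((i + 1 : ℕ) / n) a) +
        g (H (i / n) b) (H ((i + 1 : ℕ) / n) b) =
        g (H (i / n) a) (H (i / n) b) + g (H ((i + 1 : ℕ) / n) a) (H ((i + 1 : ℕ) / n) b) := by
      intro i hi
      have hi := Finset.mem_range.1 hi
      obtain ⟨t, ht⟩ := hleb (H (i / n) x) ⟨_, hI i hi.le, rfl⟩
      have m : ∀ c ∈ Metric.ball x (δ / 2) ∩ S, H (i / n) c ∈ O t ∩ S ∧
          H ((i + 1 : ℕ) / n) c ∈ O t ∩ S := fun c hc =>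
        ⟨⟨ht (hdist _ _ c (hI i hi.le) (by simp) hc.1), hHS _ (hI i hi.le) c hc.2⟩,
          ⟨ht (hdist _ _ c (hI (i + 1) hi) (by
            push_cast
            rw [← sub_div, add_sub_cancel_left, abs_of_pos (by positivity)]) hc.1),
            hHS _ (hI (i + 1) hi) c hc.2⟩⟩
      rw [hF t _ (m a ha).1 _ (m a ha).2, hF t _ (m b hb).1 _ (m b hb).2,
        hF t _ (m a ha).1 _ (m b hb).1, hF t _ (m a ha).2 _ (m b hb).2]
      abel
    have hp : g p p = 0 := by
      obtain ⟨U, hU, f, hf⟩ := hg p (by simpa [hH] using hHS 0 (by simp) x hx)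
      have hpU : p ∈ U := mem_of_mem_nhdsWithin (by simpa [hH] using hHS 0 (by simp) x hx) hU
      rw [hf p hpU p hpU, zmod_two_add_cancel]
    simp only [s]
    rw [← Finset.sum_add_distrib, Finset.sum_congr rfl hstep,
      sum_range_add_succ_zmod_two fun i : ℕ => g (H (i / n) a) (H (i / n) b)]
    simp [hH, hn0.ne', hp]
  classical
  -- The bound `N` depends on `x`, so no single `n` works everywhere, and `s n a` need not
  -- stabilise. An ultrafilter limit selects one value at each point and preserves the relation
  -- between nearby points.
  let u : Ultrafilter ℕ := hyperfilter ℕ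
  let f : E → ZMod 2 := fun a => if ∀ᶠ n in u, s n a = 0 then 0 else 1
  have hf : ∀ a, ∀ᶠ n in u, s n a = f a := by
    intro a
    by_cases h : ∀ᶠ n in u, s n a = 0
    · simp [f, h]
    · simp only [f, h, if_false]
      filter_upwards [Ultrafilter.eventually_not.2 h] with n hn
      generalize s n a = c at *
      revert c; decide
  refine ⟨f, fun x hx => ?_⟩
  obtain ⟨V, hV, N, hN⟩ := main x hx
  refine ⟨V, hV, fun a ha b hb => ?_⟩
  have hlarge : ∀ᶠ n in (u : Filter ℕ), N ≤ n :=
    Nat.hyperfilter_le_atTop (eventually_ge_atTop N)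
  obtain ⟨n, h1, h2, h3⟩ := (hlarge.and ((hf a).and (hf b))).exists
  rw [← h2, ← h3, hN n h1 a ha b hb]

theorem Convex.h1Trivial {E : Type*} [NormedAddCommGroup E] [NormedSpace ℝ E] {S : Set E}
    (hS : Convex ℝ S) : H1Trivial S := by
  rcases S.eq_empty_or_nonempty with rfl | ⟨p, hp⟩
  · exact fun g _ => ⟨0, fun x hx => hx.elim⟩
  · exact StarConvex.h1Trivial (hS hp)

/-! ### Square roots of nonvanishing functions -/

section SquareRoots

theorem zmod_two_cases (e : ZMod 2) : e = 0 ∨ e = 1 := by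
  revert e; decide

/-- The sign `±1` of an element of `ℤ/2`. -/
noncomputable def sign (e : ZMod 2) : ℂ := if e = 0 then 1 else -1

theorem sign_add (e f : ZMod 2) : sign (e + f) = sign e * sign f := by
  rcases zmod_two_cases e with rfl | rfl <;> rcases zmod_two_cases f with rfl | rfl <;>
    simp [sign, zmod_two_add_cancel]

theorem sign_sq (e : ZMod 2) : sign e ^ 2 = 1 := by
  unfold sign
  split_ifs <;> norm_num

/-- The principal square root of `ζ`. -/
noncomputable def principalRoot {X : Type*} (ζ : X → ℂ) (x : X) : ℂ := ζ x ^ (1 / 2 : ℂ)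

theorem principalRoot_sq {X : Type*} (ζ : X → ℂ) (x : X) : principalRoot ζ x ^ 2 = ζ x := by
  rw [principalRoot, ← Complex.cpow_nat_mul]
  norm_num

open scoped Classical in
/-- The local cocycle that compares the signs of the principal square roots of `ζ` at two nearby
points. -/
noncomputable def rootCocycle {X : Type*} (ζ : X → ℂ) (a b : X) : ZMod 2 :=
  if 0 < (principalRoot ζ a * star (principalRoot ζ b)).re then 0 else 1

variable {X : Type*} [TopologicalSpace X]

/-- Near `x` the quotient `ζ a / ζ x` is close to `1`, where the principal root is continuous; this
gives a continuous branch `τ`. The function `e` records where the principal root of `ζ` is `-τ`.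
Nearby values of `τ` have positive real inner product, so the root cocycle sees only these signs. -/
theorem exists_local_root {S : Set X} {ζ : X → ℂ} (hζ : ContinuousOn ζ S)
    (h0 : ∀ x ∈ S, ζ x ≠ 0) {x : X} (hx : x ∈ S) :
    ∃ τ : X → ℂ, ContinuousWithinAt τ S x ∧ ∃ U ∈ 𝓝[S] x, ∃ e : X → ZMod 2,
      (∀ a ∈ U, principalRoot ζ a = sign (e a) * τ a) ∧
        ∀ a ∈ U, ∀ b ∈ U, rootCocycle ζ a b = e a + e b := by
  classical
  have hr0 : principalRoot ζ x ≠ 0 := fun h => h0 x hx (by rw [← principalRoot_sq ζ x, h]; simp)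
  let τ : X → ℂ := fun a => principalRoot ζ x * (ζ a / ζ x) ^ (1 / 2 : ℂ)
  have hτ : ContinuousWithinAt τ S x := by
    refine continuousWithinAt_const.mul (ContinuousWithinAt.cpow ((hζ x hx).div_const _)
      continuousWithinAt_const ?_)
    rw [div_self (h0 x hx)]
    simp
  have hτx : τ x = principalRoot ζ x := by simp [τ, div_self (h0 x hx)]
  have hτsq : ∀ a, τ a ^ 2 = ζ a := by
    intro a
    simp only [τ]
    rw [mul_pow, principalRoot_sq, ← Complex.cpow_nat_mul]
    norm_num
    exact mul_div_cancel₀ _ (h0 x hx)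
  have hpos : ∀ᶠ p : X × X in 𝓝[S] x ×ˢ 𝓝[S] x, 0 < (τ p.1 * star (τ p.2)).re := by
    have h1 : Tendsto (fun p : X × X => (τ p.1 * star (τ p.2)).re) (𝓝[S] x ×ˢ 𝓝[S] x)
        (𝓝 (τ x * star (τ x)).re) :=
      (Complex.continuous_re.tendsto _).comp ((hτ.tendsto.comp tendsto_fst).mul
        ((continuous_star.tendsto _).comp (hτ.tendsto.comp tendsto_snd)))
    refine h1.eventually (lt_mem_nhds ?_)
    rw [hτx]
    simp only [Complex.star_def, Complex.mul_conj, Complex.ofReal_re]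
    exact Complex.normSq_pos.2 hr0
  obtain ⟨U, hU, hUp⟩ := (eventually_prod_self_iff (r := fun a b => 0 < (τ a * star (τ b)).re)).1 hpos
  let e : X → ZMod 2 := fun a => if principalRoot ζ a = τ a then 0 else 1
  have he : ∀ a, principalRoot ζ a = sign (e a) * τ a := by
    intro a
    by_cases h : principalRoot ζ a = τ a
    · simp [e, h, sign]
    · have : principalRoot ζ a = -τ a := by
        have h2 : principalRoot ζ a ^ 2 = τ a ^ 2 := by rw [principalRoot_sq, hτsq]
        exact (sq_eq_sq_iff_eq_or_eq_neg.1 h2).resolve_left h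
      simp [e, sign, this]
  refine ⟨τ, hτ, U, hU, e, fun a _ => he a, fun a ha b hb => ?_⟩
  have hab := hUp a ha b hb
  unfold rootCocycle
  rw [he a, he b]
  generalize e a = p
  generalize e b = q
  have hab' : 0 < (τ a * (starRingEnd ℂ) (τ b)).re := hab
  simp only [Complex.mul_re, Complex.conj_re, Complex.conj_im] at hab'
  rcases zmod_two_cases p with rfl | rfl <;> rcases zmod_two_cases q with rfl | rfl <;>
    simp [sign, zmod_two_add_cancel] <;> linarith

theorem locallyCoboundary_rootCocycle {S : Set X} {ζ : X → ℂ} (hζ : ContinuousOn ζ S)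
    (h0 : ∀ x ∈ S, ζ x ≠ 0) : LocallyCoboundary S (rootCocycle ζ) := fun _ hx =>
  let ⟨_, _, U, hU, e, _, h⟩ := exists_local_root hζ h0 hx
  ⟨U, hU, e, h⟩

/-- Both `f` and the local sign `e` are primitives of the root cocycle, so `f + e` is constant near
each point. Correcting the principal root by `f` hence yields a continuous branch up to a constant
sign. -/
theorem exists_sqrt_of_coboundaryNear {S : Set X} {ζ : X → ℂ} (hζ : ContinuousOn ζ S)
    (h0 : ∀ x ∈ S, ζ x ≠ 0) {f : X → ZMod 2} (hf : CoboundaryNear S (rootCocycle ζ) f) :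
    ∃ σ : X → ℂ, ContinuousOn σ S ∧ ∀ x, σ x ^ 2 = ζ x := by
  refine ⟨fun x => sign (f x) * principalRoot ζ x, fun x hx => ?_, fun x => by
    rw [mul_pow, sign_sq, one_mul, principalRoot_sq]⟩
  obtain ⟨τ, hτ, U, hU, e, he, hee⟩ := exists_local_root hζ h0 hx
  obtain ⟨V, hV, hfV⟩ := hf x hx
  have hxU := mem_of_mem_nhdsWithin hx hU
  have hxV := mem_of_mem_nhdsWithin hx hV
  have key : ∀ a ∈ U ∩ V,
      sign (f a) * principalRoot ζ a = sign (f x + e x) * τ a := by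
    intro a ha
    have h : f a + e a = f x + e x := by
      have h1 := hfV a ha.2 x hxV
      rw [hee a ha.1 x hxU] at h1
      generalize f a = p at *
      generalize f x = q at *
      generalize e a = r at *
      generalize e x = s at *
      clear * - h1
      revert p q r s; decide
    rw [he a ha.1, ← mul_assoc, ← sign_add, h]
  have : ContinuousWithinAt (fun a => sign (f x + e x) * τ a) S x := continuousWithinAt_const.mul hτ
  exact this.congr_of_eventuallyEq (eventually_of_mem (inter_mem hU hV) key) (key x ⟨hxU, hxV⟩)

theorem H1Trivial.exists_sqrt {S : Set X} (hS : H1Trivial S) {ζ : X → ℂ} (hζ : ContinuousOn ζ S)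
    (h0 : ∀ x ∈ S, ζ x ≠ 0) : ∃ σ : X → ℂ, ContinuousOn σ S ∧ ∀ x, σ x ^ 2 = ζ x :=
  let ⟨_, hf⟩ := hS _ (locallyCoboundary_rootCocycle hζ h0)
  exists_sqrt_of_coboundaryNear hζ h0 hf

end SquareRoots

/-- Two continuous functions with the same nonzero squares on a preconnected set, are proportional
there. -/
theorem mul_eq_mul_of_sq_eq_sq {X : Type*} [TopologicalSpace X] {S : Set X} (hS : IsPreconnected S)
    {σ τ : X → ℂ} (hσ : ContinuousOn σ S) (hτ : ContinuousOn τ S)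
    (h0 : ∀ x ∈ S, τ x ≠ 0) {c : ℂ} (h : ∀ x ∈ S, σ x ^ 2 = c * τ x ^ 2) {x y : X} (hx : x ∈ S)
    (hy : y ∈ S) : σ x / τ x = σ y / τ y := by
  have hc : ContinuousOn (fun z => σ z / τ z) S := hσ.div hτ h0
  have hsq : ∀ z ∈ S, (σ z / τ z) ^ 2 = c := fun z hz => by
    rw [div_pow, h z hz, mul_div_cancel_right₀ _ (pow_ne_zero 2 (h0 z hz))]
  refine eq_of_isPreconnected hS (f := fun z => σ z / τ z) (fun z hz => ?_) hx hy
  by_cases hc0 : c = 0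
  · refine ⟨S, self_mem_nhdsWithin, fun a ha => ?_⟩
    have h1 := hsq a ha
    have h2 := hsq z hz
    rw [hc0] at h1 h2
    rw [pow_eq_zero_iff two_ne_zero] at h1 h2
    simp only [h1, h2]
  · have hz0 : σ z / τ z ≠ 0 := fun h => hc0 (by rw [← hsq z hz, h]; simp)
    have hne : σ z / τ z ≠ -(σ z / τ z) := fun h => hz0 (self_eq_neg.1 h)
    have hev : ∀ᶠ a in 𝓝[S] z, σ a / τ a ≠ -(σ z / τ z) := (hc z hz).eventually_ne hne
    refine ⟨_, inter_mem hev self_mem_nhdsWithin, fun a ha => ?_⟩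
    exact (sq_eq_sq_iff_eq_or_eq_neg.1 ((hsq a ha.2).trans (hsq z hz).symm)).resolve_right ha.1

/-- There is no continuous square root on the circles about the origin. -/
theorem no_sqrt_on_circle {δ : ℝ} (hδ : 0 < δ) {σ : ℂ → ℂ}
    (hσ : ContinuousOn σ (Metric.sphere 0 δ)) (h : ∀ z ∈ Metric.sphere (0 : ℂ) δ, σ z ^ 2 = z) :
    False := by
  let e : ℝ → ℂ := fun θ => δ * Complex.exp (θ * Complex.I)
  have hes : ∀ θ, e θ ∈ Metric.sphere (0 : ℂ) δ := fun θ => by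
    simp [e, Complex.norm_exp_ofReal_mul_I, abs_of_pos hδ]
  -- Compare with the half-angle exponential: the quotient is constant in `θ`, but after a full turn
  -- its numerator returns while its denominator changes sign.
  have h1 := mul_eq_mul_of_sq_eq_sq (S := (univ : Set ℝ)) isPreconnected_univ
    (σ := fun θ => σ (e θ)) (τ := fun θ => Complex.exp (θ / 2 * Complex.I)) (c := δ)
    (hσ.comp (by fun_prop) fun θ _ => hes θ) (by fun_prop) (fun _ _ => Complex.exp_ne_zero _)
    (fun θ _ => by
      rw [h _ (hes θ), ← Complex.exp_nat_mul]
      simp only [e]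
      congr 2
      push_cast
      ring) (x := 0) (y := 2 * Real.pi) (mem_univ _) (mem_univ _)
  have h2 : e (2 * Real.pi) = e 0 := by simp [e]
  have h3 : ((2 * Real.pi : ℝ) : ℂ) / 2 * Complex.I = Real.pi * Complex.I := by
    push_cast; ring
  rw [h3, h2, Complex.exp_pi_mul_I] at h1
  simp only [Complex.ofReal_zero, zero_div, zero_mul, Complex.exp_zero, div_one, div_neg] at h1
  have h4 : σ (e 0) = 0 := self_eq_neg.1 h1
  have h5 := h _ (hes 0)
  rw [h4] at h5
  simp only [e, Complex.ofReal_zero, zero_mul, Complex.exp_zero, mul_one] at h5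
  exact hδ.ne (by exact_mod_cast (show (0 : ℂ) = δ by simpa using h5))


/-! ### Three-space does not embed into the plane -/

/-- Punctured three-space has trivial first cohomology. -/
theorem h1Trivial_compl_zero : H1Trivial ({0}ᶜ : Set (EuclideanSpace ℝ (Fin 3))) := by
  intro g hg
  -- For `c ≠ 0` this is the complement of the closed half-axis opposite to `c`, and it is
  -- star-shaped about the point `c` on the axis. The cases `c = 1` and `c = -1` cover punctured
  -- space.
  let O : ℝ → Set (EuclideanSpace ℝ (Fin 3)) := fun c =>
    {x | 0 < c * x 0} ∪ {x | x 1 ≠ 0} ∪ {x | x 2 ≠ 0}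
  have hO : ∀ c, IsOpen (O c) := fun c => by
    refine (IsOpen.union ?_ ?_).union ?_
    · exact isOpen_lt (by fun_prop) (by fun_prop)
    · exact isOpen_ne_fun (by fun_prop) (by fun_prop)
    · exact isOpen_ne_fun (by fun_prop) (by fun_prop)
  have hsub : ∀ c, O c ⊆ {0}ᶜ := by
    rintro c x hx rfl
    simp [O] at hx
  have hstar : ∀ c, c ≠ 0 → StarConvex ℝ (EuclideanSpace.single 0 c : EuclideanSpace ℝ (Fin 3)) (O c) := by
    intro c hc x hx a b ha hb hab
    rcases hb.eq_or_lt with rfl | hb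
    · left; left
      rw [add_zero] at hab
      simpa [hab] using mul_self_pos.2 hc
    · rcases hx with (hx | hx) | hx
      · left; left
        have hx' : 0 < c * x 0 := hx
        have : c * (a * c + b * x 0) = a * c ^ 2 + b * (c * x 0) := by ring
        have : 0 < c * (a * c + b * x 0) := by rw [this]; positivity
        simpa using this
      · left; right
        simpa [hb.ne'] using hx
      · right
        simpa [hb.ne'] using hx
  obtain ⟨f₁, hf₁⟩ := StarConvex.h1Trivial (hstar 1 one_ne_zero) g (hg.mono (hsub 1))
  obtain ⟨f₂, hf₂⟩ := StarConvex.h1Trivial (hstar (-1) (by norm_num)) g (hg.mono (hsub (-1)))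
  refine exists_coboundaryNear_union (hO 1) (hO (-1)) (fun x hx => ?_) ?_
    (hf₁.mono inter_subset_right) (hf₂.mono inter_subset_right)
  · by_contra h
    simp only [O, mem_union, mem_ofPred_eq, not_or, not_lt, not_not] at h
    apply hx
    have : x 0 = 0 := by linarith [h.1.1.1, h.2.1.1]
    ext i
    fin_cases i
    · exact this
    · exact h.1.1.2
    · exact h.1.2
  · have hi : ({0}ᶜ ∩ O 1 ∩ O (-1) : Set (EuclideanSpace ℝ (Fin 3))) =
        (({x | 0 < x 1} ∪ {x | 0 < x 2}) ∪ {x | x 1 < 0}) ∪ {x | x 2 < 0} := by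
      ext x
      simp only [O, mem_inter_iff, mem_union, mem_ofPred_eq, mem_compl_iff, mem_singleton_iff]
      constructor
      · rintro ⟨⟨-, h⟩, h'⟩
        have hx : x 1 ≠ 0 ∨ x 2 ≠ 0 := by
          rcases h with (h | h) | h
          · rcases h' with (h' | h') | h'
            · linarith
            · exact Or.inl h'
            · exact Or.inr h'
          · exact Or.inl h
          · exact Or.inr h
        rcases hx with hx | hx <;> rcases lt_or_gt_of_ne hx with hx | hx <;> tauto
      · intro h
        have h' : x 1 ≠ 0 ∨ x 2 ≠ 0 := by
          rcases h with ((h | h) | h) | h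
          exacts [Or.inl h.ne', Or.inr h.ne', Or.inl h.ne, Or.inr h.ne]
        refine ⟨⟨?_, by tauto⟩, by tauto⟩
        rintro rfl
        simp at h'
    rw [hi]
    have hpos : ∀ i : Fin 3, IsPreconnected {x : EuclideanSpace ℝ (Fin 3) | 0 < x i} := fun i =>
      (convex_halfSpace_gt (f := fun x : EuclideanSpace ℝ (Fin 3) => x i)
        ⟨fun _ _ => rfl, fun _ _ => rfl⟩ 0).isPreconnected
    have hneg : ∀ i : Fin 3, IsPreconnected {x : EuclideanSpace ℝ (Fin 3) | x i < 0} := fun i =>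
      (convex_halfSpace_lt (f := fun x : EuclideanSpace ℝ (Fin 3) => x i)
        ⟨fun _ _ => rfl, fun _ _ => rfl⟩ 0).isPreconnected
    refine IsPreconnected.union !₂[0, -1, -1] ?_ ?_ (IsPreconnected.union !₂[0, -1, 1] ?_ ?_
      (IsPreconnected.union !₂[0, 1, 1] ?_ ?_ (hpos 1) (hpos 2)) (hneg 1)) (hneg 2) <;> simp

/-- Three-space does not embed into the plane. -/
theorem not_injective_of_continuous {j : EuclideanSpace ℝ (Fin 3) → ℂ} (hj : Continuous j) :
    ¬Function.Injective j := by
  intro hinj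
  have hc : IsPreconnected ({0}ᶜ : Set (EuclideanSpace ℝ (Fin 3))) :=
    (isConnected_compl_singleton_of_one_lt_rank (by rw [← Module.finrank_eq_rank]; simp) 0).isPreconnected
  have h0 : ∀ x ∈ ({0}ᶜ : Set (EuclideanSpace ℝ (Fin 3))), j x - j (-x) ≠ 0 := fun x hx h => by
    have h1 : x = -x := hinj (sub_eq_zero.1 h)
    have h2 : x = (1 / 2 : ℝ) • (x - -x) := by module
    rw [sub_eq_zero.2 h1, smul_zero] at h2
    exact hx h2
  -- The function `j x - j (-x)` is odd. For its root `σ`, the quotient `σ (-x) / σ x` is constant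
  -- with square `-1`; comparing `y` with `-y` shows that it equals its own inverse, so its square
  -- is also `1`.
  obtain ⟨σ, hσ, hsq⟩ := h1Trivial_compl_zero.exists_sqrt (ζ := fun x => j x - j (-x))
    (by fun_prop) h0
  have hσ0 : ∀ x ∈ ({0}ᶜ : Set (EuclideanSpace ℝ (Fin 3))), σ x ≠ 0 := fun x hx h =>
    h0 x hx (by rw [← hsq, h]; simp)
  have hm : MapsTo (fun x : EuclideanSpace ℝ (Fin 3) => -x) {0}ᶜ {0}ᶜ := fun x hx => by simpa using hx
  obtain ⟨y, hy⟩ : ({0}ᶜ : Set (EuclideanSpace ℝ (Fin 3))).Nonempty :=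
    ⟨EuclideanSpace.single 0 1, by simp⟩
  have h1 := mul_eq_mul_of_sq_eq_sq hc (hσ.comp (by fun_prop) hm) hσ hσ0 (c := -1)
    (fun x _ => by simp [hsq]) hy (hm hy)
  have hy1 := hσ0 y hy
  have hy2 := hσ0 (-y) (hm hy)
  simp only [Function.comp_apply, neg_neg] at h1
  rw [div_eq_div_iff hy1 hy2, ← pow_two, ← pow_two, hsq, hsq, neg_neg, ← neg_sub, neg_eq_iff_add_eq_zero,
    ← two_mul] at h1
  exact h0 y hy (by simpa using h1)

end PHT

namespace PHT

open Geometry Filter Topology Set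

/-! ### Barycentric coordinates on a simplicial complex -/

section Barycentric

variable {E : Type*} [NormedAddCommGroup E] [NormedSpace ℝ E]

theorem weights_eq_of_affineIndependent {s : Finset E}
    (hs : AffineIndependent ℝ ((↑) : s → E)) {w w' : E → ℝ}
    (h1 : ∑ u ∈ s, w u = ∑ u ∈ s, w' u) (h2 : ∑ u ∈ s, w u • u = ∑ u ∈ s, w' u • u) :
    ∀ u ∈ s, w u = w' u := by
  intro u hu
  have h := affineIndependent_iff.1 hs Finset.univ (fun x => w x - w' x)
    (by rw [Finset.sum_coe_sort s fun x => w x - w' x, Finset.sum_sub_distrib, h1, sub_self])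
    (by
      rw [Finset.sum_coe_sort s fun x => (w x - w' x) • x]
      simp only [sub_smul, Finset.sum_sub_distrib, h2, sub_self])
    ⟨u, hu⟩ (Finset.mem_univ _)
  exact sub_eq_zero.1 h

theorem AffineMap.map_weighted_sum (f : E →ᵃ[ℝ] ℝ) (s : Finset E) {w : E → ℝ}
    (h1 : ∑ u ∈ s, w u = 1) : f (∑ u ∈ s, w u • u) = ∑ u ∈ s, w u * f u := by
  have hd : ∀ x, f x = f.linear x + f 0 := fun x => by
    have := f.map_vadd 0 x
    simpa using this
  rw [hd, map_sum]
  simp only [map_smul, smul_eq_mul]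
  have h3 : ∀ u, w u * f u = w u * f.linear u + w u * f 0 := fun u => by rw [hd u]; ring
  simp only [h3, Finset.sum_add_distrib, ← Finset.sum_mul, h1, one_mul]

/-- An affine function that is one at a given vertex of a simplex and zero at the others. -/
theorem exists_affineMap_vertex [FiniteDimensional ℝ E] {s : Finset E}
    (hs : AffineIndependent ℝ ((↑) : s → E)) {u : E} (hu : u ∈ s) :
    ∃ f : E →ᵃ[ℝ] ℝ, Continuous f ∧ f u = 1 ∧ ∀ x ∈ s, x ≠ u → f x = 0 := by
  classical
  obtain ⟨t, hst, ht, htop⟩ := exists_subset_affineIndependent_affineSpan_eq_top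
    (s := (s : Set E)) hs
  let b : AffineBasis t ℝ E := ⟨(↑), ht, by rw [Subtype.range_coe]; exact htop⟩
  have hb : ∀ x (hx : x ∈ t), b ⟨x, hx⟩ = x := fun _ _ => rfl
  refine ⟨b.coord ⟨u, hst hu⟩, continuous_barycentric_coord b _, ?_, fun x hx hxu => ?_⟩
  · simpa [hb] using b.coord_apply_eq ⟨u, hst hu⟩
  · simpa [hb] using b.coord_apply_ne (i := ⟨u, hst hu⟩) (j := ⟨x, hst hx⟩)
      fun h => hxu (congrArg Subtype.val h).symm

variable (K : SimplicialComplex ℝ E)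

open scoped Classical in
/-- The barycentric coordinate of the point `y` of `K` at the vertex `u`. -/
noncomputable def bary (y u : E) : ℝ :=
  if h : ∃ s ∈ K.faces, y ∈ convexHull ℝ (s : Set E) then
    if u ∈ h.choose then (Finset.mem_convexHull'.1 h.choose_spec.2).choose u else 0
  else 0

variable {K}

-- If two faces contain `y`, then `y` lies in the hull of their common vertices. By affine
-- independence both expansions agree with the one on the intersection, so the chosen face does not
-- matter.
open scoped Classical in
theorem bary_eq {s : Finset E} (hs : s ∈ K.faces) {w : E → ℝ} (h0 : ∀ u ∈ s, 0 ≤ w u)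
    (h1 : ∑ u ∈ s, w u = 1) {y : E} (hy : ∑ u ∈ s, w u • u = y) (u : E) :
    bary K y u = if u ∈ s then w u else 0 := by
  have hys : y ∈ convexHull ℝ (s : Set E) := Finset.mem_convexHull'.2 ⟨w, h0, h1, hy⟩
  have h : ∃ s ∈ K.faces, y ∈ convexHull ℝ (s : Set E) := ⟨s, hs, hys⟩
  rw [bary, dif_pos h]
  set t := h.choose with ht
  have htK : t ∈ K.faces := h.choose_spec.1
  obtain ⟨-, k1, k2⟩ := (Finset.mem_convexHull'.1 h.choose_spec.2).choose_spec
  set w' := (Finset.mem_convexHull'.1 h.choose_spec.2).choose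
  have hst := K.inter_subset_convexHull hs htK ⟨hys, h.choose_spec.2⟩
  rw [← Finset.coe_inter] at hst
  obtain ⟨v, -, v1, v2⟩ := Finset.mem_convexHull'.1 hst
  let v' : E → ℝ := fun x => if x ∈ s ∩ t then v x else 0
  have hv : ∀ r : Finset E, s ∩ t ⊆ r → ∑ u ∈ r, v' u = 1 ∧ ∑ u ∈ r, v' u • u = y := by
    intro r hr
    constructor
    · rw [← v1, ← Finset.sum_subset hr fun x _ hx => by simp only [v', if_neg hx]]
      exact Finset.sum_congr rfl fun x hx => by simp only [v', if_pos hx]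
    · rw [← v2, ← Finset.sum_subset hr fun x _ hx => by simp only [v', if_neg hx, zero_smul]]
      exact Finset.sum_congr rfl fun x hx => by simp only [v', if_pos hx]
  have hvs := hv s Finset.inter_subset_left
  have hvt := hv t Finset.inter_subset_right
  have e1 := weights_eq_of_affineIndependent (K.indep hs) (h1.trans hvs.1.symm)
    (hy.trans hvs.2.symm)
  have e2 := weights_eq_of_affineIndependent (K.indep htK) (k1.trans hvt.1.symm)
    (k2.trans hvt.2.symm)
  by_cases hus : u ∈ s <;> by_cases hut : u ∈ t
  · rw [if_pos hus, if_pos hut, e1 u hus, e2 u hut]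
  · rw [if_pos hus, if_neg hut, e1 u hus]
    simp [v', hut]
  · rw [if_neg hus, if_pos hut, e2 u hut]
    simp [v', hus]
  · rw [if_neg hus, if_neg hut]

theorem bary_of_notMem {s : Finset E} (hs : s ∈ K.faces) {y : E}
    (hy : y ∈ convexHull ℝ (s : Set E)) {u : E} (hu : u ∉ s) : bary K y u = 0 := by
  classical
  obtain ⟨w, h0, h1, h2⟩ := Finset.mem_convexHull'.1 hy
  rw [bary_eq hs h0 h1 h2, if_neg hu]

theorem sum_bary {s : Finset E} (hs : s ∈ K.faces) {y : E} (hy : y ∈ convexHull ℝ (s : Set E)) :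
    ∑ u ∈ s, bary K y u = 1 := by
  classical
  obtain ⟨w, h0, h1, h2⟩ := Finset.mem_convexHull'.1 hy
  rw [← h1]
  exact Finset.sum_congr rfl fun u hu => by rw [bary_eq hs h0 h1 h2, if_pos hu]

theorem sum_bary_smul {s : Finset E} (hs : s ∈ K.faces) {y : E}
    (hy : y ∈ convexHull ℝ (s : Set E)) : ∑ u ∈ s, bary K y u • u = y := by
  classical
  obtain ⟨w, h0, h1, h2⟩ := Finset.mem_convexHull'.1 hy
  refine (Finset.sum_congr rfl fun u hu => ?_).trans h2
  rw [bary_eq hs h0 h1 h2, if_pos hu]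

theorem bary_nonneg (y u : E) : 0 ≤ bary K y u := by
  classical
  by_cases h : ∃ s ∈ K.faces, y ∈ convexHull ℝ (s : Set E)
  · obtain ⟨s, hs, hy⟩ := h
    obtain ⟨w, h0, h1, h2⟩ := Finset.mem_convexHull'.1 hy
    rw [bary_eq hs h0 h1 h2]
    split_ifs with hu
    · exact h0 u hu
    · exact le_rfl
  · rw [bary, dif_neg h]

/-- The vertices at which a point of `K` has positive barycentric coordinates, are those of the
smallest face that contains the point. -/
theorem exists_carrier {y : E} (hy : y ∈ K.space) : ∃ s ∈ K.faces, y ∈ convexHull ℝ (s : Set E) ∧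
    ∀ u, u ∈ s ↔ 0 < bary K y u := by
  classical
  obtain ⟨s, hs, hys⟩ := SimplicialComplex.mem_space_iff.1 hy
  have hsum := sum_bary hs hys
  have hsm := sum_bary_smul hs hys
  set r := s.filter fun u => 0 < bary K y u with hr
  have hrs : r ⊆ s := Finset.filter_subset _ _
  have hz : ∀ u ∈ s, u ∉ r → bary K y u = 0 := fun u hu hur =>
    le_antisymm (not_lt.1 fun h => hur (Finset.mem_filter.2 ⟨hu, h⟩)) (bary_nonneg y u)
  have hsum' : ∑ u ∈ r, bary K y u = 1 := by rw [← hsum]; exact Finset.sum_subset hrs hz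
  have hne : r.Nonempty := by
    rw [Finset.nonempty_iff_ne_empty]
    intro h
    rw [h] at hsum'
    simp at hsum'
  refine ⟨r, K.down_closed hs hrs hne, Finset.mem_convexHull'.2 ⟨bary K y,
    fun u _ => bary_nonneg y u, hsum', ?_⟩, fun u => ⟨fun h => (Finset.mem_filter.1 h).2,
      fun h => Finset.mem_filter.2 ⟨?_, h⟩⟩⟩
  · refine (Finset.sum_subset hrs fun u hu hur => ?_).trans hsm
    rw [hz u hu hur, zero_smul]
  · by_contra hu
    exact h.ne' (bary_of_notMem hs hys hu)

theorem mem_convexHull_of_bary {y : E} (hy : y ∈ K.space) {s : Finset E}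
    (h : ∀ u, 0 < bary K y u → u ∈ s) : y ∈ convexHull ℝ (s : Set E) :=
  let ⟨_, _, hyr, hr⟩ := exists_carrier hy
  convexHull_mono (fun u hu => h u ((hr u).1 hu)) hyr

theorem bary_combination {s : Finset E} (hs : s ∈ K.faces) {y z : E}
    (hy : y ∈ convexHull ℝ (s : Set E)) (hz : z ∈ convexHull ℝ (s : Set E)) {a b : ℝ}
    (ha : 0 ≤ a) (hb : 0 ≤ b) (hab : a + b = 1) (u : E) :
    bary K (a • y + b • z) u = a * bary K y u + b * bary K z u := by
  classical
  rw [bary_eq hs (w := fun u => a * bary K y u + b * bary K z u)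
    (fun u _ => add_nonneg (mul_nonneg ha (bary_nonneg y u)) (mul_nonneg hb (bary_nonneg z u)))]
  · split_ifs with h
    · rfl
    · rw [bary_of_notMem hs hy h, bary_of_notMem hs hz h]; simp
  · rw [Finset.sum_add_distrib, ← Finset.mul_sum, ← Finset.mul_sum, sum_bary hs hy, sum_bary hs hz]
    simpa using hab
  · simp only [add_smul, mul_smul, Finset.sum_add_distrib, ← Finset.smul_sum,
      sum_bary_smul hs hy, sum_bary_smul hs hz]

open scoped Classical in
theorem bary_vertex {u : E} (hu : {u} ∈ K.faces) (x : E) :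
    bary K u x = if x = u then 1 else 0 := by
  rw [bary_eq hu (w := fun _ => 1) (by simp) (by simp) (by simp)]
  simp

/-- On each closed face the coordinate is zero or the restriction of an affine function, and
finitely many closed faces cover the space. -/
theorem continuousOn_bary [FiniteDimensional ℝ E] (hK : K.faces.Finite) (u : E) :
    ContinuousOn (fun y => bary K y u) K.space := by
  classical
  have h1 : ∀ s ∈ K.faces, ContinuousOn (fun y => bary K y u) (convexHull ℝ (s : Set E)) := by
    intro s hs
    by_cases hu : u ∈ s
    · obtain ⟨f, hfc, hfu, hf⟩ := exists_affineMap_vertex (K.indep hs) hu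
      refine hfc.continuousOn.congr fun y hy => ?_
      rw [← sum_bary_smul hs hy, AffineMap.map_weighted_sum f s (sum_bary hs hy),
        sum_bary_smul hs hy, Finset.sum_eq_single u]
      · rw [hfu, mul_one]
      · intro x hx hxu
        rw [hf x hx hxu, mul_zero]
      · exact fun h => (h hu).elim
    · exact (continuousOn_const (c := (0 : ℝ))).congr fun y hy => bary_of_notMem hs hy hu
  have h2 : K.space = ⋃ s : K.faces, convexHull ℝ ((s : Finset E) : Set E) := by
    rw [SimplicialComplex.space, biUnion_eq_iUnion]
  rw [h2]
  have := hK.to_subtype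
  exact (locallyFinite_of_finite _).continuousOn_iUnion
    (fun s => (s.1.finite_toSet.isCompact_convexHull (𝕜 := ℝ)).isClosed) fun s => h1 s s.2

end Barycentric

/-! ### Simplicial chains -/

section Chains

variable {E : Type*}

/-- The generator of the chain group that belongs to the finite set `s`. -/
noncomputable abbrev simplexChain (s : Finset E) : FormalChain E := Finsupp.single s 1

theorem boundaryMap_simplexChain [DecidableEq E] (s : Finset E) :
    boundaryMap E (simplexChain s) =
      ∑ x ∈ s with (s.erase x).Nonempty, simplexChain (s.erase x) := by
  classical
  rw [boundaryMap, simplexChain, Finsupp.linearCombination_single, one_smul]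
  convert rfl

theorem boundaryMap_simplexChain_of_two_le [DecidableEq E] {s : Finset E} (hs : 2 ≤ s.card) :
    boundaryMap E (simplexChain s) = ∑ x ∈ s, simplexChain (s.erase x) := by
  rw [boundaryMap_simplexChain, Finset.filter_true_of_mem]
  intro x hx
  rw [← Finset.card_pos, Finset.card_erase_of_mem hx]
  omega

theorem boundaryMap_vertex (u : E) : boundaryMap E (simplexChain {u}) = 0 := by
  classical
  rw [boundaryMap_simplexChain, Finset.filter_false_of_mem, Finset.sum_empty]
  intro x hx
  rw [Finset.mem_singleton.1 hx, Finset.erase_singleton]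
  exact Finset.not_nonempty_empty

theorem boundaryMap_edge [DecidableEq E] {u w : E} (h : u ≠ w) :
    boundaryMap E (simplexChain {u, w}) = simplexChain {u} + simplexChain {w} := by
  rw [boundaryMap_simplexChain_of_two_le (by rw [Finset.card_pair h]), Finset.sum_pair h, add_comm]
  congr 2
  · rw [Finset.pair_comm, Finset.erase_insert (by simpa using h.symm)]
  · rw [Finset.erase_insert (by simpa using h)]

theorem boundaryMap_triangle [DecidableEq E] {u v w : E} (huv : u ≠ v) (huw : u ≠ w)
    (hvw : v ≠ w) : boundaryMap E (simplexChain {u, v, w}) =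
      simplexChain {v, w} + simplexChain {u, w} + simplexChain {u, v} := by
  rw [boundaryMap_simplexChain_of_two_le (by rw [Finset.card_eq_three.2 ⟨u, v, w, huv, huw, hvw, rfl⟩]; omega),
    Finset.sum_insert (by simp [huv, huw]), Finset.sum_pair hvw, ← add_assoc]
  congr 3
  · rw [Finset.erase_insert (by simp [huv, huw])]
  · ext x; simp; grind
  · ext x; simp; grind

theorem chain_add_self (c : FormalChain E) : c + c = 0 := by
  ext s
  simp [zmod_two_add_cancel]

theorem boundaryMap_boundaryMap (c : FormalChain E) : boundaryMap E (boundaryMap E c) = 0 := by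
  classical
  suffices h : (boundaryMap E).comp (boundaryMap E) = 0 from LinearMap.congr_fun h c
  refine Finsupp.lhom_ext' fun s => LinearMap.ext_ring ?_
  change boundaryMap E (boundaryMap E (simplexChain s)) = 0
  rw [boundaryMap_simplexChain, map_sum]
  simp only [boundaryMap_simplexChain]
  rw [Finset.sum_sigma']
  refine Finset.sum_involution (fun p _ => ⟨p.2, p.1⟩) ?_ ?_ ?_ ?_
  · rintro ⟨x, y⟩ -
    simp only [Finset.erase_right_comm (a := x) (b := y), chain_add_self]
  · rintro ⟨x, y⟩ hp - h
    simp only [Finset.mem_sigma, Finset.mem_filter, Finset.mem_erase] at hp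
    exact hp.2.1.1 (congrArg Sigma.fst h)
  · rintro ⟨x, y⟩ hp
    simp only [Finset.mem_sigma, Finset.mem_filter, Finset.mem_erase] at hp ⊢
    have h2 := hp.2.2
    rw [Finset.erase_right_comm] at h2
    exact ⟨⟨hp.2.1.2, h2.mono (Finset.erase_subset _ _)⟩, ⟨hp.2.1.1.symm, hp.1.1⟩, h2⟩
  · rintro ⟨x, y⟩ -
    rfl

/-- The linear functional on chains that sends a simplex to the sum of the values of `F` at its
vertices. -/
noncomputable def vertexFunctional (F : E → ZMod 2) : FormalChain E →ₗ[ZMod 2] ZMod 2 :=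
  Finsupp.linearCombination (ZMod 2) fun s => ∑ u ∈ s, F u

theorem vertexFunctional_simplexChain (F : E → ZMod 2) (s : Finset E) :
    vertexFunctional F (simplexChain s) = ∑ u ∈ s, F u := by
  simp [vertexFunctional]

variable [NormedAddCommGroup E] [InnerProductSpace ℝ E] {K : SimplicialComplex ℝ E}

theorem mem_chains {k : ℕ} {c : FormalChain E} :
    c ∈ chains K k ↔ ∀ s, c s ≠ 0 → s ∈ K.faces ∧ s.card = k + 1 := by
  rw [chains, Finsupp.mem_supported]
  simp only [Set.subset_def, Finset.mem_coe, Finsupp.mem_support_iff, mem_ofPred_eq]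

theorem simplexChain_mem_chains {k : ℕ} {s : Finset E} (hs : s ∈ K.faces) (hk : s.card = k + 1) :
    simplexChain s ∈ chains K k :=
  Finsupp.single_mem_supported _ _ ⟨hs, hk⟩

/-- Linear maps that agree on the `k`-simplices agree on the `k`-chains. -/
theorem eqOn_chains {V : Type*} [AddCommGroup V] [Module (ZMod 2) V] {k : ℕ}
    {f g : FormalChain E →ₗ[ZMod 2] V}
    (h : ∀ s ∈ K.faces, s.card = k + 1 → f (simplexChain s) = g (simplexChain s))
    {c : FormalChain E} (hc : c ∈ chains K k) : f c = g c := by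
  rw [chains, Finsupp.supported_eq_span_single] at hc
  exact LinearMap.eqOn_span (by rintro _ ⟨s, hs, rfl⟩; exact h s hs.1 hs.2) hc

theorem chains_le {k : ℕ} {W : Submodule (ZMod 2) (FormalChain E)}
    (h : ∀ s ∈ K.faces, s.card = k + 1 → simplexChain s ∈ W) : chains K k ≤ W := by
  rw [chains, Finsupp.supported_eq_span_single, Submodule.span_le]
  rintro _ ⟨s, hs, rfl⟩
  exact h s hs.1 hs.2

theorem boundaryMap_mem_chains {k : ℕ} {c : FormalChain E} (hc : c ∈ chains K (k + 1)) :
    boundaryMap E c ∈ chains K k := by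
  classical
  refine chains_le (W := (chains K k).comap (boundaryMap E)) (fun s hs hk => ?_) hc
  rw [Submodule.mem_comap, boundaryMap_simplexChain_of_two_le (by omega)]
  refine Submodule.sum_mem _ fun x hx => simplexChain_mem_chains (K.down_closed hs
    (Finset.erase_subset _ _) ?_) ?_
  · rw [← Finset.card_pos, Finset.card_erase_of_mem hx]
    omega
  · rw [Finset.card_erase_of_mem hx]
    omega

theorem chains_mono {K L : SimplicialComplex ℝ E} (h : K.faces ⊆ L.faces) (k : ℕ) :
    chains K k ≤ chains L k :=
  Finsupp.supported_mono fun _ hs => ⟨h hs.1, hs.2⟩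

theorem cycles_mono {K L : SimplicialComplex ℝ E} (h : K.faces ⊆ L.faces) (k : ℕ) :
    cycles K k ≤ cycles L k :=
  inf_le_inf_right _ (chains_mono h k)

theorem boundaries_mono {K L : SimplicialComplex ℝ E} (h : K.faces ⊆ L.faces) (k : ℕ) :
    boundaries K k ≤ boundaries L k :=
  Submodule.map_mono (chains_mono h (k + 1))

theorem cycles_zero : cycles K 0 = chains K 0 := by
  refine inf_eq_left.2 (chains_le fun s _ hk => ?_)
  obtain ⟨u, rfl⟩ := Finset.card_eq_one.1 hk
  exact boundaryMap_vertex u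

end Chains

/-! ### From cohomology of spaces to simplicial homology -/

section VertexMaps

variable {E : Type*} [NormedAddCommGroup E] [InnerProductSpace ℝ E]

/-- Near every point of `S` the map `v` takes its values among the vertices of one simplex
of `K`. -/
def IsVertexMap (K : SimplicialComplex ℝ E) (S : Set E) (v : E → E) : Prop :=
  ∀ x ∈ S, ∃ s ∈ K.faces, ∃ U ∈ 𝓝[S] x, ∀ y ∈ U, v y ∈ s

variable {K : SimplicialComplex ℝ E} {S : Set E}

/-- The map picks a vertex of maximal weight. Vertices outside the carrier `s` of `x` have
nonpositive weight at `x`, so by continuity they stay below a fixed vertex of `s` nearby; finiteness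
of `K` gives one neighbourhood for all of them. -/
theorem exists_vertexMap (hK : K.faces.Finite) {w : E → E → ℝ}
    (hw : ∀ u, ContinuousOn (fun y => w y u) S)
    (hs : ∀ y ∈ S, ∃ s ∈ K.faces, ∀ u, u ∈ s ↔ 0 < w y u) :
    ∃ v : E → E, (∀ y ∈ S, 0 < w y (v y)) ∧ IsVertexMap K S v := by
  classical
  have hmax : ∀ y, ∃ v, y ∈ S → 0 < w y v ∧ ∀ u, w y u ≤ w y v := by
    intro y
    by_cases hy : y ∈ S
    · obtain ⟨s, hsK, hsw⟩ := hs y hy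
      obtain ⟨v, hv, hvm⟩ := s.exists_max_image (w y) (K.nonempty_of_mem_faces hsK)
      refine ⟨v, fun _ => ⟨(hsw v).1 hv, fun u => ?_⟩⟩
      by_cases hu : u ∈ s
      · exact hvm u hu
      · exact (not_lt.1 fun h => hu ((hsw u).2 h)).trans ((hsw v).1 hv).le
    · exact ⟨0, fun h => (hy h).elim⟩
  choose v hv using hmax
  refine ⟨v, fun y hy => (hv y hy).1, fun x hx => ?_⟩
  obtain ⟨s, hsK, hsw⟩ := hs x hx
  obtain ⟨u₀, hu₀⟩ := K.nonempty_of_mem_faces hsK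
  have h1 : ∀ᶠ y in 𝓝[S] x, ∀ t ∈ K.faces, ∀ u ∈ t, u ∉ s → w y u < w y u₀ := by
    rw [hK.eventually_all]
    intro t _
    rw [Filter.eventually_all_finset]
    intro u _
    by_cases hu : u ∈ s
    · exact Eventually.of_forall fun _ h => (h hu).elim
    · have hlt : w x u < w x u₀ := (not_lt.1 fun h => hu ((hsw u).2 h)).trans_lt ((hsw u₀).1 hu₀)
      filter_upwards [(hw u x hx).eventually_lt (hw u₀ x hx) hlt] with y hy _ using hy
  refine ⟨s, hsK, _, inter_mem h1 self_mem_nhdsWithin, fun y hy => ?_⟩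
  by_contra hn
  obtain ⟨t, htK, htw⟩ := hs y hy.2
  exact (hy.1 t htK (v y) ((htw _).2 (hv y hy.2).1) hn).not_ge ((hv y hy.2).2 u₀)

/-- In a complex that receives a vertex map from a connected space, any two vertices are
homologous. -/
theorem add_mem_boundaries_of_isPreconnected (hS : IsPreconnected S) {v : E → E}
    (hv : IsVertexMap K S v) {u w : E} (hu : u ∈ S) (hw : w ∈ S) (hvu : v u = u) (hvw : v w = w) :
    simplexChain {u} + simplexChain {w} ∈ boundaries K 0 := by
  classical
  by_contra hn
  -- A functional that kills boundaries takes one value on all vertices of a simplex, so its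
  -- composite with `v` is locally constant.
  obtain ⟨Γ, hΓ, hker⟩ := Submodule.exists_le_ker_of_notMem hn
  refine hΓ ?_
  have h := eq_of_isPreconnected hS (f := fun y => Γ (simplexChain {v y})) (fun x hx => ?_) hu hw
  · simp only [hvu, hvw] at h
    rw [map_add, h, zmod_two_add_cancel]
  · obtain ⟨s, hs, U, hU, h⟩ := hv x hx
    refine ⟨U, hU, fun a ha => ?_⟩
    by_cases hne : v a = v x
    · rw [hne]
    · have hedge : boundaryMap E (simplexChain {v a, v x}) ∈ boundaries K 0 :=
        Submodule.mem_map_of_mem (simplexChain_mem_chains (K.down_closed hs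
          (by
            have := h a ha
            have := h x (mem_of_mem_nhdsWithin hx hU)
            grind) (by simp)) (Finset.card_pair hne))
      have h0 := hker hedge
      rw [boundaryMap_edge hne, LinearMap.mem_ker, map_add] at h0
      exact CharTwo.add_eq_zero.1 h0

/-- A complex that receives a vertex map from a space with trivial first cohomology, has trivial
first homology as well, if the edges of the complex lie in that space. -/
theorem cycles_le_boundaries_of_h1Trivial (hS : H1Trivial S) {v : E → E}
    (hv : IsVertexMap K S v) (hvert : ∀ u, {u} ∈ K.faces → v u = u)
    (hedge : ∀ s ∈ K.faces, s.card = 2 → ∀ y ∈ convexHull ℝ (s : Set E), y ∈ S ∧ v y ∈ s) :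
    cycles K 1 ≤ boundaries K 1 := by
  classical
  intro z hz
  by_contra hn
  -- A functional that kills the boundaries of triangles is a simplicial cocycle `γ`, and its
  -- pullback along `v` is a local cocycle on `S`.
  obtain ⟨Γ, hΓ, hker⟩ := Submodule.exists_le_ker_of_notMem hn
  let γ : E → E → ZMod 2 := fun a b => if a = b then 0 else Γ (simplexChain {a, b})
  have hγs : ∀ a b, γ a b = γ b a := fun a b => by
    simp only [γ, eq_comm (a := a), Finset.pair_comm a]
  have hγ0 : ∀ a, γ a a = 0 := fun a => by simp [γ]
  have hγ : ∀ s ∈ K.faces, ∀ a ∈ s, ∀ b ∈ s, ∀ c ∈ s, γ a b = γ c a + γ c b := by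
    intro s hs a ha b hb c hc
    by_cases hab : a = b
    · rw [hab, hγ0, zmod_two_add_cancel]
    by_cases hca : c = a
    · rw [hca, hγ0, zero_add]
    by_cases hcb : c = b
    · rw [hcb, hγ0, add_zero, hγs]
    have htri : boundaryMap E (simplexChain {c, a, b}) ∈ boundaries K 1 :=
      Submodule.mem_map_of_mem (simplexChain_mem_chains (K.down_closed hs (by grind) (by simp))
        (Finset.card_eq_three.2 ⟨c, a, b, hca, hcb, hab, rfl⟩))
    have h0 := hker htri
    rw [boundaryMap_triangle hca hcb hab, LinearMap.mem_ker, map_add, map_add, add_assoc] at h0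
    simp only [γ, if_neg hab, if_neg hca, if_neg hcb]
    rw [CharTwo.add_eq_zero.1 h0, add_comm]
  obtain ⟨f, hf⟩ := hS (fun x y => γ (v x) (v y)) fun x hx => by
    obtain ⟨s, hs, U, hU, h⟩ := hv x hx
    obtain ⟨c, hc⟩ := K.nonempty_of_mem_faces hs
    exact ⟨U, hU, fun y => γ c (v y), fun a ha b hb => hγ s hs _ (h a ha) _ (h b hb) c hc⟩
  -- Along an edge at `a` the function `f y + γ (v y) a` is constant. Comparing its ends shows that
  -- `Γ` is the simplicial coboundary of `f` on one-chains, so it kills every cycle.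
  have hF : ∀ s ∈ K.faces, s.card = 1 + 1 →
      Γ (simplexChain s) = ((vertexFunctional f).comp (boundaryMap E)) (simplexChain s) := by
    intro s hs hk
    obtain ⟨a, b, hab, rfl⟩ := Finset.card_eq_two.1 hk
    rw [LinearMap.comp_apply, boundaryMap_edge hab, map_add, vertexFunctional_simplexChain,
      vertexFunctional_simplexChain, Finset.sum_singleton, Finset.sum_singleton]
    have hh := hedge _ hs hk
    have haa : v a = a := hvert a (K.down_closed hs (by simp) (by simp))
    have hbb : v b = b := hvert b (K.down_closed hs (by simp) (by simp))
    have h1 := eq_of_isPreconnected (convex_convexHull ℝ _).isPreconnected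
      (f := fun y => f y + γ (v y) a) (fun x hx => ?_)
      (subset_convexHull ℝ (({a, b} : Finset E) : Set E) (by simp : a ∈ _))
      (subset_convexHull ℝ (({a, b} : Finset E) : Set E) (by simp : b ∈ _))
    · simp only [haa, hbb, hγ0, add_zero] at h1
      rw [h1, hγs, add_right_comm, zmod_two_add_cancel, zero_add]
      simp [γ, hab]
    · obtain ⟨U, hU, hfU⟩ := hf x (hh x hx).1
      refine ⟨U ∩ convexHull ℝ (({a, b} : Finset E) : Set E), inter_mem (nhdsWithin_mono x
        (fun y hy => (hh y hy).1) hU) self_mem_nhdsWithin, fun y hy => ?_⟩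
      have h2 := hfU y hy.1 x (mem_of_mem_nhdsWithin (hh x hx).1 hU)
      have h3 := hγ _ hs (v y) (hh y hy.2).2 (v x) (hh x hx).2 a (by simp)
      simp only [h3] at h2
      rw [hγs a, hγs a] at h2
      generalize f x = p at *
      generalize f y = q at *
      generalize γ (v x) a = r at *
      generalize γ (v y) a = s at *
      clear * - h2
      revert p q r s; decide
  refine hΓ ?_
  rw [eqOn_chains hF hz.1, LinearMap.comp_apply, LinearMap.mem_ker.1 hz.2, map_zero]

end VertexMaps

/-! ### Complexes that are one-point compactifications of a vector space -/

section Charts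

variable {E : Type*} [NormedAddCommGroup E]
variable {F : Type*} [NormedAddCommGroup F] [NormedSpace ℝ F]

/-- The maps `φ` and `ψ` are mutually inverse homeomorphisms between `S` and `F`. -/
structure IsChart (S : Set E) (φ : E → F) (ψ : F → E) : Prop where
  continuousOn : ContinuousOn φ S
  continuous_symm : Continuous ψ
  mem : ∀ z, ψ z ∈ S
  left_inv : ∀ y ∈ S, ψ (φ y) = y
  right_inv : ∀ z, φ (ψ z) = z

/-- The set `S` is homeomorphic to `F` after removal of any of its points. -/
def IsPuncturedSpace (F : Type*) [NormedAddCommGroup F] [NormedSpace ℝ F] (S : Set E) : Prop :=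
  ∀ q ∈ S, ∃ (φ : E → F) (ψ : F → E), IsChart (S \ {q}) φ ψ

/-- The chart is stereographic projection from the image of the removed point; the value `0` outside
`S` is a placeholder. -/
theorem isPuncturedSpace_of_homeomorph_sphere {n : ℕ} (e : EuclideanSpace ℝ (Fin n) ≃ₜ F) {S : Set E}
    (h : S ≃ₜ Metric.sphere (0 : EuclideanSpace ℝ (Fin (n + 1))) 1) : IsPuncturedSpace F S := by
  classical
  intro q hq
  have : Fact (Module.finrank ℝ (EuclideanSpace ℝ (Fin (n + 1))) = n + 1) := ⟨by simp⟩
  let st := stereographic' (E := EuclideanSpace ℝ (Fin (n + 1))) n (h ⟨q, hq⟩)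
  have hsrc : st.source = {h ⟨q, hq⟩}ᶜ := stereographic'_source _
  have htgt : st.target = univ := stereographic'_target _
  refine ⟨fun y => if hy : y ∈ S then e (st (h ⟨y, hy⟩)) else 0,
    fun z => (h.symm (st.symm (e.symm z)) : S), ?_, ?_, ?_, ?_, ?_⟩
  · rw [continuousOn_iff_continuous_domRestrict]
    have h1 : ∀ y : (S \ {q} : Set E), h ⟨y, y.2.1⟩ ∈ st.source := fun y => by
      rw [hsrc, mem_compl_iff, mem_singleton_iff, h.injective.eq_iff]
      exact fun h => y.2.2 (congrArg Subtype.val h)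
    have h2 : Continuous fun y : (S \ {q} : Set E) => e (st (h ⟨y, y.2.1⟩)) :=
      e.continuous.comp (st.continuousOn.comp_continuous (by fun_prop) h1)
    convert h2 using 2 with y
    simp [y.2.1]
  · have h1 : Continuous st.symm := by
      rw [← continuousOn_univ, ← htgt]
      exact st.continuousOn_symm
    fun_prop
  · intro z
    refine ⟨Subtype.coe_prop _, fun hz => ?_⟩
    have h1 : h.symm (st.symm (e.symm z)) = ⟨q, hq⟩ := Subtype.ext hz
    rw [h.symm_apply_eq] at h1
    have h2 := st.map_target (x := e.symm z) (by rw [htgt]; trivial)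
    rw [hsrc, h1] at h2
    exact h2 rfl
  · intro y hy
    have h1 : h ⟨y, hy.1⟩ ∈ st.source := by
      rw [hsrc, mem_compl_iff, mem_singleton_iff, h.injective.eq_iff]
      exact fun h => hy.2 (congrArg Subtype.val h)
    simp [hy.1, st.left_inv h1]
  · intro z
    have h1 : e.symm z ∈ st.target := by rw [htgt]; trivial
    simp [st.right_inv h1]

variable {S : Set E}

omit [NormedSpace ℝ F] in
theorem IsChart.isPreconnected_image {φ : E → F} {ψ : F → E} (h : IsChart S φ ψ) {T : Set E}
    (hT : T ⊆ S) {A : Set F} (hA : IsPreconnected A) (hTA : ∀ y ∈ S, y ∈ T ↔ φ y ∈ A) :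
    IsPreconnected T := by
  have : T = ψ '' A := by
    ext y
    constructor
    · exact fun hy => ⟨φ y, (hTA y (hT hy)).1 hy, h.left_inv y (hT hy)⟩
    · rintro ⟨z, hz, rfl⟩
      exact (hTA _ (h.mem z)).2 (by rwa [h.right_inv])
  rw [this]
  exact hA.image _ h.continuous_symm.continuousOn

theorem IsPuncturedSpace.isPreconnected_diff_singleton (h : IsPuncturedSpace F S) {q : E}
    (hq : q ∈ S) : IsPreconnected (S \ {q}) := by
  obtain ⟨φ, ψ, hc⟩ := h q hq
  exact hc.isPreconnected_image subset_rfl isPreconnected_univ (by simp +contextual)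

theorem IsPuncturedSpace.isPreconnected_diff_pair (h : IsPuncturedSpace F S)
    (hF : 1 < Module.rank ℝ F) {p q : E} (hp : p ∈ S) (hq : q ∈ S) :
    IsPreconnected (S \ {p, q}) := by
  by_cases hpq : p = q
  · subst hpq
    simpa using h.isPreconnected_diff_singleton hp
  obtain ⟨φ, ψ, hc⟩ := h q hq
  refine hc.isPreconnected_image (fun y hy => ⟨hy.1, fun h => hy.2 (Or.inr h)⟩)
    (isConnected_compl_singleton_of_one_lt_rank hF (φ p)).isPreconnected fun y hy => ?_
  have hy2 : y ≠ q := hy.2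
  have h1 : φ y = φ p ↔ y = p :=
    ⟨fun h => by rw [← hc.left_inv y hy, h, hc.left_inv p ⟨hp, hpq⟩], fun h => by rw [h]⟩
  simp [hy.1, hy2, h1]

/-- Two distinct points lie together in the complement of a third, which is connected. -/
theorem IsPuncturedSpace.isPreconnected [Nontrivial F] (h : IsPuncturedSpace F S) :
    IsPreconnected S := by
  refine isPreconnected_of_forall_pair fun x hx y hy => ?_
  obtain ⟨φ, ψ, hc⟩ := h x hx
  by_cases hxy : x = y
  · subst hxy
    exact ⟨{x}, by simpa, rfl, rfl, isPreconnected_singleton⟩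
  obtain ⟨z, hz⟩ := exists_ne (φ y)
  have hzx : ψ z ≠ x := fun h => (hc.mem z).2 h
  have hzy : ψ z ≠ y := fun h => hz (by rw [← h, hc.right_inv])
  exact ⟨S \ {ψ z}, sdiff_subset, ⟨hx, hzx.symm⟩, ⟨hy, hzy.symm⟩,
    h.isPreconnected_diff_singleton (hc.mem z).1⟩

theorem IsPuncturedSpace.h1Trivial_diff_singleton (h : IsPuncturedSpace F S) {q : E}
    (hq : q ∈ S) : H1Trivial (S \ {q}) := by
  obtain ⟨φ, ψ, hc⟩ := h q hq
  exact (Convex.h1Trivial (convex_univ (𝕜 := ℝ) (E := F))).of_homeo hc.continuousOn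
    hc.continuous_symm.continuousOn (fun _ _ => mem_univ _) (fun z _ => hc.mem z) hc.left_inv

theorem IsPuncturedSpace.exists_ne (h : IsPuncturedSpace F S) {q : E} (hq : q ∈ S) :
    ∃ y ∈ S, y ≠ q :=
  let ⟨_, ψ, hc⟩ := h q hq
  ⟨ψ 0, (hc.mem 0).1, (hc.mem 0).2⟩

end Charts

/-! ### Deleting the open star of a face -/

section DeleteStar

variable {E : Type*} [NormedAddCommGroup E] [InnerProductSpace ℝ E]

/-- The subcomplex of the faces that do not contain `σ`. -/
def deleteStar (K : SimplicialComplex ℝ E) (σ : Finset E) : SimplicialComplex ℝ E where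
  faces := {s | s ∈ K.faces ∧ ¬σ ⊆ s}
  isRelLowerSet_faces := by
    intro s hs
    exact ⟨K.nonempty_of_mem_faces hs.1, fun t hts ht =>
      ⟨K.down_closed hs.1 hts ht, fun h => hs.2 (h.trans hts)⟩⟩
  indep hs := K.indep hs.1
  inter_subset_convexHull hs ht := K.inter_subset_convexHull hs.1 ht.1

theorem deleteStar_faces_subset (K : SimplicialComplex ℝ E) (σ : Finset E) :
    (deleteStar K σ).faces ⊆ K.faces := fun _ h => h.1

/-- The barycentre of a simplex. -/
noncomputable def barycenter (σ : Finset E) : E := ∑ u ∈ σ, (σ.card : ℝ)⁻¹ • u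

variable {K : SimplicialComplex ℝ E} {σ : Finset E}

theorem barycenter_mem (hσ : σ.Nonempty) : barycenter σ ∈ convexHull ℝ (σ : Set E) := by
  refine Finset.mem_convexHull'.2 ⟨fun _ => (σ.card : ℝ)⁻¹, fun _ _ => by positivity, ?_, rfl⟩
  rw [Finset.sum_const, nsmul_eq_mul, mul_inv_cancel₀]
  exact_mod_cast hσ.card_pos.ne'

open scoped Classical in
theorem bary_barycenter (hσ : σ ∈ K.faces) (u : E) :
    bary K (barycenter σ) u = if u ∈ σ then (σ.card : ℝ)⁻¹ else 0 := by
  refine bary_eq hσ (w := fun _ => (σ.card : ℝ)⁻¹) (fun _ _ => by positivity) ?_ rfl u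
  rw [Finset.sum_const, nsmul_eq_mul, mul_inv_cancel₀]
  exact_mod_cast (K.nonempty_of_mem_faces hσ).card_pos.ne'

theorem barycenter_mem_space (hσ : σ ∈ K.faces) : barycenter σ ∈ K.space :=
  SimplicialComplex.convexHull_subset_space hσ (barycenter_mem (K.nonempty_of_mem_faces hσ))

theorem subset_of_barycenter_mem (hσ : σ ∈ K.faces) {s : Finset E} (hs : s ∈ K.faces)
    (h : barycenter σ ∈ convexHull ℝ (s : Set E)) : σ ⊆ s := by
  classical
  intro u hu
  by_contra hus
  have h1 := bary_of_notMem hs h hus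
  rw [bary_barycenter hσ, if_pos hu] at h1
  have h2 : (0 : ℝ) < σ.card := by exact_mod_cast (K.nonempty_of_mem_faces hσ).card_pos
  exact (inv_pos.2 h2).ne' h1

theorem eq_barycenter (hσ : σ ∈ K.faces) {y : E} (hy : y ∈ convexHull ℝ (σ : Set E)) {m : ℝ}
    (h : ∀ u ∈ σ, bary K y u = m) : y = barycenter σ := by
  have h1 := sum_bary hσ hy
  rw [Finset.sum_congr rfl h, Finset.sum_const, nsmul_eq_mul] at h1
  refine (sum_bary_smul hσ hy).symm.trans (Finset.sum_congr rfl fun u hu => by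
    rw [h u hu, eq_inv_of_mul_eq_one_right h1])

theorem exists_vertexMap_space [FiniteDimensional ℝ E] (hK : K.faces.Finite) :
    ∃ v : E → E, (∀ y ∈ K.space, 0 < bary K y (v y)) ∧ IsVertexMap K K.space v :=
  exists_vertexMap hK (continuousOn_bary hK) fun _ hy =>
    let ⟨s, hs, _, h⟩ := exists_carrier hy
    ⟨s, hs, h⟩

/-- The space of `K` without the barycentre of `σ` retracts to the complex without the open star
of `σ`. -/
theorem exists_vertexMap_deleteStar [FiniteDimensional ℝ E] (hK : K.faces.Finite)
    (hσ : σ ∈ K.faces) : ∃ v : E → E, (∀ y ∈ K.space \ {barycenter σ}, 0 < bary K y (v y)) ∧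
      IsVertexMap (deleteStar K σ) (K.space \ {barycenter σ}) v := by
  classical
  have hne := K.nonempty_of_mem_faces hσ
  -- Subtracting the least coordinate over `σ` from the coordinates on `σ` makes one of them vanish,
  -- so the remaining support does not contain `σ`. All weights vanish only if the support lies in
  -- `σ` and its coordinates are equal, that is, at the barycentre.
  let m : E → ℝ := fun y => σ.inf' hne (bary K y)
  have hm0 : ∀ y, 0 ≤ m y := fun y => Finset.le_inf' _ _ fun u _ => bary_nonneg y u
  let w : E → E → ℝ := fun y u => bary K y u - if u ∈ σ then m y else 0
  have hwb : ∀ y u, w y u ≤ bary K y u := fun y u => by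
    simp only [w]
    split_ifs
    · linarith [hm0 y]
    · simp
  have hfin : (deleteStar K σ).faces.Finite := hK.subset (deleteStar_faces_subset K σ)
  have hm : ContinuousOn m K.space :=
    ContinuousOn.finset_inf'_apply hne fun u _ => continuousOn_bary hK u
  suffices h : ∃ v : E → E, (∀ y ∈ K.space \ {barycenter σ}, 0 < w y (v y)) ∧
      IsVertexMap (deleteStar K σ) (K.space \ {barycenter σ}) v by
    obtain ⟨v, hv, hvm⟩ := h
    exact ⟨v, fun y hy => (hv y hy).trans_le (hwb y _), hvm⟩
  refine exists_vertexMap hfin (fun u => ?_) (fun y hy => ?_)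
  · refine ContinuousOn.mono ?_ sdiff_subset
    simp only [w]
    split_ifs
    · exact (continuousOn_bary hK u).sub hm
    · exact (continuousOn_bary hK u).sub continuousOn_const
  · obtain ⟨s, hs, hys, hsb⟩ := exists_carrier hy.1
    have hmem : ∀ u, 0 < w y u → u ∈ s := fun u hu => (hsb u).2 (hu.trans_le (hwb y u))
    refine ⟨s.filter fun u => 0 < w y u, ⟨K.down_closed hs (Finset.filter_subset _ _) ?_, ?_⟩,
      fun u => ?_⟩
    · rw [Finset.nonempty_iff_ne_empty]
      intro he
      have hle : ∀ u, w y u ≤ 0 := fun u => not_lt.1 fun h =>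
        Finset.notMem_empty u (he ▸ Finset.mem_filter.2 ⟨hmem u h, h⟩)
      have hyσ : y ∈ convexHull ℝ (σ : Set E) := mem_convexHull_of_bary hy.1 fun u hu => by
        by_contra huσ
        have := hle u
        simp only [w, if_neg huσ] at this
        linarith
      refine hy.2 (eq_barycenter hσ hyσ (m := m y) fun u hu => le_antisymm ?_
        (Finset.inf'_le _ hu))
      have := hle u
      simp only [w, if_pos hu] at this
      linarith
    · intro hsub
      obtain ⟨u, hu, hmin⟩ := σ.exists_mem_eq_inf' hne (bary K y)
      have h1 := (Finset.mem_filter.1 (hsub hu)).2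
      simp only [w, if_pos hu] at h1
      have h2 : m y = bary K y u := hmin
      linarith
    · rw [Finset.mem_filter]
      exact ⟨fun h => h.2, fun h => ⟨hmem u h, h⟩⟩

theorem vertexMap_mem {v : E → E} {y : E} (hv : 0 < bary K y (v y)) {s : Finset E}
    (hs : s ∈ K.faces) (hy : y ∈ convexHull ℝ (s : Set E)) : v y ∈ s := by
  by_contra h
  exact hv.ne' (bary_of_notMem hs hy h)

theorem vertexMap_vertex {v : E → E} {u : E} (hv : 0 < bary K u (v u)) (hu : {u} ∈ K.faces) :
    v u = u := by
  have := vertexMap_mem hv hu (subset_convexHull ℝ _ (by simp))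
  simpa using this

theorem mem_space_diff_barycenter (hσ : σ ∈ K.faces) {s : Finset E}
    (hs : s ∈ (deleteStar K σ).faces) {y : E} (hy : y ∈ convexHull ℝ (s : Set E)) :
    y ∈ K.space \ {barycenter σ} :=
  ⟨SimplicialComplex.convexHull_subset_space hs.1 hy,
    fun h => hs.2 (subset_of_barycenter_mem hσ hs.1 (by rwa [← mem_singleton_iff.1 h]))⟩

/-- This carries the vanishing of cohomology of a punctured space over to simplicial homology: the
faces that survive the deletion miss the barycentre, so they lie in the domain of the vertex map. -/
theorem cycles_le_boundaries_deleteStar [FiniteDimensional ℝ E] (hK : K.faces.Finite)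
    (hσ : σ ∈ K.faces) (h : H1Trivial (K.space \ {barycenter σ})) :
    cycles (deleteStar K σ) 1 ≤ boundaries (deleteStar K σ) 1 := by
  obtain ⟨v, hv, hvm⟩ := exists_vertexMap_deleteStar hK hσ
  refine cycles_le_boundaries_of_h1Trivial h hvm (fun u hu => ?_) fun s hs _ y hy => ?_
  · have hus := mem_space_diff_barycenter hσ hu (y := u) (subset_convexHull ℝ _ (by simp))
    exact vertexMap_vertex (hv u hus) hu.1
  · have hys := mem_space_diff_barycenter hσ hs hy
    exact ⟨hys, vertexMap_mem (hv y hys) hs.1 hy⟩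

theorem add_mem_boundaries_deleteStar [FiniteDimensional ℝ E] (hK : K.faces.Finite)
    (hσ : σ ∈ K.faces) (h : IsPreconnected (K.space \ {barycenter σ})) {u w : E}
    (hu : {u} ∈ (deleteStar K σ).faces) (hw : {w} ∈ (deleteStar K σ).faces) :
    simplexChain {u} + simplexChain {w} ∈ boundaries (deleteStar K σ) 0 := by
  obtain ⟨v, hv, hvm⟩ := exists_vertexMap_deleteStar hK hσ
  have hus := mem_space_diff_barycenter hσ hu (y := u) (subset_convexHull ℝ _ (by simp))
  have hws := mem_space_diff_barycenter hσ hw (y := w) (subset_convexHull ℝ _ (by simp))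
  exact add_mem_boundaries_of_isPreconnected h hvm hus hws (vertexMap_vertex (hv u hus) hu.1)
    (vertexMap_vertex (hv w hws) hw.1)

theorem add_mem_boundaries [FiniteDimensional ℝ E] (hK : K.faces.Finite)
    (h : IsPreconnected K.space) {u w : E} (hu : {u} ∈ K.faces) (hw : {w} ∈ K.faces) :
    simplexChain {u} + simplexChain {w} ∈ boundaries K 0 := by
  obtain ⟨v, hv, hvm⟩ := exists_vertexMap_space hK
  have hus : u ∈ K.space := K.subset_space hu (by simp)
  have hws : w ∈ K.space := K.subset_space hw (by simp)
  exact add_mem_boundaries_of_isPreconnected h hvm hus hws (vertexMap_vertex (hv u hus) hu)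
    (vertexMap_vertex (hv w hws) hw)

end DeleteStar

/-! ### Local structure of a triangulated sphere or circle -/

section Faces

variable {E : Type*} [NormedAddCommGroup E] [InnerProductSpace ℝ E] [FiniteDimensional ℝ E]
variable {F : Type*} [NormedAddCommGroup F] [NormedSpace ℝ F]
variable {M : SimplicialComplex ℝ E}

omit [FiniteDimensional ℝ E] in
theorem mem_space_of_vertex {u : E} (hu : {u} ∈ M.faces) : u ∈ M.space :=
  M.subset_space hu (by simp)

/-- No vertex is isolated. -/
theorem exists_edge_of_vertex [Nontrivial F] (hfin : M.faces.Finite)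
    (hM : IsPuncturedSpace F M.space) {u : E} (hu : {u} ∈ M.faces) :
    ∃ s ∈ M.faces, s.card = 2 ∧ u ∈ s := by
  classical
  by_contra hn
  push Not at hn
  have hus := mem_space_of_vertex hu
  -- Without edges at `u`, the point `u` is the whole open set where its coordinate is positive. It
  -- is then open and closed in a connected space that has other points.
  have hsingle : ∀ y ∈ M.space, 0 < bary M y u → y = u := by
    intro y hy hpos
    obtain ⟨s, hs, hys, hsb⟩ := exists_carrier hy
    have hu' := (hsb u).2 hpos
    have hs1 : s = {u} := by
      by_contra hne
      obtain ⟨w, hw, hwu⟩ : ∃ w ∈ s, w ≠ u := by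
        by_contra h
        push Not at h
        exact hne (Finset.eq_singleton_iff_unique_mem.2 ⟨hu', h⟩)
      exact hn {u, w} (M.down_closed hs (by grind) (by simp)) (Finset.card_pair hwu.symm)
        (by simp)
    simpa [hs1] using hys
  obtain ⟨y, hy, hyu⟩ := hM.exists_ne hus
  refine hyu.symm ?_
  have h := eq_of_isPreconnected hM.isPreconnected (f := fun y => y = u) (fun x hx => ?_) hus hy
  · exact (cast h rfl : y = u).symm
  · by_cases hxu : x = u
    · have hpos : 0 < bary M x u := by rw [hxu, bary_vertex hu, if_pos rfl]; exact one_pos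
      exact ⟨_, inter_mem ((continuousOn_bary hfin u x hx).eventually (lt_mem_nhds hpos))
        self_mem_nhdsWithin, fun a ha => by simp [hxu, hsingle a ha.2 ha.1]⟩
    · refine ⟨_, mem_nhdsWithin_of_mem_nhds (isOpen_ne.mem_nhds hxu), fun a ha => ?_⟩
      simpa [hxu] using ha

/-- If the complement of any two points is connected, every edge lies in a triangle. -/
theorem exists_triangle_of_edge [Nontrivial F] (hfin : M.faces.Finite)
    (hM : IsPuncturedSpace F M.space) (hF : 1 < Module.rank ℝ F) {e : Finset E}
    (he : e ∈ M.faces) (hcard : e.card = 2) : ∃ s ∈ M.faces, s.card = 3 ∧ e ⊆ s := by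
  classical
  by_contra hn
  push Not at hn
  obtain ⟨u, w, huw, rfl⟩ := Finset.card_eq_two.1 hcard
  have hcar : ∀ y ∈ M.space, 0 < bary M y u → 0 < bary M y w →
      y ∈ convexHull ℝ (({u, w} : Finset E) : Set E) := by
    intro y hy h1 h2
    obtain ⟨s, hs, hys, hsb⟩ := exists_carrier hy
    have h1 := (hsb u).2 h1
    have h2 := (hsb w).2 h2
    have : s = {u, w} := by
      by_contra hne
      obtain ⟨x, hx, hxn⟩ : ∃ x ∈ s, x ∉ ({u, w} : Finset E) := by
        by_contra h
        push Not at h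
        exact hne (Finset.Subset.antisymm h (by grind))
      exact hn {x, u, w} (M.down_closed hs (by grind) (by simp)) (by
        rw [Finset.card_insert_of_notMem hxn, hcard]) (by simp)
    rwa [← this]
  -- the points that divide the edge into three equal parts
  let pt : ℝ → E := fun a => a • u + (1 - a) • w
  have hpt : ∀ a ∈ Icc (0 : ℝ) 1, pt a ∈ convexHull ℝ (({u, w} : Finset E) : Set E) :=
    fun a ha => (convex_convexHull ℝ _) (subset_convexHull ℝ _ (by simp))
      (subset_convexHull ℝ _ (by simp)) ha.1 (by linarith [ha.2]) (by ring)
  have hsp := SimplicialComplex.convexHull_subset_space he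
  have hub : {u} ∈ M.faces := M.down_closed he (by simp) (by simp)
  have hwb : {w} ∈ M.faces := M.down_closed he (by simp) (by simp)
  have hbu : ∀ a ∈ Icc (0 : ℝ) 1, bary M (pt a) u = a := fun a ha => by
    rw [bary_combination he (subset_convexHull ℝ _ (by simp)) (subset_convexHull ℝ _ (by simp))
      ha.1 (by linarith [ha.2]) (by ring), bary_vertex hub, bary_vertex hwb, if_pos rfl, if_neg huw]
    ring
  have hbw : ∀ a ∈ Icc (0 : ℝ) 1, bary M (pt a) w = 1 - a := fun a ha => by
    rw [bary_combination he (subset_convexHull ℝ _ (by simp)) (subset_convexHull ℝ _ (by simp))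
      ha.1 (by linarith [ha.2]) (by ring), bary_vertex hub, bary_vertex hwb, if_pos rfl,
      if_neg huw.symm]
    ring
  have heq : ∀ y ∈ convexHull ℝ (({u, w} : Finset E) : Set E), bary M y u + bary M y w = 1 ∧
      y = pt (bary M y u) := by
    intro y hy
    have h1 := sum_bary he hy
    have h2 := sum_bary_smul he hy
    rw [Finset.sum_pair huw] at h1 h2
    refine ⟨h1, ?_⟩
    simp only [pt]
    rw [← h1, add_sub_cancel_left, h2]
  have hconn := hM.isPreconnected_diff_pair hF (hsp (hpt (1 / 3) (by norm_num)))
    (hsp (hpt (2 / 3) (by norm_num)))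
  set T := M.space \ {pt (1 / 3), pt (2 / 3)} with hT
  have hTs : T ⊆ M.space := sdiff_subset
  have hcont : ∀ z, ContinuousOn (fun y => bary M y z) T := fun z => (continuousOn_bary hfin z).mono hTs
  have hne : ∀ a ∈ Icc (0 : ℝ) 1, a ≠ 1 / 3 → a ≠ 2 / 3 → pt a ∈ T := by
    intro a ha h1 h2
    refine ⟨hsp (hpt a ha), ?_⟩
    rintro (h | h)
    · exact h1 (by rw [← hbu a ha, h, hbu _ (by norm_num)])
    · exact h2 (by rw [← hbu a ha, mem_singleton_iff.1 h, hbu _ (by norm_num)])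
  -- With no triangle on the edge, its open middle third is open and closed in `T`. It contains the
  -- midpoint but not the end `pt 1 = u`.
  have h := eq_of_isPreconnected hconn (f := fun y => 1 / 3 < bary M y u ∧ 1 / 3 < bary M y w)
    (fun x hx => ?_) (hne (1 / 2) (by norm_num) (by norm_num) (by norm_num))
    (hne 1 (by norm_num) (by norm_num) (by norm_num))
  · have h' : (1 : ℝ) / 3 < bary M (pt 1) u ∧ 1 / 3 < bary M (pt 1) w := by
      rw [← h, hbu _ (by norm_num), hbw _ (by norm_num)]
      norm_num
    rw [hbu _ (by norm_num), hbw _ (by norm_num)] at h'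
    norm_num at h'
  · by_cases hfx : 1 / 3 < bary M x u ∧ 1 / 3 < bary M x w
    · refine ⟨_, inter_mem ((hcont u x hx).eventually (lt_mem_nhds hfx.1))
        ((hcont w x hx).eventually (lt_mem_nhds hfx.2)), fun a ha => ?_⟩
      exact propext ⟨fun _ => hfx, fun _ => ha⟩
    · have hlt : bary M x u < 1 / 3 ∨ bary M x w < 1 / 3 := by
        by_contra hc
        push Not at hc
        obtain ⟨h1, h2⟩ := heq x (hcar x hx.1 (by linarith [hc.1]) (by linarith [hc.2]))
        rcases hc.1.eq_or_lt with h3 | h3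
        · exact hx.2 (Or.inl (by rw [h2, ← h3]))
        · rcases hc.2.eq_or_lt with h4 | h4
          · refine hx.2 (Or.inr ?_)
            rw [mem_singleton_iff, h2, show bary M x u = 2 / 3 by linarith]
          · exact hfx ⟨h3, h4⟩
      rcases hlt with hlt | hlt
      · refine ⟨_, (hcont u x hx).eventually (gt_mem_nhds hlt), fun a ha => propext ?_⟩
        have ha' : bary M a u < 1 / 3 := ha
        constructor
        · intro h; linarith [h.1]
        · intro h; exact (hfx h).elim
      · refine ⟨_, (hcont w x hx).eventually (gt_mem_nhds hlt), fun a ha => propext ?_⟩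
        have ha' : bary M a w < 1 / 3 := ha
        constructor
        · intro h; linarith [h.2]
        · intro h; exact (hfx h).elim

end Faces

/-- A complex in space that becomes a plane after removal of any point, contains no tetrahedra. -/
theorem card_ne_four {M : SimplicialComplex ℝ (EuclideanSpace ℝ (Fin 3))}
    (hM : IsPuncturedSpace ℂ M.space) {s : Finset (EuclideanSpace ℝ (Fin 3))} (hs : s ∈ M.faces) :
    s.card ≠ 4 := by
  intro hcard
  have htop : affineSpan ℝ (s : Set (EuclideanSpace ℝ (Fin 3))) = ⊤ := by
    have h := (M.indep hs).affineSpan_eq_top_iff_card_eq_finrank_add_one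
    rw [Subtype.range_coe] at h
    exact h.2 (by simp [hcard])
  obtain ⟨p, hp⟩ := interior_convexHull_nonempty_iff_affineSpan_eq_top.2 htop
  obtain ⟨r, hr, hball⟩ := Metric.isOpen_iff.1 isOpen_interior p hp
  have hsub : Metric.ball p r ⊆ M.space := hball.trans
    (interior_subset.trans (SimplicialComplex.convexHull_subset_space hs))
  obtain ⟨q, hq, hqp⟩ := hM.exists_ne (hsub (Metric.mem_ball_self hr))
  obtain ⟨φ, ψ, hc⟩ := hM q hq
  have hr' : 0 < min r (dist q p) := lt_min hr (dist_pos.2 hqp)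
  -- A ball inside the tetrahedron that avoids `q` is a copy of three-space, which the chart at `q`
  -- would embed into the plane.
  let b := OpenPartialHomeomorph.univBall p (min r (dist q p))
  have hbsrc : b.source = univ := OpenPartialHomeomorph.univBall_source _ _
  have hbtgt : b.target = Metric.ball p (min r (dist q p)) :=
    OpenPartialHomeomorph.univBall_target _ hr'
  have hbm : ∀ x, b x ∈ M.space \ {q} := by
    intro x
    have h1 : b x ∈ Metric.ball p (min r (dist q p)) := by
      rw [← hbtgt]; exact b.map_source (by rw [hbsrc]; trivial)
    rw [Metric.mem_ball, lt_min_iff] at h1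
    exact ⟨hsub h1.1, fun h => by rw [mem_singleton_iff.1 h] at h1; exact h1.2.ne rfl⟩
  have hbc : Continuous b := by rw [← continuousOn_univ, ← hbsrc]; exact b.continuousOn
  refine not_injective_of_continuous (j := fun x => φ (b x))
    (hc.continuousOn.comp_continuous hbc hbm) fun x y hxy => ?_
  have h1 : b x = b y := by rw [← hc.left_inv _ (hbm x), show φ (b x) = φ (b y) from hxy, hc.left_inv _ (hbm y)]
  exact b.injOn (by rw [hbsrc]; trivial) (by rw [hbsrc]; trivial) h1

/-! ### The second homology of a triangulated sphere -/

/-- Local primitives on three relatively open sets that agree on the overlaps glue. -/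
theorem exists_coboundaryNear_of_three {X : Type*} [TopologicalSpace X] {S W₁ W₂ W₃ : Set X}
    {g : X → X → ZMod 2} {f₁ f₂ f₃ : X → ZMod 2}
    (hW : ∀ x ∈ S, W₁ ∈ 𝓝[S] x ∨ W₂ ∈ 𝓝[S] x ∨ W₃ ∈ 𝓝[S] x) (h₁ : CoboundaryNear W₁ g f₁)
    (h₂ : CoboundaryNear W₂ g f₂) (h₃ : CoboundaryNear W₃ g f₃)
    (h₁₂ : ∀ y ∈ W₁, y ∈ W₂ → f₁ y = f₂ y) (h₁₃ : ∀ y ∈ W₁, y ∈ W₃ → f₁ y = f₃ y)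
    (h₂₃ : ∀ y ∈ W₂, y ∈ W₃ → f₂ y = f₃ y) : ∃ F, CoboundaryNear S g F := by
  classical
  have key : ∀ (W : Set X) (f F : X → ZMod 2), CoboundaryNear W g f → (∀ y ∈ W, F y = f y) →
      ∀ x ∈ S, W ∈ 𝓝[S] x → ∃ U ∈ 𝓝[S] x, ∀ a ∈ U, ∀ b ∈ U, g a b = F a + F b := by
    intro W f F hf hF x hx hi
    obtain ⟨U, hU, h⟩ := hf x (mem_of_mem_nhdsWithin hx hi)
    have hle : 𝓝[S] x ≤ 𝓝[W] x := by
      rw [nhdsWithin, nhdsWithin]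
      exact le_inf inf_le_left (le_principal_iff.2 hi)
    refine ⟨U ∩ W, inter_mem (hle hU) hi, fun a ha b hb => ?_⟩
    rw [h a ha.1 b hb.1, hF a ha.2, hF b hb.2]
  refine ⟨fun y => if y ∈ W₁ then f₁ y else if y ∈ W₂ then f₂ y else f₃ y, fun x hx => ?_⟩
  rcases hW x hx with h | h | h
  · exact key W₁ f₁ _ h₁ (fun y hy => if_pos hy) x hx h
  · refine key W₂ f₂ _ h₂ (fun y hy => ?_) x hx h
    split_ifs with h'
    · exact h₁₂ y h' hy
    · rfl
  · refine key W₃ f₃ _ h₃ (fun y hy => ?_) x hx h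
    split_ifs with h' h''
    · exact h₁₃ y h' hy
    · exact h₂₃ y h'' hy
    · rfl

theorem sum_sum_erase {ι A : Type*} [DecidableEq ι] [AddCommMonoid A] {p q r : ι} (hpq : p ≠ q)
    (hpr : p ≠ r) (hqr : q ≠ r) (f : ι → ι → A) :
    ∑ x ∈ ({p, q, r} : Finset ι), ∑ y ∈ ({p, q, r} : Finset ι).erase x, f x y =
      f p q + f p r + (f q p + f q r + (f r p + f r q)) := by
  have ep : ({p, q, r} : Finset ι).erase p = {q, r} := by grind
  have eq : ({p, q, r} : Finset ι).erase q = {p, r} := by grind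
  have er : ({p, q, r} : Finset ι).erase r = {p, q} := by grind
  rw [Finset.sum_insert (by simp [hpq, hpr]), Finset.sum_pair hqr, ep, eq, er, Finset.sum_pair hqr,
    Finset.sum_pair hpr, Finset.sum_pair hpq]

section Sphere

variable {E : Type*} [NormedAddCommGroup E] [InnerProductSpace ℝ E] [FiniteDimensional ℝ E]
variable {M : SimplicialComplex ℝ E}

omit [FiniteDimensional ℝ E] in
/-- Two cochains with the same local coboundary have the same sum over the ends of an edge. -/
theorem sum_eq_of_coboundaryNear {g : E → E → ZMod 2} {f f' : E → ZMod 2} {S S' : Set E}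
    {e : Finset E} (he : e.card = 2) (hf : CoboundaryNear S g f) (hf' : CoboundaryNear S' g f')
    (h : convexHull ℝ (e : Set E) ⊆ S) (h' : convexHull ℝ (e : Set E) ⊆ S') :
    ∑ u ∈ e, f u = ∑ u ∈ e, f' u := by
  classical
  obtain ⟨a, b, hab, rfl⟩ := Finset.card_eq_two.1 he
  have h1 := (hf.mono h).add_eq (hf'.mono h') (convex_convexHull ℝ _).isPreconnected
    (subset_convexHull ℝ _ (by simp : a ∈ _)) (subset_convexHull ℝ _ (by simp : b ∈ _))
  rw [Finset.sum_pair hab, Finset.sum_pair hab]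
  generalize f a = p at *
  generalize f b = q at *
  generalize f' a = r at *
  generalize f' b = s at *
  clear * - h1
  revert p q r s; decide

/-- A local cocycle on a triangle without its barycentre is trivial, if it sums to zero along the
boundary of the triangle. -/
theorem exists_coboundaryNear_punctured_triangle (hfin : M.faces.Finite) {t : Finset E}
    (ht : t ∈ M.faces) (hcard : t.card = 3) {g : E → E → ZMod 2}
    (hg : LocallyCoboundary (convexHull ℝ (t : Set E) \ {barycenter t}) g)
    {c : Finset E → E → ZMod 2}
    (hc : ∀ e ⊂ t, CoboundaryNear (convexHull ℝ (e : Set E)) g (c e))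
    (hsum : ∀ [DecidableEq E], ∑ x ∈ t, ∑ y ∈ t.erase x, c (t.erase x) y = 0) :
    ∃ f, CoboundaryNear (convexHull ℝ (t : Set E) \ {barycenter t}) g f := by
  classical
  set S := convexHull ℝ (t : Set E) \ {barycenter t} with hS
  -- These three convex sets miss the barycentre and cover the rest, since coordinates that sum to
  -- one and are all at least `1 / 3` equal `1 / 3`. Each `W x` contains the side opposite `x`, and
  -- two of them meet in a convex set containing the third vertex.
  let W : E → Set E := fun x => {y | y ∈ convexHull ℝ (t : Set E) ∧ bary M y x < 1 / 3}
  have hWS : ∀ x ∈ t, W x ⊆ S := by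
    refine fun x hx y hy => ⟨hy.1, fun h => ?_⟩
    have := hy.2
    rw [mem_singleton_iff.1 h, bary_barycenter ht, if_pos hx, hcard] at this
    norm_num at this
  have hconv : ∀ x, Convex ℝ (W x) := by
    intro x y hy z hz a b ha hb hab
    refine ⟨convex_convexHull ℝ _ hy.1 hz.1 ha hb hab, ?_⟩
    rw [bary_combination ht hy.1 hz.1 ha hb hab]
    rcases ha.eq_or_lt with rfl | ha
    · rw [zero_add] at hab
      simpa [hab] using hz.2
    · nlinarith [hy.2, hz.2]
  have hvert : ∀ x ∈ t, ∀ y ∈ t, x ≠ y → y ∈ W x := by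
    intro x hx y hy hxy
    refine ⟨subset_convexHull ℝ _ hy, ?_⟩
    rw [bary_vertex (M.down_closed ht (by simpa using hy) (by simp)), if_neg hxy]
    norm_num
  have hface : ∀ x ∈ t, convexHull ℝ ((t.erase x : Finset E) : Set E) ⊆ W x := fun x hx =>
    convexHull_min (fun y hy => by
      have := Finset.mem_erase.1 (Finset.mem_coe.1 hy)
      exact hvert x hx y this.2 this.1.symm) (hconv x)
  have hnear : ∀ x ∈ S, ∃ i : t, W i ∈ 𝓝[S] x := by
    intro y hy
    obtain ⟨x, hx, hlt⟩ : ∃ x ∈ t, bary M y x < 1 / 3 := by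
      by_contra h
      push Not at h
      refine hy.2 (eq_barycenter ht hy.1 (m := 1 / 3) fun u hu => ?_)
      have h1 := sum_bary ht hy.1
      obtain ⟨p, q, r, hpq, hpr, hqr, rfl⟩ := Finset.card_eq_three.1 hcard
      rw [Finset.sum_insert (by simp [hpq, hpr]), Finset.sum_pair hqr] at h1
      have hp := h p (by simp)
      have hq := h q (by simp)
      have hr := h r (by simp)
      simp only [Finset.mem_insert, Finset.mem_singleton] at hu
      rcases hu with rfl | rfl | rfl <;> linarith
    have hcont : ContinuousOn (fun z => bary M z x) S := (continuousOn_bary hfin x).mono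
      (sdiff_subset.trans (SimplicialComplex.convexHull_subset_space ht))
    refine ⟨⟨x, hx⟩, ?_⟩
    filter_upwards [(hcont y hy).eventually (gt_mem_nhds hlt), self_mem_nhdsWithin] with z hz hzS
    exact ⟨hzS.1, hz⟩
  have hf : ∀ x, ∃ f, x ∈ t → CoboundaryNear (W x) g f := by
    intro x
    by_cases hx : x ∈ t
    · obtain ⟨f, hf⟩ := Convex.h1Trivial (hconv x) g (hg.mono (hWS x hx))
      exact ⟨f, fun _ => hf⟩
    · exact ⟨0, fun h => (hx h).elim⟩
  choose f hf using hf
  have hsum' : ∑ x ∈ t, ∑ y ∈ t.erase x, f x y = 0 := by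
    rw [← hsum]
    refine Finset.sum_congr rfl fun x hx => sum_eq_of_coboundaryNear ?_ (hf x hx)
      (hc _ (Finset.erase_ssubset hx)) (hface x hx) subset_rfl
    rw [Finset.card_erase_of_mem hx, hcard]
  -- the local primitives differ by constants
  have hdiff : ∀ x ∈ t, ∀ y ∈ t, ∀ z ∈ t, x ≠ z → y ≠ z → ∀ w ∈ W x, w ∈ W y →
      f x w + f y w = f x z + f y z := by
    intro x hx y hy z hz hxz hyz w hwx hwy
    exact ((hf x hx).mono inter_subset_left).add_eq ((hf y hy).mono inter_subset_right)
      ((hconv x).inter (hconv y)).isPreconnected ⟨hwx, hwy⟩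
      ⟨hvert x hx z hz hxz, hvert y hy z hz hyz⟩
  obtain ⟨p, q, r, hpq, hpr, hqr, rfl⟩ := Finset.card_eq_three.1 hcard
  rw [sum_sum_erase hpq hpr hqr] at hsum'
  have hmp : p ∈ ({p, q, r} : Finset E) := by simp
  have hmq : q ∈ ({p, q, r} : Finset E) := by simp
  have hmr : r ∈ ({p, q, r} : Finset E) := by simp
  have hmove : ∀ a b c d : ZMod 2, a + b = c + d → a = b + (c + d) := by decide
  -- The primitives at `q` and `r` are shifted by constants to match the one at `p`. That they then
  -- match each other is exactly the vanishing of the sum along the boundary.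
  refine exists_coboundaryNear_of_three (W₁ := W p) (W₂ := W q) (W₃ := W r)
    (fun x hx => ?_) (hf p hmp) ((hf q hmq).add_const (f p r + f q r))
    ((hf r hmr).add_const (f p q + f r q)) (fun y hy hy' => ?_) (fun y hy hy' => ?_)
    (fun y hy hy' => ?_)
  · obtain ⟨⟨i, hi⟩, hx⟩ := hnear x hx
    simp only [Finset.mem_insert, Finset.mem_singleton] at hi
    rcases hi with rfl | rfl | rfl
    exacts [Or.inl hx, Or.inr (Or.inl hx), Or.inr (Or.inr hx)]
  · exact hmove _ _ _ _ (hdiff p hmp q hmq r hmr hpr hqr y hy hy')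
  · exact hmove _ _ _ _ (hdiff p hmp r hmr q hmq hpq hqr.symm y hy hy')
  · have h3 := hdiff q hmq r hmr p hmp hpq.symm hpr.symm y hy hy'
    have h4 := hmove _ _ _ _ h3
    have h5 : f q p + f r p = f p q + f p r + f q r + f r q := by
      have : f p q + f p r + f q r + f r q + (f q p + f r p) = 0 := by rw [← hsum']; ring
      exact (CharTwo.add_eq_zero.1 this).symm
    have h6 : f p r + f p r = 0 := zmod_two_add_cancel _
    have h7 : f q r + f q r = 0 := zmod_two_add_cancel _
    rw [h4, h5]
    linear_combination h6 + h7

end Sphere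

/-! ### The fundamental cycle of a triangulated sphere -/

section Sphere

variable {E : Type*} [NormedAddCommGroup E] [InnerProductSpace ℝ E]
variable {M : SimplicialComplex ℝ E}

theorem card_le_of_forall_ne {k : ℕ} (h : ∀ s ∈ M.faces, s.card ≠ k + 1) {s : Finset E}
    (hs : s ∈ M.faces) : s.card ≤ k := by
  by_contra hlt
  obtain ⟨t, hts, ht⟩ := Finset.exists_subset_card_eq (show k + 1 ≤ s.card by omega)
  exact h t (M.down_closed hs hts (Finset.card_pos.1 (by omega))) ht

theorem add_simplexChain_mem_deleteStar {k : ℕ} {c : FormalChain E} (hc : c ∈ chains M k)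
    {t : Finset E} (ht : t ∈ M.faces) (hcard : t.card = k + 1) (hct : c t = 1) :
    c + simplexChain t ∈ chains (deleteStar M t) k := by
  classical
  rw [mem_chains]
  intro s hs
  have hsM : s ∈ M.faces ∧ s.card = k + 1 :=
    mem_chains.1 (Submodule.add_mem _ hc (simplexChain_mem_chains ht hcard)) s hs
  refine ⟨⟨hsM.1, fun hsub => hs ?_⟩, hsM.2⟩
  rw [← Finset.eq_of_subset_of_card_le hsub (by omega)]
  simp [hct, zmod_two_add_cancel]

theorem mem_chains_deleteStar {k : ℕ} {c : FormalChain E} (hc : c ∈ chains M k)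
    {t : Finset E} (hcard : t.card = k + 1) (hct : c t = 0) : c ∈ chains (deleteStar M t) k := by
  rw [mem_chains] at hc ⊢
  intro s hs
  refine ⟨⟨(hc s hs).1, fun hsub => hs ?_⟩, (hc s hs).2⟩
  rw [← Finset.eq_of_subset_of_card_le hsub (by have := (hc s hs).2; omega), hct]

variable [FiniteDimensional ℝ E]

/-- If the local cocycle of a function to the punctured plane vanishes along the boundary of a
triangle, the function has a square root on the triangle without its barycentre. -/
theorem exists_sqrt_of_cycle (hfin : M.faces.Finite) {t t' : Finset E} (ht : t ∈ M.faces)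
    (ht' : t' ∈ M.faces) (hcard : t.card = 3) (hcard' : t'.card = 3)
    {z : FormalChain E} (hz : z ∈ cycles M 2) (hzt : z t = 1) (hzt' : z t' = 0) {ζ : E → ℂ}
    (hζ : ContinuousOn ζ (M.space \ {barycenter t'}))
    (hζ0 : ∀ y ∈ M.space \ {barycenter t'}, y ≠ barycenter t → ζ y ≠ 0) :
    ∃ σ : E → ℂ, ContinuousOn σ (convexHull ℝ (t : Set E) \ {barycenter t}) ∧
      ∀ y, σ y ^ 2 = ζ y := by
  classical
  have htt' : t ≠ t' := fun h => by rw [h, hzt'] at hzt; exact zero_ne_one hzt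
  set g := rootCocycle ζ
  set S := (M.space \ {barycenter t'}) \ {barycenter t} with hS
  have hζS : ContinuousOn ζ S := hζ.mono sdiff_subset
  have hg : LocallyCoboundary S g := locallyCoboundary_rootCocycle hζS fun y hy => hζ0 y hy.1 hy.2
  have hconvS : ∀ s ∈ M.faces, ¬t ⊆ s → ¬t' ⊆ s → convexHull ℝ (s : Set E) ⊆ S :=
    fun s hs h h' y hy => ⟨mem_space_diff_barycenter ht' ⟨hs, h'⟩ hy,
      (mem_space_diff_barycenter ht ⟨hs, h⟩ hy).2⟩
  have hcex : ∀ s : Finset E, ∃ f : E → ZMod 2, convexHull ℝ (s : Set E) ⊆ S →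
      CoboundaryNear (convexHull ℝ (s : Set E)) g f := by
    intro s
    by_cases hs : convexHull ℝ (s : Set E) ⊆ S
    · obtain ⟨f, hf⟩ := Convex.h1Trivial (convex_convexHull ℝ (s : Set E)) g (hg.mono hs)
      exact ⟨f, fun _ => hf⟩
    · exact ⟨0, fun h => (hs h).elim⟩
  choose c hc using hcex
  -- the simplicial cochain that sums the local cocycle along edges
  let Γ : FormalChain E →ₗ[ZMod 2] ZMod 2 :=
    Finsupp.linearCombination (ZMod 2) fun s => ∑ u ∈ s, c s u
  have hΓ : ∀ s : Finset E, s.card = 3 → Γ (boundaryMap E (simplexChain s)) =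
      ∑ x ∈ s, ∑ y ∈ s.erase x, c (s.erase x) y := by
    intro s hs
    rw [boundaryMap_simplexChain_of_two_le (by omega), map_sum]
    simp [Γ]
  -- On a triangle other than `t` and `t'` a single primitive serves all three sides, so `Γ` kills
  -- its boundary. The chain `z + simplexChain t` has only such triangles; as `z` is a cycle, `Γ`
  -- also kills the boundary of `t`.
  have hz0 : Γ (boundaryMap E (z + simplexChain t)) = 0 := by
    have h1 : z + simplexChain t ∈ chains (deleteStar (deleteStar M t) t') 2 :=
      mem_chains_deleteStar (add_simplexChain_mem_deleteStar hz.1 ht hcard hzt) hcard'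
        (by simp [hzt', htt'])
    refine eqOn_chains (f := Γ.comp (boundaryMap E)) (g := 0) (fun s hs hk => ?_) h1
    rw [LinearMap.comp_apply, hΓ s hk, LinearMap.zero_apply]
    have hsS := hconvS s hs.1.1 hs.1.2 hs.2
    have h2 : ∀ x ∈ s, ∑ y ∈ s.erase x, c (s.erase x) y = ∑ y ∈ s.erase x, c s y := by
      intro x hx
      have h3 : convexHull ℝ ((s.erase x : Finset E) : Set E) ⊆ convexHull ℝ (s : Set E) :=
        convexHull_mono (Finset.coe_subset.2 (Finset.erase_subset _ _))
      exact sum_eq_of_coboundaryNear (by rw [Finset.card_erase_of_mem hx, hk])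
        (hc _ (h3.trans hsS)) (hc s hsS) subset_rfl h3
    rw [Finset.sum_congr rfl h2]
    obtain ⟨p, q, r, hpq, hpr, hqr, rfl⟩ := Finset.card_eq_three.1 hk
    rw [sum_sum_erase hpq hpr hqr]
    generalize c {p, q, r} p = a1
    generalize c {p, q, r} q = a2
    generalize c {p, q, r} r = a3
    revert a1 a2 a3; decide
  rw [map_add, LinearMap.mem_ker.1 hz.2, zero_add, hΓ t hcard] at hz0
  have htS : convexHull ℝ (t : Set E) \ {barycenter t} ⊆ S := fun y hy =>
    ⟨mem_space_diff_barycenter ht' ⟨ht, fun h => htt'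
      (Finset.eq_of_subset_of_card_le h (by omega)).symm⟩ hy.1, hy.2⟩
  have hce : ∀ e ⊂ t, CoboundaryNear (convexHull ℝ (e : Set E)) g (c e) := by
    intro e he
    rcases e.eq_empty_or_nonempty with rfl | hne
    · intro x hx
      simp at hx
    · have hlt := Finset.card_lt_card he
      exact hc e (hconvS e (M.down_closed ht he.1 hne) he.2 fun h => by
        have := Finset.card_le_card h
        omega)
  obtain ⟨f, hf⟩ := exists_coboundaryNear_punctured_triangle hfin ht hcard (hg.mono htS) hce (by
    intro inst
    convert hz0)
  exact exists_sqrt_of_coboundaryNear (hζS.mono htS) (fun y hy => hζ0 y (htS hy).1 hy.2) hf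

/-- In a triangulated sphere, a cycle that contains one triangle contains all of them. -/
theorem cycle_apply_ne_zero (hfin : M.faces.Finite) (hM : IsPuncturedSpace ℂ M.space)
    (hle : ∀ s ∈ M.faces, s.card ≤ 3) {t t' : Finset E} (ht : t ∈ M.faces)
    (ht' : t' ∈ M.faces) (hcard : t.card = 3) (hcard' : t'.card = 3) {z : FormalChain E}
    (hz : z ∈ cycles M 2) (hzt : z t ≠ 0) : z t' ≠ 0 := by
  classical
  intro hzt'
  have hzt1 : z t = 1 := (zmod_two_cases _).resolve_left hzt
  have htt' : t ≠ t' := fun h => hzt (by rw [h, hzt'])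
  obtain ⟨φ, ψ, hch⟩ := hM _ (barycenter_mem_space ht')
  set p := barycenter t with hp
  have hpS : p ∈ M.space \ {barycenter t'} := mem_space_diff_barycenter ht' (s := t)
    ⟨ht, fun h => htt' (Finset.eq_of_subset_of_card_le h (by omega)).symm⟩
    (barycenter_mem (M.nonempty_of_mem_faces ht))
  -- If `z` omits `t'`, the chart away from the barycentre of `t'`, shifted to vanish at `p`, has a
  -- square root on `t` without `p`. Small circles about the origin pull back into the interior of
  -- `t`, since no face is larger than `t`, and they would inherit this root.
  obtain ⟨σ, hσ, hsq⟩ := exists_sqrt_of_cycle hfin ht ht' hcard hcard' hz hzt1 hzt'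
    (ζ := fun y => φ y - φ p) (hch.continuousOn.sub continuousOn_const) fun y hy hyp h => hyp (by
      rw [← hch.left_inv y hy, sub_eq_zero.1 h, hch.left_inv p hpS])
  -- the interior of `t` is a neighbourhood of its barycentre
  have hnear : ∀ᶠ y in 𝓝[M.space] p, ∀ u ∈ t, 0 < bary M y u := by
    rw [Filter.eventually_all_finset]
    intro u hu
    refine (continuousOn_bary hfin u p (barycenter_mem_space ht)).eventually (lt_mem_nhds ?_)
    change 0 < bary M (barycenter t) u
    rw [bary_barycenter ht, if_pos hu, hcard]
    norm_num
  let ψ' : ℂ → E := fun w => ψ (w + φ p)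
  have hψ' : Continuous ψ' := hch.continuous_symm.comp (by fun_prop)
  have hψ'0 : ψ' 0 = p := by simp only [ψ', zero_add, hch.left_inv p hpS]
  have htend : Tendsto ψ' (𝓝 0) (𝓝[M.space] p) := by
    refine tendsto_nhdsWithin_iff.2 ⟨?_, Eventually.of_forall fun w => (hch.mem _).1⟩
    rw [← hψ'0]
    exact hψ'.tendsto 0
  obtain ⟨δ, hδ, hball⟩ := Metric.nhds_basis_closedBall.mem_iff.1 (htend.eventually hnear)
  have hmem : ∀ w ∈ Metric.sphere (0 : ℂ) δ, ψ' w ∈ convexHull ℝ (t : Set E) \ {p} := by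
    intro w hw
    have hpos : ∀ u ∈ t, 0 < bary M (ψ' w) u := hball (Metric.sphere_subset_closedBall hw)
    obtain ⟨s, hs, hys, hsb⟩ := exists_carrier (hch.mem (w + φ p)).1
    have hts : t = s := Finset.eq_of_subset_of_card_le (fun u hu => (hsb u).2 (hpos u hu))
      (by have := hle s hs; omega)
    refine ⟨by rw [hts]; exact hys, fun h => ?_⟩
    have h1 : φ (ψ' w) = φ p := by rw [mem_singleton_iff.1 h]
    simp only [ψ', hch.right_inv, add_eq_right] at h1
    rw [h1] at hw
    simp only [mem_sphere_iff_norm, sub_self, norm_zero] at hw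
    exact hδ.ne hw
  refine no_sqrt_on_circle hδ (σ := fun w => σ (ψ' w)) (hσ.comp hψ'.continuousOn hmem) fun w _ => ?_
  rw [hsq]
  simp [ψ', hch.right_inv]

/-- A finite connected complex of pure dimension `k` whose only nonzero `k`-cycle is `z`, and `z`
consists of all `k`-simplices. -/
structure HasFundamentalCycle (M : SimplicialComplex ℝ E) (k : ℕ) (z : FormalChain E) : Prop where
  finite : M.faces.Finite
  nonempty : M.faces.Nonempty
  card_le : ∀ s ∈ M.faces, s.card ≤ k + 1
  connected : ∀ u w, {u} ∈ M.faces → {w} ∈ M.faces →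
    simplexChain {u} + simplexChain {w} ∈ boundaries M 0
  exists_facet : ∀ s ∈ M.faces, ∃ t ∈ M.faces, t.card = k + 1 ∧ s ⊆ t
  fundamental_mem : z ∈ cycles M k
  fundamental_apply : ∀ s ∈ M.faces, s.card = k + 1 → z s = 1
  cycles_eq : ∀ c ∈ cycles M k, c = 0 ∨ c = z

omit [FiniteDimensional ℝ E] in
/-- A cycle that contains all `k`-simplices is the only one, if every nonzero cycle contains
all of them. -/
theorem hasFundamentalCycle_of_forall {k : ℕ} (hfin : M.faces.Finite)
    (hle : ∀ s ∈ M.faces, s.card ≤ k + 1)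
    (hconn : ∀ u w, {u} ∈ M.faces → {w} ∈ M.faces →
      simplexChain {u} + simplexChain {w} ∈ boundaries M 0)
    (hfacet : ∀ s ∈ M.faces, ∃ t ∈ M.faces, t.card = k + 1 ∧ s ⊆ t) {z : FormalChain E}
    (hz : z ∈ cycles M k) {t : Finset E} (ht : t ∈ M.faces) (htk : t.card = k + 1) (hzt : z t = 1)
    (hall : ∀ w ∈ cycles M k, ∀ s ∈ M.faces, ∀ s' ∈ M.faces, s.card = k + 1 → s'.card = k + 1 →
      w s = w s') : HasFundamentalCycle M k z := by
  have hz1 : ∀ s ∈ M.faces, s.card = k + 1 → z s = 1 := fun s hs hk => by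
    rw [← hzt, hall z hz s hs t ht hk htk]
  refine ⟨hfin, ⟨t, ht⟩, hle, hconn, hfacet, hz, hz1, fun w hw => ?_⟩
  have hout : ∀ v ∈ cycles M k, ∀ s, ¬(s ∈ M.faces ∧ s.card = k + 1) → v s = 0 := fun v hv s hs => by
    by_contra h
    exact hs (mem_chains.1 hv.1 s h)
  rcases zmod_two_cases (w t) with h | h
  · left
    ext s
    by_cases hs : s ∈ M.faces ∧ s.card = k + 1
    · rw [hall w hw s hs.1 t ht hs.2 htk, h]; rfl
    · rw [hout w hw s hs]; rfl
  · right
    ext s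
    by_cases hs : s ∈ M.faces ∧ s.card = k + 1
    · rw [hall w hw s hs.1 t ht hs.2 htk, h, hz1 s hs.1 hs.2]
    · rw [hout w hw s hs, hout z hz s hs]

/-- The combinatorial properties of a triangulation of the two-sphere on which the computation of
persistence diagrams rests. -/
structure IsHomologySphere (M : SimplicialComplex ℝ E) (z : FormalChain E) : Prop
    extends HasFundamentalCycle M 2 z where
  cycles_one : cycles M 1 ≤ boundaries M 1
  star : ∀ c ∈ chains M 2, ∀ u, {u} ∈ M.faces →
    (∀ e ∈ M.faces, e.card = 2 → u ∈ e → boundaryMap E c e = 0) →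
      ∀ s ∈ M.faces, ∀ t ∈ M.faces, s.card = 3 → t.card = 3 → u ∈ s → u ∈ t → c s = c t

theorem exists_isHomologySphere (hfin : M.faces.Finite) (hne : M.space.Nonempty)
    (hM : IsPuncturedSpace ℂ M.space) (h4 : ∀ s ∈ M.faces, s.card ≠ 4) :
    ∃ z, IsHomologySphere M z := by
  classical
  have hle : ∀ s ∈ M.faces, s.card ≤ 3 := fun s hs => card_le_of_forall_ne h4 hs
  have hrank : 1 < Module.rank ℝ ℂ := by rw [Complex.rank_real_complex]; exact Nat.one_lt_ofNat
  have htri : ∀ s ∈ M.faces, ∃ t ∈ M.faces, t.card = 3 ∧ s ⊆ t := by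
    have h2 : ∀ s ∈ M.faces, s.card = 2 → ∃ t ∈ M.faces, t.card = 3 ∧ s ⊆ t := fun s hs hk =>
      exists_triangle_of_edge hfin hM hrank hs hk
    intro s hs
    have hpos := (M.nonempty_of_mem_faces hs).card_pos
    have h3 := hle s hs
    interval_cases hk : s.card
    · obtain ⟨u, rfl⟩ := Finset.card_eq_one.1 hk
      obtain ⟨e, he, hek, hue⟩ := exists_edge_of_vertex hfin hM hs
      obtain ⟨t, ht, htk, het⟩ := h2 e he hek
      exact ⟨t, ht, htk, by simpa using het hue⟩
    · exact h2 s hs hk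
    · exact ⟨s, hs, hk, subset_rfl⟩
  have hdel : ∀ σ ∈ M.faces, cycles (deleteStar M σ) 1 ≤ boundaries (deleteStar M σ) 1 :=
    fun σ hσ => cycles_le_boundaries_deleteStar hfin hσ
      (hM.h1Trivial_diff_singleton (barycenter_mem_space hσ))
  obtain ⟨y, hy⟩ := hne
  obtain ⟨s₀, hs₀, -⟩ := SimplicialComplex.mem_space_iff.1 hy
  obtain ⟨t, ht, htk, -⟩ := htri s₀ hs₀
  have hsub := deleteStar_faces_subset M t
  have hch1 : chains M 1 ≤ chains (deleteStar M t) 1 := chains_le fun s hs hk =>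
    simplexChain_mem_chains ⟨hs, fun h => by have := Finset.card_le_card h; omega⟩ hk
  -- Puncturing the sphere inside `t` leaves a plane, so the boundary of `t` bounds a chain avoiding
  -- `t`. Together with `t` this chain forms the fundamental cycle.
  obtain ⟨c, hc, hct⟩ : boundaryMap E (simplexChain t) ∈ boundaries (deleteStar M t) 1 :=
    hdel t ht ⟨hch1 (boundaryMap_mem_chains (simplexChain_mem_chains ht htk)),
      boundaryMap_boundaryMap _⟩
  have hct0 : c t = 0 := by
    by_contra h
    exact (mem_chains.1 hc t h).1.2 subset_rfl
  set z := simplexChain t + c with hz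
  have hzc : z ∈ cycles M 2 := ⟨Submodule.add_mem _ (simplexChain_mem_chains ht htk)
    (chains_mono hsub 2 hc), by rw [SetLike.mem_coe, LinearMap.mem_ker, map_add, hct, chain_add_self]⟩
  have hzt : z t = 1 := by simp [hz, hct0]
  have hall : ∀ w ∈ cycles M 2, ∀ s ∈ M.faces, ∀ s' ∈ M.faces, s.card = 3 → s'.card = 3 →
      w s = w s' := by
    intro w hw s hs s' hs' hk hk'
    have h1 := cycle_apply_ne_zero hfin hM hle hs hs' hk hk' hw
    have h2 := cycle_apply_ne_zero hfin hM hle hs' hs hk' hk hw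
    rcases zmod_two_cases (w s) with h | h <;> rcases zmod_two_cases (w s') with h' | h' <;>
      simp_all
  refine ⟨z, hasFundamentalCycle_of_forall hfin hle
    (fun u w hu hw => add_mem_boundaries hfin hM.isPreconnected hu hw) htri hzc ht htk hzt hall,
    fun w hw => boundaries_mono hsub 1 (hdel t ht ⟨hch1 hw.1, hw.2⟩), ?_⟩
  -- The boundary of `c` avoids `u`, so it bounds a chain `d` avoiding `u`. The cycle `c + d` has
  -- one value on all triangles and agrees with `c` on those at `u`.
  · intro c hc u hu hcu s hs s' hs' hk hk' hus hus'
    obtain ⟨d, hd, hdc⟩ : boundaryMap E c ∈ boundaries (deleteStar M {u}) 1 := by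
      refine hdel _ hu ⟨mem_chains.2 fun e he => ?_, boundaryMap_boundaryMap _⟩
      have h1 := mem_chains.1 (boundaryMap_mem_chains hc) e he
      exact ⟨⟨h1.1, fun h => he (hcu e h1.1 h1.2 (by simpa using h))⟩, h1.2⟩
    have hd0 : ∀ r, u ∈ r → d r = 0 := fun r hr => by
      by_contra h
      exact (mem_chains.1 hd r h).1.2 (by simpa using hr)
    have h1 := hall (c + d) ⟨Submodule.add_mem _ hc (chains_mono (deleteStar_faces_subset M _) 2 hd),
      by rw [SetLike.mem_coe, LinearMap.mem_ker, map_add, hdc, chain_add_self]⟩ s hs s' hs' hk hk'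
    simpa [hd0 s hus, hd0 s' hus'] using h1

end Sphere

/-! ### Triangulated circles -/

section Circle

variable {E : Type*} [NormedAddCommGroup E] [InnerProductSpace ℝ E]

/-- By the intermediate value theorem every value between `φ x` and `φ y` is taken on the segment;
injectivity then keeps `w` from taking one. -/
theorem notMem_uIcc_of_injOn {φ : E → ℝ} {S : Set E} (hφ : ContinuousOn φ S) (hinj : InjOn φ S)
    {x y w : E} (hxy : segment ℝ x y ⊆ S) (hw : w ∈ S) (hwn : w ∉ segment ℝ x y) :
    φ w ∉ uIcc (φ x) (φ y) := by
  intro h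
  have h1 : IsPreconnected (φ '' segment ℝ x y) :=
    (convex_segment x y).isPreconnected.image _ (hφ.mono hxy)
  obtain ⟨v, hv, hvw⟩ := h1.ordConnected.uIcc_subset ⟨x, left_mem_segment ℝ x y, rfl⟩
    ⟨y, right_mem_segment ℝ x y, rfl⟩ h
  exact hwn (hinj (hxy hv) hw hvw ▸ hv)

theorem exists_mem_uIcc (a b c : ℝ) : a ∈ uIcc b c ∨ b ∈ uIcc a c ∨ c ∈ uIcc a b := by
  simp only [mem_uIcc]
  rcases le_total a b with h1 | h1 <;> rcases le_total b c with h2 | h2 <;>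
    rcases le_total a c with h3 | h3 <;> tauto

variable {M : SimplicialComplex ℝ E}

/-- A triangle does not embed into a circle. -/
theorem card_ne_three (hM : IsPuncturedSpace ℝ M.space) {t : Finset E} (ht : t ∈ M.faces) :
    t.card ≠ 3 := by
  classical
  intro hcard
  obtain ⟨a, b, c, hab, hac, hbc, rfl⟩ := Finset.card_eq_three.1 hcard
  set t : Finset E := {a, b, c} with htdef
  have hv : ∀ u ∈ t, {u} ∈ M.faces := fun u hu => M.down_closed ht (by simpa using hu) (by simp)
  have hat : a ∈ t := by simp [htdef]
  have hbt : b ∈ t := by simp [htdef]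
  have hct : c ∈ t := by simp [htdef]
  obtain ⟨φ, ψ, hch⟩ := hM a (mem_space_of_vertex (hv a hat))
  set m := barycenter t with hm
  have hmt : m ∈ convexHull ℝ (t : Set E) := barycenter_mem (M.nonempty_of_mem_faces ht)
  have hbc' : b ∈ convexHull ℝ (t : Set E) := subset_convexHull ℝ _ hbt
  have hcc' : c ∈ convexHull ℝ (t : Set E) := subset_convexHull ℝ _ hct
  have hmb : ∀ u ∈ t, bary M m u = 1 / 3 := fun u hu => by
    rw [hm, bary_barycenter ht, if_pos hu, hcard]; norm_num
  have hS : ∀ y ∈ convexHull ℝ (t : Set E), bary M y a ≤ 1 / 3 → y ∈ M.space \ {a} := by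
    refine fun y hy h => ⟨SimplicialComplex.convexHull_subset_space ht hy, fun hya => ?_⟩
    rw [mem_singleton_iff.1 hya, bary_vertex (hv a hat), if_pos rfl] at h
    norm_num at h
  have hba : bary M b a = 0 := by rw [bary_vertex (hv b hbt), if_neg hab]
  have hbb : bary M b b = 1 := by rw [bary_vertex (hv b hbt), if_pos rfl]
  have hbc0 : bary M b c = 0 := by rw [bary_vertex (hv b hbt), if_neg hbc.symm]
  have hca : bary M c a = 0 := by rw [bary_vertex (hv c hct), if_neg hac]
  have hcb : bary M c b = 0 := by rw [bary_vertex (hv c hct), if_neg hbc]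
  have hcc : bary M c c = 1 := by rw [bary_vertex (hv c hct), if_pos rfl]
  have hinj : InjOn φ (M.space \ {a}) := fun x hx y hy h => by
    rw [← hch.left_inv x hx, h, hch.left_inv y hy]
  have hseg : ∀ x ∈ convexHull ℝ (t : Set E), ∀ y ∈ convexHull ℝ (t : Set E),
      bary M x a ≤ 1 / 3 → bary M y a ≤ 1 / 3 → segment ℝ x y ⊆ M.space \ {a} := by
    rintro x hx y hy h1 h2 _ ⟨α, β, hα, hβ, hαβ, rfl⟩
    refine hS _ (convex_convexHull ℝ _ hx hy hα hβ hαβ) ?_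
    rw [bary_combination ht hx hy hα hβ hαβ]
    nlinarith
  have hma := hmb a hat
  have hmb' := hmb b hbt
  have hmc := hmb c hct
  -- None of `m`, `b`, `c` lies on the segment joining the other two, and all three segments miss
  -- `a`. Yet among three real numbers one lies between the others.
  rcases exists_mem_uIcc (φ m) (φ b) (φ c) with h | h | h
  · refine notMem_uIcc_of_injOn hch.continuousOn hinj (hseg b hbc' c hcc' (by rw [hba]; norm_num)
      (by rw [hca]; norm_num)) (hS m hmt hma.le) ?_ h
    rintro ⟨α, β, hα, hβ, hαβ, he⟩
    have h1 := bary_combination ht hbc' hcc' hα hβ hαβ a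
    rw [he, hma, hba, hca] at h1
    norm_num at h1
  · refine notMem_uIcc_of_injOn hch.continuousOn hinj (hseg m hmt c hcc' hma.le
      (by rw [hca]; norm_num)) (hS b hbc' (by rw [hba]; norm_num)) ?_ h
    rintro ⟨α, β, hα, hβ, hαβ, he⟩
    have h1 := bary_combination ht hmt hcc' hα hβ hαβ a
    have h2 := bary_combination ht hmt hcc' hα hβ hαβ b
    rw [he, hma, hba, hca] at h1
    rw [he, hmb', hbb, hcb] at h2
    linarith
  · refine notMem_uIcc_of_injOn hch.continuousOn hinj (hseg m hmt b hbc' hma.le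
      (by rw [hba]; norm_num)) (hS c hcc' (by rw [hca]; norm_num)) ?_ h
    rintro ⟨α, β, hα, hβ, hαβ, he⟩
    have h1 := bary_combination ht hmt hbc' hα hβ hαβ a
    have h2 := bary_combination ht hmt hbc' hα hβ hαβ c
    rw [he, hma, hba, hca] at h1
    rw [he, hmc, hbc0, hcc] at h2
    linarith

variable [FiniteDimensional ℝ E]

/-- In a triangulated circle, a cycle that contains one edge contains all of them. -/
theorem cycle_apply_ne_zero_of_edge (hfin : M.faces.Finite) (hM : IsPuncturedSpace ℝ M.space)
    (hle : ∀ s ∈ M.faces, s.card ≤ 2) {e e' : Finset E} (he : e ∈ M.faces)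
    (he' : e' ∈ M.faces) (hcard : e.card = 2) (hcard' : e'.card = 2) {z : FormalChain E}
    (hz : z ∈ cycles M 1) (hze : z e ≠ 0) : z e' ≠ 0 := by
  classical
  intro hze'
  have hze1 : z e = 1 := (zmod_two_cases _).resolve_left hze
  have hee' : e ≠ e' := fun h => hze (by rw [h, hze'])
  obtain ⟨φ, ψ, hch⟩ := hM _ (barycenter_mem_space he')
  set p := barycenter e with hp
  have hpS : p ∈ M.space \ {barycenter e'} := mem_space_diff_barycenter he' (s := e)
    ⟨he, fun h => hee' (Finset.eq_of_subset_of_card_le h (by omega)).symm⟩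
    (barycenter_mem (M.nonempty_of_mem_faces he))
  set S := (M.space \ {barycenter e'}) \ {p} with hS
  -- the side of `p` on which a point lies
  let side : E → ZMod 2 := fun y => if φ p < φ y then 1 else 0
  have hside : ∀ T ⊆ S, IsPreconnected T → ∀ x ∈ T, ∀ y ∈ T, side x = side y := by
    intro T hTS hT x hx y hy
    refine eq_of_isPreconnected hT (fun w hw => ?_) hx hy
    have hc : ContinuousWithinAt φ T w := (hch.continuousOn w (hTS hw).1).mono (hTS.trans sdiff_subset)
    have hne : φ w ≠ φ p := fun h => (hTS hw).2 (by
      rw [mem_singleton_iff, ← hch.left_inv w (hTS hw).1, h, hch.left_inv p hpS])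
    rcases lt_or_gt_of_ne hne with h | h
    · refine ⟨_, hc.eventually (gt_mem_nhds h), fun a ha => ?_⟩
      have ha' : φ a < φ p := ha
      simp only [side, if_neg ha'.not_gt, if_neg h.not_gt]
    · refine ⟨_, hc.eventually (lt_mem_nhds h), fun a ha => ?_⟩
      have ha' : φ p < φ a := ha
      simp only [side, if_pos ha', if_pos h]
  -- Every edge other than `e` and `e'` stays on one side of `p`, so a cycle through `e` that omits
  -- `e'` forces the two ends of `e` onto the same side.
  have hz0 : vertexFunctional side (boundaryMap E (z + simplexChain e)) = 0 := by
    have h1 : z + simplexChain e ∈ chains (deleteStar (deleteStar M e) e') 1 :=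
      mem_chains_deleteStar (add_simplexChain_mem_deleteStar hz.1 he hcard hze1) hcard'
        (by simp [hze', hee'])
    refine eqOn_chains (f := (vertexFunctional side).comp (boundaryMap E)) (g := 0)
      (fun s hs hk => ?_) h1
    obtain ⟨u, w, huw, rfl⟩ := Finset.card_eq_two.1 hk
    rw [LinearMap.comp_apply, boundaryMap_edge huw, map_add, vertexFunctional_simplexChain,
      vertexFunctional_simplexChain, Finset.sum_singleton, Finset.sum_singleton,
      hside (convexHull ℝ (({u, w} : Finset E) : Set E)) (fun y hy =>
        ⟨mem_space_diff_barycenter he' ⟨hs.1.1, hs.2⟩ hy,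
          (mem_space_diff_barycenter he hs.1 hy).2⟩)
        (convex_convexHull ℝ _).isPreconnected u (subset_convexHull ℝ _ (by simp)) w
        (subset_convexHull ℝ _ (by simp)), zmod_two_add_cancel, LinearMap.zero_apply]
  obtain ⟨u, w, huw, hew⟩ := Finset.card_eq_two.1 hcard
  have hsides : side u = side w := by
    rw [map_add, LinearMap.mem_ker.1 hz.2, zero_add, hew, boundaryMap_edge huw, map_add,
      vertexFunctional_simplexChain, vertexFunctional_simplexChain, Finset.sum_singleton,
      Finset.sum_singleton] at hz0
    exact CharTwo.add_eq_zero.1 hz0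
  have hue : u ∈ e := by simp [hew]
  have hwe : w ∈ e := by simp [hew]
  have hv : ∀ x ∈ e, {x} ∈ M.faces := fun x hx => M.down_closed he (by simpa using hx) (by simp)
  have hpb : ∀ x ∈ e, bary M p x = 1 / 2 := fun x hx => by
    rw [hp, bary_barycenter he, if_pos hx, hcard]; norm_num
  have heS : convexHull ℝ (e : Set E) ⊆ M.space \ {barycenter e'} := fun y hy =>
    mem_space_diff_barycenter he' (s := e)
      ⟨he, fun h => hee' (Finset.eq_of_subset_of_card_le h (by omega)).symm⟩ hy
  have hhalf : ∀ x ∈ e, ∀ x' ∈ e, x ≠ x' → ∀ y ∈ convexHull ℝ (e : Set E), bary M y x < 1 / 2 →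
      side y = side x' := by
    intro x hx x' hx' hxx' y hy hlt
    have hx'e : x' ∈ convexHull ℝ (e : Set E) := subset_convexHull ℝ _ hx'
    refine hside (segment ℝ y x') ?_ (convex_segment y x').isPreconnected y
      (left_mem_segment ℝ y x') x' (right_mem_segment ℝ y x')
    rintro _ ⟨α, β, hα, hβ, hαβ, rfl⟩
    refine ⟨heS (convex_convexHull ℝ _ hy hx'e hα hβ hαβ), fun h => ?_⟩
    have h1 := bary_combination he hy hx'e hα hβ hαβ x
    rw [mem_singleton_iff.1 h, hpb x hx, bary_vertex (hv x' hx'), if_neg hxx'] at h1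
    have h2 := bary_nonneg (K := M) y x
    nlinarith
  have hconst : ∀ y ∈ convexHull ℝ (e : Set E), y ≠ p → side y = side u := by
    intro y hy hyp
    have h1 := sum_bary he hy
    have h1' : bary M y u + bary M y w = 1 := by rw [← h1, hew, Finset.sum_pair huw]
    rcases lt_trichotomy (bary M y u) (1 / 2) with h | h | h
    · rw [hhalf u hue w hwe huw y hy h, hsides]
    · refine (hyp (eq_barycenter he hy (m := 1 / 2) fun x hx => ?_)).elim
      rw [hew, Finset.mem_insert, Finset.mem_singleton] at hx
      rcases hx with rfl | rfl <;> linarith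
    · exact hhalf w hwe u hue huw.symm y hy (by linarith)
  have hnear : ∀ᶠ y in 𝓝[M.space] p, ∀ x ∈ e, 0 < bary M y x := by
    rw [Filter.eventually_all_finset]
    intro x hx
    refine (continuousOn_bary hfin x p (barycenter_mem_space he)).eventually (lt_mem_nhds ?_)
    change 0 < bary M p x
    rw [hpb x hx]
    norm_num
  have htend : Tendsto ψ (𝓝 (φ p)) (𝓝[M.space] p) := by
    refine tendsto_nhdsWithin_iff.2 ⟨?_, Eventually.of_forall fun w => (hch.mem _).1⟩
    nth_rw 2 [← hch.left_inv p hpS]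
    exact hch.continuous_symm.tendsto _
  obtain ⟨δ, hδ, hball⟩ := Metric.nhds_basis_closedBall.mem_iff.1 (htend.eventually hnear)
  have hmem : ∀ r ∈ Metric.closedBall (φ p) δ, r ≠ φ p → side (ψ r) = side u := by
    intro r hr hrp
    have hpos : ∀ x ∈ e, 0 < bary M (ψ r) x := hball hr
    obtain ⟨s, hs, hys, hsb⟩ := exists_carrier (hch.mem r).1
    have hes : e = s := Finset.eq_of_subset_of_card_le (fun x hx => (hsb x).2 (hpos x hx))
      (by have := hle s hs; omega)
    exact hconst _ (by rw [hes]; exact hys) fun h => hrp (by rw [← h, hch.right_inv])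
  -- Near `p` the space consists of points of `e`, all on one side apart from `p`; but the chart
  -- reaches both sides.
  have h1 := hmem (φ p + δ) (by simp [abs_of_pos hδ]) (by linarith)
  have h2 := hmem (φ p - δ) (by simp [abs_of_pos hδ]) (by linarith)
  rw [← h2] at h1
  simp only [side, hch.right_inv] at h1
  rw [if_pos (by linarith), if_neg (by linarith)] at h1
  exact one_ne_zero h1

/-- The circle without the midpoint of `e` is connected, so a chain avoiding `e` joins the ends of
`e`; adding `e` closes it up to the fundamental cycle. -/
theorem exists_hasFundamentalCycle_one (hfin : M.faces.Finite) (hne : M.space.Nonempty)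
    (hM : IsPuncturedSpace ℝ M.space) : ∃ z, HasFundamentalCycle M 1 z := by
  classical
  have hle : ∀ s ∈ M.faces, s.card ≤ 2 := fun s hs =>
    card_le_of_forall_ne (fun _ => card_ne_three hM) hs
  have hedge : ∀ s ∈ M.faces, ∃ t ∈ M.faces, t.card = 2 ∧ s ⊆ t := by
    intro s hs
    have hpos := (M.nonempty_of_mem_faces hs).card_pos
    have h3 := hle s hs
    interval_cases hk : s.card
    · obtain ⟨u, rfl⟩ := Finset.card_eq_one.1 hk
      obtain ⟨e, he, hek, hue⟩ := exists_edge_of_vertex hfin hM hs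
      exact ⟨e, he, hek, by simpa using hue⟩
    · exact ⟨s, hs, hk, subset_rfl⟩
  obtain ⟨y, hy⟩ := hne
  obtain ⟨s₀, hs₀, -⟩ := SimplicialComplex.mem_space_iff.1 hy
  obtain ⟨e, he, hek, -⟩ := hedge s₀ hs₀
  obtain ⟨u, w, huw, hew⟩ := Finset.card_eq_two.1 hek
  have hdel : ∀ x ∈ e, {x} ∈ (deleteStar M e).faces := fun x hx =>
    ⟨M.down_closed he (by simpa using hx) (by simp), fun h => by
      have := Finset.card_le_card h
      rw [hek, Finset.card_singleton] at this
      omega⟩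
  obtain ⟨c, hc, hcu⟩ := add_mem_boundaries_deleteStar hfin he
    (hM.isPreconnected_diff_singleton (barycenter_mem_space he)) (hdel u (by simp [hew]))
    (hdel w (by simp [hew]))
  have hce : c e = 0 := by
    by_contra h
    exact (mem_chains.1 hc e h).1.2 subset_rfl
  refine ⟨simplexChain e + c, hasFundamentalCycle_of_forall hfin hle
    (fun u w hu hw => add_mem_boundaries hfin hM.isPreconnected hu hw) hedge
    ⟨Submodule.add_mem _ (simplexChain_mem_chains he hek)
      (chains_mono (deleteStar_faces_subset M e) 1 hc), ?_⟩ he hek (by simp [hce]) ?_⟩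
  · rw [SetLike.mem_coe, LinearMap.mem_ker, map_add, hcu, hew, boundaryMap_edge huw, chain_add_self]
  · intro z hz s hs s' hs' hk hk'
    have h1 := cycle_apply_ne_zero_of_edge hfin hM hle hs hs' hk hk' hz
    have h2 := cycle_apply_ne_zero_of_edge hfin hM hle hs' hs hk' hk hz
    rcases zmod_two_cases (z s) with h | h <;> rcases zmod_two_cases (z s') with h' | h' <;>
      simp_all

end Circle

end PHT

namespace PHT

open Geometry

/-! ### Dimensions -/

section LinearAlgebra

variable {F V W : Type*} [Field F] [AddCommGroup V] [Module F V] [AddCommGroup W] [Module F W]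

/-- The dimension of a subspace. -/
noncomputable def subDim (S : Submodule F V) : ℕ :=
  Module.finrank F S

theorem quotientDim_eq_zero {N D : Submodule F V} (h : N ≤ D) : quotientDim N D = 0 := by
  have h1 : D.submoduleOf N = ⊤ := by
    rw [Submodule.submoduleOf, Submodule.comap_subtype_eq_top]
    exact h
  rw [quotientDim, h1]
  exact Module.finrank_zero_of_subsingleton

theorem quotientDim_add_finrank {N D : Submodule F V} [FiniteDimensional F N] (h : D ≤ N) :
    quotientDim N D + Module.finrank F D = Module.finrank F N := by
  rw [quotientDim, ← (Submodule.submoduleOfEquivOfLe h).finrank_eq]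
  exact Submodule.finrank_quotient_add_finrank _

theorem quotientDim_pos {N D : Submodule F V} [FiniteDimensional F N] {x : V} (hx : x ∈ N)
    (hxD : x ∉ D) : 0 < quotientDim N D := by
  have h1 : D.submoduleOf N ≠ ⊤ := by
    rw [Submodule.submoduleOf, Ne, Submodule.comap_subtype_eq_top]
    exact fun h => hxD (h hx)
  have := Submodule.Quotient.nontrivial_iff.2 h1
  exact Module.finrank_pos

theorem subDim_map_add_subDim_inf_ker (f : V →ₗ[F] W) (U : Submodule F V)
    [FiniteDimensional F U] : subDim (U.map f) + subDim (U ⊓ LinearMap.ker f) = subDim U := by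
  unfold subDim
  rw [← LinearMap.finrank_range_add_finrank_ker (f.domRestrict U), LinearMap.range_domRestrict,
    LinearMap.ker_domRestrict, ← (Submodule.comapSubtypeEquivOfLe (inf_le_left :
      U ⊓ LinearMap.ker f ≤ U)).finrank_eq, Submodule.comap_inf, Submodule.comap_subtype_self,
    top_inf_eq]

/-- The left and the right rank of a pairing of two finite-dimensional spaces are equal. -/
theorem subDim_add_subDim_orthogonal (B : V →ₗ[F] W →ₗ[F] F) (S : Submodule F V)
    (T : Submodule F W) [FiniteDimensional F S] [FiniteDimensional F T] {S' : Submodule F V}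
    {T' : Submodule F W} (hS' : ∀ x, x ∈ S' ↔ x ∈ S ∧ ∀ y ∈ T, B x y = 0)
    (hT' : ∀ y, y ∈ T' ↔ y ∈ T ∧ ∀ x ∈ S, B x y = 0) :
    subDim S + subDim T' = subDim T + subDim S' := by
  unfold subDim
  let f : S →ₗ[F] Module.Dual F T := (B.domRestrict₁₂ S T)
  have hf : ∀ x y, f x y = B x y := fun _ _ => rfl
  have h1 := LinearMap.finrank_range_add_finrank_ker f
  have h2 := LinearMap.finrank_range_add_finrank_ker f.flip
  have hr : Module.finrank F (LinearMap.range f.flip) = Module.finrank F (LinearMap.range f) := by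
    rw [← LinearMap.finrank_range_dualMap_eq_finrank_range f]
    have h3 : f.flip = f.dualMap.comp (Module.Dual.eval F T) := by
      ext y x
      rfl
    rw [h3, LinearMap.range_comp_of_range_eq_top]
    exact LinearMap.range_eq_top.2 (Module.evalEquiv F T).surjective
  have hk1 : Module.finrank F (LinearMap.ker f) = Module.finrank F S' := by
    have hle : S' ≤ S := fun x hx => ((hS' x).1 hx).1
    rw [← (Submodule.comapSubtypeEquivOfLe hle).finrank_eq]
    have he : LinearMap.ker f = S'.comap S.subtype := ?_
    · rw [he]
    ext x
    rw [LinearMap.mem_ker, Submodule.mem_comap, Submodule.coe_subtype, hS']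
    exact ⟨fun h => ⟨x.2, fun y hy => by rw [← hf x ⟨y, hy⟩, h]; rfl⟩,
      fun h => LinearMap.ext fun y => h.2 y y.2⟩
  have hk2 : Module.finrank F (LinearMap.ker f.flip) = Module.finrank F T' := by
    have hle : T' ≤ T := fun x hx => ((hT' x).1 hx).1
    rw [← (Submodule.comapSubtypeEquivOfLe hle).finrank_eq]
    have he : LinearMap.ker f.flip = T'.comap T.subtype := ?_
    · rw [he]
    ext y
    rw [LinearMap.mem_ker, Submodule.mem_comap, Submodule.coe_subtype, hT']
    exact ⟨fun h => ⟨y.2, fun x hx => by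
      rw [← hf ⟨x, hx⟩ y, ← LinearMap.flip_apply, h]; rfl⟩,
      fun h => LinearMap.ext fun x => h.2 x x.2⟩
  omega

/-- The dimension of the quotient by which a point of a persistence diagram is weighted, as a
second difference. -/
theorem quotientDim_second_difference {Z Z' B B' : Submodule F V} (hZ : Z' ≤ Z) (hB : B' ≤ B)
    [FiniteDimensional F Z] :
    quotientDim (Z ⊓ B) ((Z' ⊓ B) ⊔ (Z ⊓ B')) + subDim (Z' ⊓ B) + subDim (Z ⊓ B') =
      subDim (Z ⊓ B) + subDim (Z' ⊓ B') := by
  unfold subDim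
  have : FiniteDimensional F Z' := Submodule.finiteDimensional_of_le hZ
  have h1 := quotientDim_add_finrank (N := Z ⊓ B) (D := (Z' ⊓ B) ⊔ (Z ⊓ B'))
    (sup_le (inf_le_inf_right _ hZ) (inf_le_inf_left _ hB))
  have h2 := Submodule.finrank_sup_add_finrank_inf_eq (Z' ⊓ B) (Z ⊓ B')
  have h3 : (Z' ⊓ B) ⊓ (Z ⊓ B') = Z' ⊓ B' := by
    rw [inf_inf_inf_comm, inf_eq_left.2 hZ, inf_eq_right.2 hB]
  rw [h3] at h2
  omega

end LinearAlgebra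

/-! ### The essential part of the persistence diagrams -/

section Persistence

variable {E : Type*} [NormedAddCommGroup E] [InnerProductSpace ℝ E]
variable {M : SimplicialComplex ℝ E}

theorem finiteDimensional_chains (hfin : M.faces.Finite) (k : ℕ) :
    FiniteDimensional (ZMod 2) (chains M k) := by
  rw [chains, Finsupp.supported_eq_span_single]
  exact FiniteDimensional.span_of_finite _ ((hfin.subset fun _ h => h.1).image _)

theorem fullSubcomplex_faces_subset (P : E → Prop) : (fullSubcomplex M P).faces ⊆ M.faces :=
  fun _ h => h.1

theorem finiteDimensional_cycles (hfin : M.faces.Finite) (k : ℕ) :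
    FiniteDimensional (ZMod 2) (cycles M k) :=
  have := finiteDimensional_chains hfin k
  Submodule.finiteDimensional_of_le inf_le_left

theorem chains_eq_bot {k : ℕ} (h : ∀ s ∈ M.faces, s.card ≠ k + 1) : chains M k = ⊥ :=
  le_bot_iff.1 (chains_le fun s hs hk => (h s hs hk).elim)

theorem cycles_eq_bot {k : ℕ} (h : ∀ s ∈ M.faces, s.card ≠ k + 1) : cycles M k = ⊥ := by
  rw [cycles, chains_eq_bot h, bot_inf_eq]

theorem boundaries_eq_bot {k : ℕ} (h : ∀ s ∈ M.faces, s.card ≠ k + 2) : boundaries M k = ⊥ := by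
  rw [boundaries, chains_eq_bot h, Submodule.map_bot]

theorem fullSubcomplex_eq_self {P : E → Prop} (h : ∀ u, {u} ∈ M.faces → P u) :
    fullSubcomplex M P = M := by
  have : (fullSubcomplex M P).faces = M.faces := Set.Subset.antisymm (fullSubcomplex_faces_subset P)
    fun s hs => ⟨hs, fun x hx => h x (M.down_closed hs (by simpa using hx) (by simp))⟩
  exact SimplicialComplex.ext this

theorem strictSublevel_top (v : E) : strictSublevel M v ⊤ = M :=
  fullSubcomplex_eq_self fun _ _ => EReal.coe_lt_top _

theorem height_neg (v x : E) : height (-v) x = -height v x := by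
  simp [height]

theorem persistenceDiagram_apply_eq_zero {k : ℕ} {v : E} {p : OffDiagonal}
    (h : dyingCycles M v k p.1.1 p.1.2 ≤ earlierCycles M v k p.1.1 p.1.2) :
    persistenceDiagram k M v p = 0 :=
  quotientDim_eq_zero h

theorem persistenceDiagram_eq_zero_of_cycles {k : ℕ} {v : E} {p : OffDiagonal}
    (h : cycles (sublevel M v p.1.1) k = ⊥) : persistenceDiagram k M v p = 0 :=
  persistenceDiagram_apply_eq_zero (by rw [dyingCycles, h, bot_inf_eq]; exact bot_le)

theorem sublevel_bot_cycles (k : ℕ) (v : E) : cycles (sublevel M v ⊥) k = ⊥ :=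
  cycles_eq_bot fun s hs _ => by
    obtain ⟨x, hx⟩ := M.nonempty_of_mem_faces hs.1
    exact absurd (hs.2 x hx) (not_le.2 (EReal.bot_lt_coe _))

theorem HasFundamentalCycle.exists_isMax {k : ℕ} {z : FormalChain E}
    (hM : HasFundamentalCycle M k z) (v : E) :
    ∃ u, {u} ∈ M.faces ∧ ∀ w, {w} ∈ M.faces → height v w ≤ height v u := by
  have hfin : {u | {u} ∈ M.faces}.Finite := hM.finite.preimage Finset.singleton_injective.injOn
  obtain ⟨s, hs⟩ := hM.nonempty
  obtain ⟨x, hx⟩ := M.nonempty_of_mem_faces hs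
  obtain ⟨u, hu, hmax⟩ := hfin.exists_maximalFor (height v) _
    ⟨x, M.down_closed hs (by simpa using hx) (by simp)⟩
  exact ⟨u, hu, fun w hw => (le_total (height v u) (height v w)).elim (hmax hw) id⟩

/-- In a connected complex, the essential class of dimension zero is born at the lowest vertex. -/
theorem essentialBirth_eq (hfin : M.faces.Finite) (hconn : ∀ u w, {u} ∈ M.faces → {w} ∈ M.faces →
      simplexChain {u} + simplexChain {w} ∈ boundaries M 0) {v u : E} (hu : {u} ∈ M.faces)
    (hmin : ∀ w, {w} ∈ M.faces → height v u ≤ height v w) :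
    (persistenceDiagram 0 M v).essentialBirth = height v u := by
  have key : ∀ x (hx : x < ⊤), 0 < persistenceDiagram 0 M v ⟨(x, ⊤), hx⟩ ↔ x = height v u := by
    intro x hx
    have hmem : ∀ P : E → Prop, P u → simplexChain {u} ∈ cycles (fullSubcomplex M P) 0 := fun P hP => by
      rw [cycles_zero]
      exact simplexChain_mem_chains ⟨hu, by simpa using hP⟩ (by simp)
    constructor
    · intro hpos
      rcases lt_trichotomy x (height v u) with h | h | h
      · refine absurd (persistenceDiagram_eq_zero_of_cycles (cycles_eq_bot fun s hs _ => ?_)) hpos.ne'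
        obtain ⟨y, hy⟩ := M.nonempty_of_mem_faces hs.1
        exact absurd (hs.2 y hy) (not_le.2 (h.trans_le
          (hmin y (M.down_closed hs.1 (by simpa using hy) (by simp)))))
      · exact h
      · refine absurd (persistenceDiagram_apply_eq_zero ?_) hpos.ne'
        refine inf_le_left.trans ?_
        rw [cycles_zero]
        refine chains_le fun s hs hk => ?_
        obtain ⟨w, rfl⟩ := Finset.card_eq_one.1 hk
        -- Above the lowest vertex nothing new survives: `u` was present earlier, and the difference
        -- of `w` and `u` bounds in `M`, so it is dead before `∞`.
        have hw : simplexChain {w} = simplexChain {u} + (simplexChain {w} + simplexChain {u}) := by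
          rw [add_left_comm, chain_add_self, add_zero]
        rw [hw]
        refine Submodule.add_mem_sup ⟨hmem _ h, by simp [deadAt]⟩ ⟨Submodule.add_mem _ ?_
          (hmem _ h.le), ?_⟩
        · rw [cycles_zero]
          exact simplexChain_mem_chains hs hk
        · simp only [strictSublevel_top]
          exact hconn w u hs.1 hu
    · rintro rfl
      have : FiniteDimensional (ZMod 2) (cycles (sublevel M v (height v u)) 0) :=
        finiteDimensional_cycles (hfin.subset (fullSubcomplex_faces_subset _)) 0
      have hfd : FiniteDimensional (ZMod 2) (dyingCycles M v 0 (height v u) ⊤) :=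
        Submodule.finiteDimensional_of_le (S₂ := cycles (sublevel M v (height v u)) 0) inf_le_left
      refine quotientDim_pos (x := simplexChain {u}) ⟨hmem _ le_rfl, by simp [deadAt]⟩ fun hD => ?_
      -- The augmentation kills all boundaries and no vertex lies strictly below `u`, but the
      -- augmentation of `u` is one.
      have hle : earlierCycles M v 0 (height v u) ⊤ ≤ LinearMap.ker (vertexFunctional fun _ : E => 1) := by
        refine sup_le ?_ ?_
        · have : cycles (strictSublevel M v (height v u)) 0 = ⊥ := cycles_eq_bot fun s hs _ => by
            obtain ⟨y, hy⟩ := M.nonempty_of_mem_faces hs.1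
            exact absurd (hs.2 y hy) (not_lt.2
              (hmin y (M.down_closed hs.1 (by simpa using hy) (by simp))))
          rw [this, bot_inf_eq]
          exact bot_le
        · refine inf_le_right.trans ?_
          rintro _ ⟨c, hc, rfl⟩
          classical
          refine eqOn_chains (f := (vertexFunctional fun _ : E => 1).comp (boundaryMap E)) (g := 0)
            (fun s _ hk => ?_) hc
          obtain ⟨a, b, hab, rfl⟩ := Finset.card_eq_two.1 hk
          rw [LinearMap.comp_apply, boundaryMap_edge hab, map_add, vertexFunctional_simplexChain,
            vertexFunctional_simplexChain, Finset.sum_singleton, Finset.sum_singleton]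
          rfl
      have := hle hD
      rw [LinearMap.mem_ker, vertexFunctional_simplexChain, Finset.sum_singleton] at this
      exact one_ne_zero this
  have hset : {x | ∃ hx : x < ⊤, 0 < persistenceDiagram 0 M v ⟨(x, ⊤), hx⟩} = {height v u} := by
    ext x
    constructor
    · rintro ⟨hx, h⟩
      exact (key x hx).1 h
    · rintro rfl
      exact ⟨EReal.coe_lt_top _, (key _ _).2 rfl⟩
  rw [PersistenceDiagram.essentialBirth, hset, sInf_singleton]

/-- In the dimension of the fundamental cycle there is a single point, which belongs to the
highest vertex. -/
theorem HasFundamentalCycle.persistenceDiagram_eq {k : ℕ} {z : FormalChain E}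
    (hM : HasFundamentalCycle M k z) (v : E) :
    persistenceDiagram k M v = (persistenceDiagram 0 M (-v)).oppositeEssential := by
  obtain ⟨u, hu, hmax⟩ := hM.exists_isMax v
  have hbirth : -(persistenceDiagram 0 M (-v)).essentialBirth = height v u := by
    rw [essentialBirth_eq hM.finite hM.connected hu fun w hw => by
      rw [height_neg, height_neg, EReal.neg_le_neg_iff]
      exact hmax w hw, height_neg, neg_neg]
  have hz0 : z ≠ 0 := by
    rintro rfl
    obtain ⟨t, ht, htk, -⟩ := hM.exists_facet _ hu
    simpa using hM.fundamental_apply t ht htk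
  -- The only nonzero cycle contains every facet, in particular one at `u`, so no cycle exists
  -- before `u` enters.
  have hbot : ∀ P : E → Prop, ¬P u → cycles (fullSubcomplex M P) k = ⊥ := by
    intro P hP
    refine le_bot_iff.1 fun c hc => ?_
    rcases hM.cycles_eq c (cycles_mono (fullSubcomplex_faces_subset P) k hc) with rfl | rfl
    · exact Submodule.zero_mem _
    · obtain ⟨t, ht, htk, hut⟩ := hM.exists_facet _ hu
      have h1 := mem_chains.1 hc.1 t (by rw [hM.fundamental_apply t ht htk]; exact one_ne_zero)
      exact (hP (h1.1.2 u (by simpa using hut))).elim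
  have hnb : ∀ P : E → Prop, boundaries (fullSubcomplex M P) k = ⊥ := fun P =>
    boundaries_eq_bot fun s hs => by have := hM.card_le s hs.1; omega
  funext p
  obtain ⟨⟨a, b⟩, hab⟩ := p
  simp only [PersistenceDiagram.oppositeEssential, hbirth, Prod.mk.injEq]
  by_cases hb : b = ⊤
  · subst hb
    have hdying : dyingCycles M v k a ⊤ = cycles (sublevel M v a) k := by
      simp [dyingCycles, deadAt]
    have hearlier : earlierCycles M v k a ⊤ = cycles (strictSublevel M v a) k := by
      rw [earlierCycles, strictSublevel, strictSublevel, hnb]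
      simp [deadAt]
    rcases lt_trichotomy a (height v u) with h | h | h
    · rw [if_neg fun h' => h.ne h'.1]
      exact persistenceDiagram_eq_zero_of_cycles (hbot _ h.not_ge)
    · subst h
      rw [if_pos ⟨rfl, rfl⟩]
      change quotientDim (dyingCycles M v k _ _) (earlierCycles M v k _ _) = 1
      have hspan : cycles M k = Submodule.span (ZMod 2) {z} := by
        refine le_antisymm (fun c hc => ?_) ?_
        · rcases hM.cycles_eq c hc with rfl | rfl
          · exact Submodule.zero_mem _
          · exact Submodule.mem_span_singleton_self c
        · rw [Submodule.span_singleton_le_iff_mem]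
          exact hM.fundamental_mem
      have hall : sublevel M v (height v u) = M := fullSubcomplex_eq_self hmax
      have := finiteDimensional_cycles hM.finite k
      have h1 := quotientDim_add_finrank (N := cycles M k) (D := ⊥) bot_le
      rw [finrank_bot, add_zero] at h1
      rw [hdying, hearlier, hall, strictSublevel,
        hbot (fun x => height v x < height v u) (lt_irrefl _), h1, hspan,
        finrank_span_singleton hz0]
    · rw [if_neg fun h' => h.ne' h'.1]
      refine persistenceDiagram_apply_eq_zero ?_
      simp only
      have h1 : sublevel M v a = M := fullSubcomplex_eq_self fun w hw => (hmax w hw).trans h.le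
      have h2 : strictSublevel M v a = M :=
        fullSubcomplex_eq_self fun w hw => (hmax w hw).trans_lt h
      rw [hdying, hearlier, h1, h2]
  · rw [if_neg fun h' => hb h'.2]
    refine persistenceDiagram_apply_eq_zero ?_
    simp only [dyingCycles, deadAt, if_neg hb, sublevel, hnb, inf_bot_eq]
    exact bot_le

theorem persistenceDiagram_eq_empty {k : ℕ} (h : ∀ s ∈ M.faces, s.card ≠ k + 1) (v : E) :
    persistenceDiagram k M v = PersistenceDiagram.empty :=
  funext fun _ => persistenceDiagram_eq_zero_of_cycles (cycles_eq_bot fun s hs => h s hs.1)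

end Persistence

/-! ### Duality on the sphere -/

section Duality

variable {E : Type*} [NormedAddCommGroup E] [InnerProductSpace ℝ E]
variable {M : SimplicialComplex ℝ E} {z : FormalChain E} {P Q : E → Prop}

/-- The `2`-chains of `M` whose boundary lies in the full subcomplex on the vertices that
satisfy `P`. -/
noncomputable def relativeCycles (M : SimplicialComplex ℝ E) (P : E → Prop) :
    Submodule (ZMod 2) (FormalChain E) :=
  chains M 2 ⊓ (chains (fullSubcomplex M P) 1).comap (boundaryMap E)

theorem IsHomologySphere.apply_eq_of_mem_relativeCycles (hM : IsHomologySphere M z)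
    {c : FormalChain E} (hc : c ∈ relativeCycles M P) {u : E} (hu : ¬P u) {s t : Finset E}
    (hs : s ∈ M.faces) (ht : t ∈ M.faces) (hsk : s.card = 3) (htk : t.card = 3) (hus : u ∈ s)
    (hut : u ∈ t) : c s = c t := by
  refine hM.star c hc.1 u (M.down_closed hs (by simpa using hus) (by simp)) (fun e _ _ hue => ?_)
    s hs t ht hsk htk hus hut
  by_contra h
  exact hu ((mem_chains.1 hc.2 e h).1.2 u hue)

open scoped Classical in
/-- Every locally constant function on the vertices outside `P` comes from a relative cycle. -/
theorem IsHomologySphere.exists_relativeCycle (hM : IsHomologySphere M z)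
    {F : E → ZMod 2} (hF : ∀ u w, u ≠ w → {u, w} ∈ (fullSubcomplex M fun x => ¬P x).faces →
      F u = F w) : ∃ c ∈ relativeCycles M P, ∀ s ∈ M.faces, s.card = 3 → ∀ u ∈ s, ¬P u →
        c s = F u := by
  classical
  let val : Finset E → ZMod 2 := fun s =>
    if h : (s ∈ M.faces ∧ s.card = 3) ∧ ∃ u ∈ s, ¬P u then F h.2.choose else 0
  have hval0 : ∀ s, val s ≠ 0 → s ∈ M.faces ∧ s.card = 3 := fun s hs => by
    by_contra h
    exact hs (dif_neg fun h' => h h'.1)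
  let c : FormalChain E := Finsupp.onFinset hM.finite.toFinset val fun s hs =>
    hM.finite.mem_toFinset.2 (hval0 s hs).1
  have hcs : ∀ s, c s = val s := fun _ => rfl
  have hcF : ∀ s ∈ M.faces, s.card = 3 → ∀ u ∈ s, ¬P u → c s = F u := by
    intro s hs hk u hu hPu
    have h : (s ∈ M.faces ∧ s.card = 3) ∧ ∃ u ∈ s, ¬P u := ⟨⟨hs, hk⟩, u, hu, hPu⟩
    rw [hcs]
    simp only [val]
    rw [dif_pos h]
    obtain ⟨hw, hPw⟩ := h.2.choose_spec
    by_cases hne : h.2.choose = u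
    · rw [hne]
    · exact hF _ _ hne ⟨M.down_closed hs (by
        rw [Finset.insert_subset_iff, Finset.singleton_subset_iff]
        exact ⟨hw, hu⟩) (by simp), by
        intro x hx
        rw [Finset.mem_insert, Finset.mem_singleton] at hx
        rcases hx with rfl | rfl
        exacts [hPw, hPu]⟩
  have hc2 : c ∈ chains M 2 := mem_chains.2 fun s hs => hval0 s hs
  refine ⟨c, ⟨hc2, mem_chains.2 fun e he => ?_⟩, hcF⟩
  have heM := mem_chains.1 (boundaryMap_mem_chains hc2) e he
  refine ⟨⟨heM.1, fun u hu => ?_⟩, heM.2⟩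
  by_contra hPu
  -- Around `u` the chain `c` is the multiple `F u` of the fundamental cycle. Subtracting that
  -- multiple clears all triangles at `u` without changing the boundary, which therefore has no edge
  -- at `u`.
  have hc' : c + F u • z ∈ chains (deleteStar M {u}) 2 := by
    refine mem_chains.2 fun s hs => ?_
    have hsM := mem_chains.1 (Submodule.add_mem _ hc2
      (Submodule.smul_mem _ (F u) hM.fundamental_mem.1)) s hs
    refine ⟨⟨hsM.1, fun hus => hs ?_⟩, hsM.2⟩
    rw [Finsupp.add_apply, Finsupp.smul_apply, hM.fundamental_apply s hsM.1 hsM.2,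
      hcF s hsM.1 hsM.2 u (by simpa using hus) hPu, smul_eq_mul, mul_one, zmod_two_add_cancel]
  have h1 := boundaryMap_mem_chains hc'
  rw [map_add, map_smul, LinearMap.mem_ker.1 hM.fundamental_mem.2, smul_zero, add_zero] at h1
  exact (mem_chains.1 h1 e he).1.2 (by simpa using hu)

/-- The rank of the restriction of relative cycles to the vertices outside `Q` is the rank of the
inclusion of those vertices into the components outside `P`. -/
theorem IsHomologySphere.subDim_relativeCycles (hM : IsHomologySphere M z)
    (hPQ : ∀ x, P x → Q x) :
    subDim (chains (fullSubcomplex M fun x => ¬Q x) 0) +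
        subDim (relativeCycles M P ⊓ chains (fullSubcomplex M Q) 2) =
      subDim (relativeCycles M P) + subDim (chains (fullSubcomplex M fun x => ¬Q x) 0 ⊓
        boundaries (fullSubcomplex M fun x => ¬P x) 0) := by
  classical
  have htri : ∀ u, ∃ t, {u} ∈ M.faces → t ∈ M.faces ∧ t.card = 3 ∧ u ∈ t := by
    intro u
    by_cases hu : {u} ∈ M.faces
    · obtain ⟨t, ht, htk, hut⟩ := hM.exists_facet _ hu
      exact ⟨t, fun _ => ⟨ht, htk, by simpa using hut⟩⟩
    · exact ⟨∅, fun h => (hu h).elim⟩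
  choose t ht using htri
  -- The pairing evaluates a relative cycle at a chosen triangle `t u` at each vertex; for vertices
  -- outside `P` the choice is immaterial. Its left null space consists of the zero-chains that
  -- bound outside `P`, its right null space of the relative cycles supported in `Q`.
  let B : FormalChain E →ₗ[ZMod 2] FormalChain E →ₗ[ZMod 2] ZMod 2 :=
    Finsupp.linearCombination (ZMod 2) fun s => ∑ u ∈ s, Finsupp.lapply (t u)
  have hB : ∀ a c, B a c = vertexFunctional (fun u => c (t u)) a := by
    intro a c
    suffices h : B.flip c = vertexFunctional (fun u => c (t u)) from LinearMap.congr_fun h a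
    refine Finsupp.lhom_ext' fun s => LinearMap.ext_ring ?_
    simp [B, vertexFunctional]
  have hfin2 := finiteDimensional_chains hM.finite 2
  have hfd1 : FiniteDimensional (ZMod 2) (relativeCycles M P) :=
    Submodule.finiteDimensional_of_le (S₂ := chains M 2) inf_le_left
  have hfd2 : FiniteDimensional (ZMod 2) (chains (fullSubcomplex M fun x => ¬Q x) 0) :=
    finiteDimensional_chains (hM.finite.subset (fullSubcomplex_faces_subset _)) 0
  have hBv : ∀ u c, B (simplexChain {u}) c = c (t u) := fun u c => by
    rw [hB, vertexFunctional_simplexChain, Finset.sum_singleton]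
  refine (subDim_add_subDim_orthogonal B _ _ (fun a => ⟨fun h => ⟨h.1, fun c hc => ?_⟩,
    fun h => ⟨h.1, ?_⟩⟩) fun c => ⟨fun h => ⟨h.1, fun a ha => ?_⟩, fun h => ⟨h.1, ?_⟩⟩)
  · obtain ⟨b, hb, rfl⟩ := h.2
    refine eqOn_chains (f := (B.flip c).comp (boundaryMap E)) (g := 0) (fun s hs hk => ?_) hb
    obtain ⟨u, w, huw, rfl⟩ := Finset.card_eq_two.1 hk
    obtain ⟨r, hr, hrk, hsub⟩ := hM.exists_facet _ hs.1
    have hvert : ∀ x ∈ ({u, w} : Finset E), c (t x) = c r := fun x hx => by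
      obtain ⟨h1, h2, h3⟩ := ht x (M.down_closed hs.1 (by simpa using hx) (by simp))
      exact hM.apply_eq_of_mem_relativeCycles hc (hs.2 x hx) h1 hr h2 hrk h3 (hsub hx)
    rw [LinearMap.comp_apply, boundaryMap_edge huw, map_add, LinearMap.flip_apply,
      LinearMap.flip_apply, hBv, hBv, hvert u (by simp), hvert w (by simp), zmod_two_add_cancel,
      LinearMap.zero_apply]
  · by_contra hn
    obtain ⟨Γ, hΓ, hker⟩ := Submodule.exists_le_ker_of_notMem hn
    -- A functional that kills boundaries outside `P` is a locally constant function on the vertices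
    -- there, so it is evaluation of the pairing at some relative cycle.
    obtain ⟨c, hc, hcF⟩ := hM.exists_relativeCycle (P := P) (F := fun u => Γ (simplexChain {u}))
      fun u w huw hface => by
        have h1 := hker (Submodule.mem_map_of_mem (simplexChain_mem_chains hface
          (Finset.card_pair huw)))
        rw [boundaryMap_edge huw, LinearMap.mem_ker, map_add] at h1
        exact CharTwo.add_eq_zero.1 h1
    refine hΓ ?_
    rw [← h.2 c hc]
    refine eqOn_chains (f := Γ) (g := B.flip c) (fun s hs hk => ?_) h.1
    obtain ⟨u, rfl⟩ := Finset.card_eq_one.1 hk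
    obtain ⟨h1, h2, h3⟩ := ht u hs.1
    rw [LinearMap.flip_apply, hBv, hcF _ h1 h2 u h3 fun hPu => hs.2 u (by simp) (hPQ u hPu)]
  · refine eqOn_chains (f := B.flip c) (g := 0) (fun s hs hk => ?_) ha
    obtain ⟨u, rfl⟩ := Finset.card_eq_one.1 hk
    obtain ⟨h1, h2, h3⟩ := ht u hs.1
    rw [LinearMap.flip_apply, hBv, LinearMap.zero_apply]
    by_contra hne
    exact hs.2 u (by simp) ((mem_chains.1 h.2 _ hne).1.2 u h3)
  · refine mem_chains.2 fun s hs => ?_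
    have hsM := mem_chains.1 h.1.1 s hs
    refine ⟨⟨hsM.1, fun u hu => ?_⟩, hsM.2⟩
    by_contra hQ
    have huM : {u} ∈ M.faces := M.down_closed hsM.1 (by simpa using hu) (by simp)
    obtain ⟨h1, h2, h3⟩ := ht u huM
    have h4 := h.2 (simplexChain {u}) (simplexChain_mem_chains ⟨huM, by simpa using hQ⟩ (by simp))
    rw [hBv, hM.apply_eq_of_mem_relativeCycles h.1 (fun hPu => hQ (hPQ u hPu)) h1 hsM.1 h2 hsM.2
      h3 hu] at h4
    exact hs h4

/-- The relation between the one-cycles of `P` that bound in `Q` and the zero-cycles outside `Q`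
that bound outside `P`. -/
theorem IsHomologySphere.subDim_duality (hM : IsHomologySphere M z) (hPQ : ∀ x, P x → Q x) :
    subDim (chains (fullSubcomplex M fun x => ¬Q x) 0) +
        (subDim (cycles (fullSubcomplex M P) 1 ⊓ boundaries (fullSubcomplex M Q) 1) +
          subDim (cycles (fullSubcomplex M Q) 2)) =
      subDim (relativeCycles M P) + subDim (cycles (fullSubcomplex M fun x => ¬Q x) 0 ⊓
        boundaries (fullSubcomplex M fun x => ¬P x) 0) := by
  rw [cycles_zero, ← hM.subDim_relativeCycles hPQ]
  have hfin2 := finiteDimensional_chains hM.finite 2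
  have hfd : FiniteDimensional (ZMod 2) (relativeCycles M P ⊓ chains (fullSubcomplex M Q) 2 :
      Submodule (ZMod 2) (FormalChain E)) :=
    Submodule.finiteDimensional_of_le (S₂ := chains M 2) (inf_le_left.trans inf_le_left)
  have h1 : (relativeCycles M P ⊓ chains (fullSubcomplex M Q) 2).map (boundaryMap E) =
      cycles (fullSubcomplex M P) 1 ⊓ boundaries (fullSubcomplex M Q) 1 := by
    ext a
    constructor
    · rintro ⟨b, ⟨hb, hbQ⟩, rfl⟩
      exact ⟨⟨hb.2, boundaryMap_boundaryMap b⟩, b, hbQ, rfl⟩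
    · rintro ⟨⟨ha, -⟩, b, hb, rfl⟩
      exact ⟨b, ⟨⟨chains_mono (fullSubcomplex_faces_subset Q) 2 hb, ha⟩, hb⟩, rfl⟩
  have h2 : relativeCycles M P ⊓ chains (fullSubcomplex M Q) 2 ⊓ LinearMap.ker (boundaryMap E) =
      cycles (fullSubcomplex M Q) 2 := by
    ext a
    constructor
    · rintro ⟨ha, hk⟩
      exact ⟨ha.2, hk⟩
    · rintro ⟨ha, hk⟩
      refine ⟨⟨⟨chains_mono (fullSubcomplex_faces_subset Q) 2 ha, ?_⟩, ha⟩, hk⟩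
      rw [SetLike.mem_coe, Submodule.mem_comap, LinearMap.mem_ker.1 hk]
      exact Submodule.zero_mem _
  rw [← subDim_map_add_subDim_inf_ker (boundaryMap E)
    (relativeCycles M P ⊓ chains (fullSubcomplex M Q) 2), h1, h2]

theorem sublevel_neg (v : E) (a : EReal) :
    sublevel M (-v) (-a) = fullSubcomplex M fun x => ¬height v x < a := by
  rw [sublevel]
  congr 1
  funext x
  rw [height_neg, EReal.neg_le_neg_iff, not_lt]

theorem strictSublevel_neg (v : E) (a : EReal) :
    strictSublevel M (-v) (-a) = fullSubcomplex M fun x => ¬height v x ≤ a := by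
  rw [strictSublevel]
  congr 1
  funext x
  rw [height_neg, EReal.neg_lt_neg_iff, not_le]

/-- Both multiplicities are second differences over the four choices of strict or weak inequality at
`a` and at `b`. Applying `subDim_duality` to each choice, the terms depending on one inequality
alone cancel. Passing to `-v` complements the vertex sets and so exchanges strict and weak, which
leaves a second difference unchanged. -/
theorem IsHomologySphere.persistenceDiagram_one (hM : IsHomologySphere M z) (v : E) :
    persistenceDiagram 1 M v = (persistenceDiagram 0 M (-v)).flip := by
  funext p
  obtain ⟨⟨a, b⟩, hab⟩ := p
  simp only [PersistenceDiagram.flip]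
  by_cases ha : a = ⊥
  · subst ha
    rw [if_pos rfl]
    exact persistenceDiagram_eq_zero_of_cycles (sublevel_bot_cycles 1 v)
  rw [if_neg ha]
  by_cases hb : b = ⊤
  · subst hb
    -- All one-cycles bound in `M`, so none is essential; the mirrored point starts at `-∞`, where
    -- there are no cycles.
    refine (persistenceDiagram_apply_eq_zero ?_).trans
      (persistenceDiagram_eq_zero_of_cycles ?_).symm
    · simp only [dyingCycles, earlierCycles, strictSublevel_top]
      exact inf_le_left.trans ((le_inf le_rfl ((cycles_mono (fullSubcomplex_faces_subset _) 1).trans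
        hM.cycles_one)).trans le_sup_right)
    · simp only [EReal.neg_top]
      exact sublevel_bot_cycles 0 (-v)
  have ha' : -a ≠ ⊤ := fun h => ha (EReal.neg_eq_top_iff.1 h)
  change quotientDim (dyingCycles M v 1 a b) (earlierCycles M v 1 a b) =
    quotientDim (dyingCycles M (-v) 0 (-b) (-a)) (earlierCycles M (-v) 0 (-b) (-a))
  simp only [dyingCycles, earlierCycles, deadAt, if_neg hb, if_neg ha', sublevel_neg,
    strictSublevel_neg]
  simp only [sublevel, strictSublevel]
  have hfd : ∀ (R : E → Prop) k, FiniteDimensional (ZMod 2) (cycles (fullSubcomplex M R) k) :=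
    fun R k => finiteDimensional_cycles (hM.finite.subset (fullSubcomplex_faces_subset R)) k
  have hmono : ∀ R R' : E → Prop, (∀ x, R x → R' x) →
      (fullSubcomplex M R).faces ⊆ (fullSubcomplex M R').faces :=
    fun R R' h s hs => ⟨hs.1, fun x hx => h x (hs.2 x hx)⟩
  have h1 := quotientDim_second_difference
    (cycles_mono (hmono (fun x => height v x < a) (fun x => height v x ≤ a) fun x h => h.le) 1)
    (boundaries_mono (hmono (fun x => height v x < b) (fun x => height v x ≤ b) fun x h => h.le) 1)
  have h2 := quotientDim_second_difference
    (cycles_mono (hmono (fun x => ¬height v x ≤ b) (fun x => ¬height v x < b)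
      fun x h h' => h h'.le) 0)
    (boundaries_mono (hmono (fun x => ¬height v x ≤ a) (fun x => ¬height v x < a)
      fun x h h' => h h'.le) 0)
  have e1 := hM.subDim_duality (P := fun x => height v x ≤ a) (Q := fun x => height v x ≤ b)
    fun x h => h.trans hab.le
  have e2 := hM.subDim_duality (P := fun x => height v x < a) (Q := fun x => height v x ≤ b)
    fun x h => h.le.trans hab.le
  have e3 := hM.subDim_duality (P := fun x => height v x ≤ a) (Q := fun x => height v x < b)
    fun x h => h.trans_lt hab
  have e4 := hM.subDim_duality (P := fun x => height v x < a) (Q := fun x => height v x < b)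
    fun x h => h.trans hab
  omega

end Duality

/-! ### Triangulated circles and the final statement -/

section Main

variable {E : Type*} [NormedAddCommGroup E] [InnerProductSpace ℝ E]

theorem nonempty_of_homeomorph_sphere {X : Type*} [TopologicalSpace X] {n : ℕ} {S : Set X}
    (h : S ≃ₜ Metric.sphere (0 : EuclideanSpace ℝ (Fin (n + 1))) 1) : S.Nonempty := by
  have : (Metric.sphere (0 : EuclideanSpace ℝ (Fin (n + 1))) 1).Nonempty :=
    NormedSpace.sphere_nonempty.2 zero_le_one
  obtain ⟨x, hx⟩ := this
  exact ⟨_, (h.symm ⟨x, hx⟩).2⟩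

theorem circle_persistenceDiagrams [FiniteDimensional ℝ E] {M : SimplicialComplex ℝ E}
    (hfin : M.faces.Finite) (h : M.space ≃ₜ Metric.sphere (0 : EuclideanSpace ℝ (Fin 2)) 1) (v : E) :
    persistenceDiagram 1 M v = (persistenceDiagram 0 M (-v)).oppositeEssential ∧
      persistenceDiagram 2 M v = PersistenceDiagram.empty := by
  have hM : IsPuncturedSpace ℝ M.space := isPuncturedSpace_of_homeomorph_sphere
    ((PiLp.homeomorph 2 _).trans (Homeomorph.funUnique (Fin 1) ℝ)) h
  obtain ⟨z, hz⟩ := exists_hasFundamentalCycle_one hfin (nonempty_of_homeomorph_sphere h) hM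
  exact ⟨hz.persistenceDiagram_eq v,
    persistenceDiagram_eq_empty (fun s hs => card_ne_three hM hs) v⟩

end Main

end PHT

theorem mainTheorem5 :
    -- spheres in space
    (∀ M : Geometry.SimplicialComplex ℝ (EuclideanSpace ℝ (Fin 3)), M.faces.Finite →
      Nonempty (M.space ≃ₜ Metric.sphere (0 : EuclideanSpace ℝ (Fin 3)) 1) →
      ∀ v : EuclideanSpace ℝ (Fin 3), ‖v‖ = 1 →
        PHT.persistenceDiagram 1 M v = (PHT.persistenceDiagram 0 M (-v)).flip ∧
        PHT.persistenceDiagram 2 M v = (PHT.persistenceDiagram 0 M (-v)).oppositeEssential) ∧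
    -- circles in space
    (∀ M : Geometry.SimplicialComplex ℝ (EuclideanSpace ℝ (Fin 3)), M.faces.Finite →
      Nonempty (M.space ≃ₜ Metric.sphere (0 : EuclideanSpace ℝ (Fin 2)) 1) →
      ∀ v : EuclideanSpace ℝ (Fin 3), ‖v‖ = 1 →
        PHT.persistenceDiagram 1 M v = (PHT.persistenceDiagram 0 M (-v)).oppositeEssential ∧
        PHT.persistenceDiagram 2 M v = PHT.PersistenceDiagram.empty) ∧
    -- circles in the plane
    (∀ M : Geometry.SimplicialComplex ℝ (EuclideanSpace ℝ (Fin 2)), M.faces.Finite →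
      Nonempty (M.space ≃ₜ Metric.sphere (0 : EuclideanSpace ℝ (Fin 2)) 1) →
      ∀ v : EuclideanSpace ℝ (Fin 2), ‖v‖ = 1 →
        PHT.persistenceDiagram 1 M v = (PHT.persistenceDiagram 0 M (-v)).oppositeEssential ∧
        PHT.persistenceDiagram 2 M v = PHT.PersistenceDiagram.empty) := by
  refine ⟨fun M hfin ⟨h⟩ v _ => ?_, fun M hfin ⟨h⟩ v _ => PHT.circle_persistenceDiagrams hfin h v,
    fun M hfin ⟨h⟩ v _ => PHT.circle_persistenceDiagrams hfin h v⟩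
  have hM := PHT.isPuncturedSpace_of_homeomorph_sphere
    Complex.orthonormalBasisOneI.repr.symm.toHomeomorph h
  obtain ⟨z, hz⟩ := PHT.exists_isHomologySphere hfin (PHT.nonempty_of_homeomorph_sphere h) hM
    fun s hs => PHT.card_ne_four hM hs
  exact ⟨hz.persistenceDiagram_one v, hz.toHasFundamentalCycle.persistenceDiagram_eq v⟩
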